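/- **Theorem.** Let $N\ge 1$ and let $\Omega\subset\mathbb R^N$ be a bounded domain with smooth boundary. Let $\alpha,l,\sigma>0$, $\beta,\nu\ge0$, $\gamma>0$, $\mu\in\mathbb R$, $k,m,s\ge 1$, $r\ge p-1\ge \frac p2$, $m>\max\{p-1,r,\sigma\}$, $q\ge\frac p2$, $q+l>1$ and $k+s>\max\{p-1,q+l,r\}$. Consider the problem $$ \begin{cases} u_t-\operatorname{div}(|\nabla u|^{p-2}\nabla u)=\alpha|u|^{k-1}u\int_\Omega|u|^s\,dx-\beta|u|^{l-1}u|\nabla u|^q+\gamma u^m+\mu|\nabla u|^r-\nu|u|^{\sigma-1}u & \text{in }\Omega,\ t>0,\\ u=0 & \text{on }\partial\Omega,\ t>0,\\ u(\cdot,0)=u_0 & \text{in }\Omega, \end{cases}\tag{1} $$ with initial data $u_0\in W^{1,\infty}(\Omega)$, $u_0\ge0$, $u_0\not\equiv0$. Put $Q_S=\Omega\times(0,S)$ and $\tilde\alpha=\max\{p,k+s,l+q,m,r,\sigma\}$. A weak solution of (1) on $Q_S$ is a function $u\ge0$ with $u\in C([0,S)\times\overline\Omega)\cap L^{\tilde\alpha}(0,S;W^{1,\tilde\alpha}_0(\Omega))\cap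 L^\infty(0,S;W^{1,\infty}_0(\Omega))$ and $u_t\in L^2(Q_S)$, such that $u(\cdot,0)=u_0$ in $\Omega$, $u=0$ on $\partial\Omega\times(0,S)$, and, for all $0\le\phi\in C(\overline{Q_S})\cap L^p(0,S;W^{1,p}_0(\Omega))$, $$ \int_{Q_S}\big(u_t\phi+|\nabla u|^{p-2}\nabla u\cdot\nabla\phi\big)\,dx\,dt=\int_{Q_S}\Big(\alpha|u|^{k-1}u\int_\Omega|u|^s\,dx-\beta|u|^{l-1}u|\nabla u|^q+\gamma u^m+\mu|\nabla u|^r-\nu|u|^{\sigma-1}u\Big)\phi\,dx\,dt . $$ For $0<T\le\infty$, a solution on $[0,T)$ is a function that is a weak solution on $Q_S$ for every finite $0<S<T$. It is called maximal (in the $L^\infty$ sense), with $T_{\max}=T$, if $T=\infty$ or $\limsup_{t\uparrow T}\|u(\cdot,t)\|_{L^\infty(\Omega)}=\infty$. Then solutions with sufficiently large initial data blow up in $L^\infty$ in finite time. Precisely, for every ball $B(x_0,\rho)\subset\Omega$ with $\rho>0$ there are $C>0$, $\delta>0$, $t_0\in[0,1/\delta)$, $c>0$ and $\kappa>0$ (depending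 only on $\Omega$, on the parameters of (1), and on the ball) such that, for all initial data $u_0$ as above with $u_0\ge C$ on $B(x_0,\rho)$: 1. every solution $u$ on $[0,T)$, $0<T\le\infty$, satisfies $$T\le \frac1\delta-t_0\qquad\text{and}\qquad \|u(\cdot,t)\|_{L^\infty(\Omega)}\ge c\Big(\frac1\delta-t_0-t\Big)^{-\kappa}\quad\text{for all }0\le t<T;$$ 2. every maximal solution satisfies $T_{\max}\le\frac1\delta-t_0<\infty$ and $\limsup_{t\uparrow T_{\max}}\|u(\cdot,t)\|_{L^\infty(\Omega)}=\infty$. -/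

import Mathlib

open Set Filter Topology MeasureTheory
open scoped ENNReal ContDiff

noncomputable section

namespace PLaplace

/-- Euclidean space `ℝ^N`. -/
abbrev E (N : ℕ) : Type := EuclideanSpace ℝ (Fin N)

/-- The coefficients and exponents of the equation
`u_t - div(|∇u|^(p-2) ∇u) = α |u|^(k-1) u ∫_Ω |u|^s - β |u|^(l-1) u |∇u|^q + γ u^m
  + μ |∇u|^r - ν |u|^(σ-1) u`. -/
structure Params where
  (α β γ μ ν k l m p q r s σ : ℝ)

/-- The boundary of `Ω` is smooth: near every boundary point, `Ω` is the set where a smooth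
function with non-vanishing derivative is negative. -/
def HasSmoothBoundary {N : ℕ} (Ω : Set (E N)) : Prop :=
  ∀ x ∈ frontier Ω, ∃ U : Set (E N), IsOpen U ∧ x ∈ U ∧
    ∃ f : E N → ℝ, ContDiff ℝ ∞ f ∧ fderiv ℝ f x ≠ 0 ∧ U ∩ Ω = {y ∈ U | f y < 0}

/-- `C_c^∞(Ω)` -/
def IsTestFun {N : ℕ} (Ω : Set (E N)) (ψ : E N → ℝ) : Prop :=
  ContDiff ℝ ∞ ψ ∧ HasCompactSupport ψ ∧ tsupport ψ ⊆ Ω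

/-- `f ∈ W^{1,∞}(Ω)`. -/
def MemW1Infty {N : ℕ} (Ω : Set (E N)) (f : E N → ℝ) : Prop :=
  MemLp f ⊤ (volume.restrict Ω) ∧ ∃ g : E N → E N, MemLp g ⊤ (volume.restrict Ω) ∧
    ∀ ψ : E N → ℝ, IsTestFun Ω ψ →
      ∫ x in Ω, f x • gradient ψ x = - ∫ x in Ω, ψ x • g x

/-- `f ∈ W_0^{1,a}(Ω)` (the closure of `C_c^∞(Ω)` in `W^{1,a}(Ω)`, used for `1 ≤ a < ∞`),
and `g` is its weak gradient. -/
def MemW0 {N : ℕ} (Ω : Set (E N)) (a : ℝ≥0∞) (f : E N → ℝ) (g : E N → E N) : Prop :=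
  MemLp f a (volume.restrict Ω) ∧ MemLp g a (volume.restrict Ω) ∧
    ∃ ψ : ℕ → E N → ℝ, (∀ n, IsTestFun Ω (ψ n)) ∧
      Tendsto (fun n => eLpNorm (fun x => f x - ψ n x) a (volume.restrict Ω)) atTop (𝓝 0) ∧
      Tendsto (fun n => eLpNorm (fun x => g x - gradient (ψ n) x) a (volume.restrict Ω))
        atTop (𝓝 0)

/-- The cylinder `Q_T = Ω × (0,T)`, with the time variable written first. -/
def cyl {N : ℕ} (Ω : Set (E N)) (T : ℝ) : Set (ℝ × E N) := Ioo 0 T ×ˢ Ω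

/-- `f ∈ L^a(0,T; W_0^{1,a}(Ω))` (used for `1 ≤ a < ∞`), and `g` is its weak spatial gradient. -/
def MemLpW0 {N : ℕ} (Ω : Set (E N)) (T : ℝ) (a : ℝ≥0∞) (f : ℝ × E N → ℝ)
    (g : ℝ × E N → E N) : Prop :=
  MemLp f a (volume.restrict (cyl Ω T)) ∧ MemLp g a (volume.restrict (cyl Ω T)) ∧
    ∀ᵐ t ∂(volume.restrict (Ioo 0 T)), MemW0 Ω a (fun x => f (t, x)) (fun x => g (t, x))

/-- `w ∈ L^2(Q_T)` is the weak time derivative of `f` on `Q_T`. -/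
def IsWeakTimeDeriv {N : ℕ} (Ω : Set (E N)) (T : ℝ) (f w : ℝ × E N → ℝ) : Prop :=
  MemLp w 2 (volume.restrict (cyl Ω T)) ∧
    ∀ ψ : ℝ × E N → ℝ, ContDiff ℝ ∞ ψ → HasCompactSupport ψ → tsupport ψ ⊆ cyl Ω T →
      ∫ z in cyl Ω T, f z * fderiv ℝ ψ z (1, 0) = - ∫ z in cyl Ω T, w z * ψ z

/-- The largest of the exponents `p, k+s, l+q, m, r, σ`. -/
def Params.top (P : Params) : ℝ :=
  max P.p (max (P.k + P.s) (max (P.l + P.q) (max P.m (max P.r P.σ))))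

/-- The right-hand side of the equation for a function `u` with spatial gradient `g`, at the
point `z = (t, x)`. -/
def rhs {N : ℕ} (P : Params) (Ω : Set (E N)) (u : ℝ × E N → ℝ) (g : ℝ × E N → E N)
    (z : ℝ × E N) : ℝ :=
  P.α * (|u z| ^ (P.k - 1) * u z) * (∫ y in Ω, |u (z.1, y)| ^ P.s)
    - P.β * (|u z| ^ (P.l - 1) * u z) * ‖g z‖ ^ P.q
    + P.γ * u z ^ P.m + P.μ * ‖g z‖ ^ P.r - P.ν * (|u z| ^ (P.σ - 1) * u z)

/-- `u` is a (nonnegative) weak solution on `Q_T`, with initial datum `u₀` and zero lateral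
boundary values, in the class `L^∞(0,T; W_0^{1,∞}(Ω))` of the comparison principle. -/
def IsWeakSolution {N : ℕ} (P : Params) (Ω : Set (E N)) (u₀ : E N → ℝ) (T : ℝ)
    (u : ℝ × E N → ℝ) : Prop :=
  (∀ z ∈ Ico 0 T ×ˢ closure Ω, 0 ≤ u z) ∧
  ContinuousOn u (Ico 0 T ×ˢ closure Ω) ∧
  (∀ x ∈ Ω, u (0, x) = u₀ x) ∧
  (∀ t ∈ Ioo 0 T, ∀ x ∈ frontier Ω, u (t, x) = 0) ∧
  ∃ (g : ℝ × E N → E N) (w : ℝ × E N → ℝ),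
    MemLpW0 Ω T (ENNReal.ofReal P.top) u g ∧
    MemLp u ⊤ (volume.restrict (cyl Ω T)) ∧ MemLp g ⊤ (volume.restrict (cyl Ω T)) ∧
    IsWeakTimeDeriv Ω T u w ∧
    ∀ (φ : ℝ × E N → ℝ) (h : ℝ × E N → E N),
      ContinuousOn φ (Icc 0 T ×ˢ closure Ω) → (∀ z ∈ Icc 0 T ×ˢ closure Ω, 0 ≤ φ z) →
      MemLpW0 Ω T (ENNReal.ofReal P.p) φ h →
      ∫ z in cyl Ω T, (w z * φ z + ‖g z‖ ^ (P.p - 2) * inner ℝ (g z) (h z))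
        = ∫ z in cyl Ω T, rhs P Ω u g z * φ z

/-- `u` is a weak solution on `Ω × [0,T)`, `0 < T ≤ ∞`: a weak solution on `Q_S` for every
finite `S < T`. -/
def IsSolutionUpTo {N : ℕ} (P : Params) (Ω : Set (E N)) (u₀ : E N → ℝ) (T : ℝ≥0∞)
    (u : ℝ × E N → ℝ) : Prop :=
  0 < T ∧ ∀ S : ℝ, 0 < S → ENNReal.ofReal S < T → IsWeakSolution P Ω u₀ S u

/-- Admissible initial data: `u₀ ≥ 0`, `u₀ ≢ 0`, `u₀ ∈ W^{1,∞}(Ω)`. -/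
def IsInitialDatum {N : ℕ} (Ω : Set (E N)) (u₀ : E N → ℝ) : Prop :=
  (∀ x ∈ Ω, 0 ≤ u₀ x) ∧ ¬ (u₀ =ᵐ[volume.restrict Ω] 0) ∧ MemW1Infty Ω u₀

/-- `‖u(t)‖_{L^∞(Ω)}` -/
def supNorm {N : ℕ} (Ω : Set (E N)) (u : ℝ × E N → ℝ) (t : ℝ) : ℝ≥0∞ :=
  eLpNorm (fun x => u (t, x)) ⊤ (volume.restrict Ω)

/-- `u` blows up in `L^∞` at the finite time `T`: `limsup_{t ↑ T} ‖u(t)‖_{L^∞(Ω)} = ∞`. -/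
def BlowsUpAt {N : ℕ} (Ω : Set (E N)) (u : ℝ × E N → ℝ) (T : ℝ≥0∞) : Prop :=
  T ≠ ⊤ ∧ limsup (supNorm Ω u) (𝓝[<] T.toReal) = ⊤

/-- `u` is a solution and `T` is its maximal existence time in the `L^∞` sense: either `u` is
global, or its sup norm is unbounded as `t ↑ T`. -/
def IsMaximalUpTo {N : ℕ} (P : Params) (Ω : Set (E N)) (u₀ : E N → ℝ) (T : ℝ≥0∞)
    (u : ℝ × E N → ℝ) : Prop :=
  IsSolutionUpTo P Ω u₀ T u ∧ (T = ⊤ ∨ BlowsUpAt Ω u T)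

end PLaplace

end

/-!
The solution is compared with a self-similar subsolution that blows up at a point. With `τ = τ₀ - t`
the time left, the barrier is the growing and shrinking paraboloid

  `W(t, x) = τ ^ (-κ) * (1 - |x - x₀|² / τ ^ (2θ))`.

Where `W` is at least a fixed fraction of its maximum, the two reaction terms are of order
`τ ^ (-κ m)` and `τ ^ (-κ (k + s) + θ N)`. For suitable `κ` and small `θ`
(`PLaplace.Params.exists_similarity_exponents`) one of them dominates `∂ₜW`, which is of order
`τ ^ (-κ - 1)`, while diffusion, damping, the gradient term and absorption are of lower order than
`∂ₜW`. Near the edge of the positivity set `{W > 0}` the reaction is of no use, but there the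
shrinking of the set makes `∂ₜW` *negative* of order `τ ^ (-κ - 1)`, which outweighs the
unfavourable terms. Hence `W` is a subsolution where it is positive, if `τ₀` is small
(`PLaplace.exists_self_similar_subsolution`), and so it stays below every solution whose datum is
at least `C = τ₀ ^ (-κ)` on the ball. At the centre this says `u(t, x₀) ≥ τ ^ (-κ)`: no solution
lives beyond `τ = 0`, and its norm obeys the stated lower bound.

The comparison `W ≤ u` (`PLaplace.barrier_le`) comes from testing the equation with
`exp (-λ t) (W - u)₊²`, whose energy is `∫ exp (-λ t) (W - u)₊³`. The square is used because it is a
`C¹` function of `W - u`. The monotonicity of the `p`-Laplacian controls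
`(|∇W| ^ (p/2) - |∇u| ^ (p/2))²`. Since `q, r ≥ p / 2`, the gradient terms are Lipschitz functions of
`|∇u| ^ (p/2)` on bounded sets, so Young's inequality absorbs their differences
(`PLaplace.Params.exists_source_diff_le`). The nonlocal term contributes the product of
`∫ (W - u)₊²` and `∫ (W - u)₊`, which `PLaplace.integral_sq_mul_integral_le` bounds by the energy.

Two facts about weak derivatives justify the testing. In space, `(W - u)₊²`, truncated to linear
growth above a height that `W - u` does not reach, is a Sobolev function vanishing at the boundary
(`PLaplace.MemW0.truncSq_sub`). In time, `u` is for almost every `x` a primitive of its weak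
derivative (`PLaplace.IsWeakTimeDeriv.ae_eq_integral`), so the chain rule holds there.
-/


namespace PLaplace

/-! ### Elementary inequalities -/

lemma rpow_sub_rpow_le {e x y M : ℝ} (he : 1 ≤ e) (hy : 0 ≤ y) (hxy : y ≤ x) (hxM : x ≤ M) :
    x ^ e - y ^ e ≤ e * M ^ (e - 1) * (x - y) := by
  rcases (hy.trans hxy).eq_or_lt with h0 | hx
  · have : y = x := le_antisymm hxy (h0 ▸ hy)
    simp [this]
  have h1 : 1 + e * (y / x - 1) ≤ (1 + (y / x - 1)) ^ e :=
    one_add_mul_self_le_rpow_one_add (by have : 0 ≤ y / x := by positivity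
                                         linarith) he
  have h2 : (1 + (y / x - 1)) ^ e = y ^ e / x ^ e := by
    rw [add_sub_cancel, Real.div_rpow hy hx.le]
  have hxe : 0 < x ^ e := Real.rpow_pos_of_pos hx e
  have h3 : x ^ e = x ^ (e - 1) * x := by
    rw [Real.rpow_sub_one hx.ne', div_mul_cancel₀ _ hx.ne']
  have h4 : x ^ (e - 1) ≤ M ^ (e - 1) := Real.rpow_le_rpow hx.le hxM (by linarith)
  rw [h2, le_div_iff₀ hxe] at h1
  have h5 : (1 + e * (y / x - 1)) * x ^ e = x ^ e - e * x ^ (e - 1) * (x - y) := by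
    rw [h3]; field_simp; ring
  have h6 : e * x ^ (e - 1) * (x - y) ≤ e * M ^ (e - 1) * (x - y) := by
    gcongr
  linarith

/-- On bounded intervals a power `X ^ r` is Lipschitz as a function of `X ^ b`, if `b ≤ r`. -/
lemma abs_rpow_sub_rpow_le {r b X Y M : ℝ} (hb : 0 < b) (hbr : b ≤ r) (hX : 0 ≤ X) (hY : 0 ≤ Y)
    (hXM : X ≤ M) (hYM : Y ≤ M) :
    |X ^ r - Y ^ r| ≤ r / b * (M ^ b) ^ (r / b - 1) * |X ^ b - Y ^ b| := by
  wlog h : Y ≤ X generalizing X Y with H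
  · rw [abs_sub_comm, abs_sub_comm (X ^ b)]
    exact H hY hX hYM hXM (le_of_not_ge h)
  have e1 : ∀ Z : ℝ, 0 ≤ Z → Z ^ r = (Z ^ b) ^ (r / b) := fun Z hZ => by
    rw [← Real.rpow_mul hZ]; congr 1; field_simp
  have h1 : Y ^ b ≤ X ^ b := Real.rpow_le_rpow hY h hb.le
  have h2 : Y ^ r ≤ X ^ r := Real.rpow_le_rpow hY h (hb.le.trans hbr)
  rw [abs_of_nonneg (sub_nonneg.2 h1), abs_of_nonneg (sub_nonneg.2 h2), e1 X hX, e1 Y hY]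
  exact rpow_sub_rpow_le ((one_le_div hb).2 hbr) (by positivity) h1
    (Real.rpow_le_rpow hX hXM hb.le)

lemma sq_rpow_half_sub_le {p X Y : ℝ} (hp : 2 ≤ p) (hX : 0 ≤ X) (hY : 0 ≤ Y) :
    2 / p * (X ^ (p / 2) - Y ^ (p / 2)) ^ 2 ≤ (X ^ (p - 1) - Y ^ (p - 1)) * (X - Y) := by
  wlog h : Y ≤ X generalizing X Y with H
  · have := H hY hX (le_of_not_ge h)
    linarith
  have h1 : Y ^ (p / 2) ≤ X ^ (p / 2) := Real.rpow_le_rpow hY h (by linarith)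
  have h2 : X ^ (p / 2) - Y ^ (p / 2) ≤ p / 2 * X ^ (p / 2 - 1) * (X - Y) :=
    rpow_sub_rpow_le (by linarith) hY h le_rfl
  have split : ∀ Z : ℝ, 0 ≤ Z → Z ^ (p - 1) = Z ^ (p / 2 - 1) * Z ^ (p / 2) := fun Z hZ => by
    rw [← Real.rpow_add_of_nonneg hZ (by linarith) (by linarith)]; ring_nf
  have h3 : X ^ (p / 2 - 1) * (X ^ (p / 2) - Y ^ (p / 2)) ≤ X ^ (p - 1) - Y ^ (p - 1) := by
    have : Y ^ (p / 2 - 1) * Y ^ (p / 2) ≤ X ^ (p / 2 - 1) * Y ^ (p / 2) := by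
      gcongr
      linarith
    rw [split X hX, split Y hY]
    linarith
  have hXY := sub_nonneg.2 h
  have hd := sub_nonneg.2 h1
  calc 2 / p * (X ^ (p / 2) - Y ^ (p / 2)) ^ 2
      = 2 / p * (X ^ (p / 2) - Y ^ (p / 2)) * (X ^ (p / 2) - Y ^ (p / 2)) := by ring
    _ ≤ 2 / p * (X ^ (p / 2) - Y ^ (p / 2)) * (p / 2 * X ^ (p / 2 - 1) * (X - Y)) := by gcongr
    _ = X ^ (p / 2 - 1) * (X ^ (p / 2) - Y ^ (p / 2)) * (X - Y) := by
        field_simp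
    _ ≤ _ := by gcongr

/-- Strong monotonicity of the field `ξ ↦ |ξ|^(p-2) ξ`, measured by `|ξ|^(p/2)`. -/
lemma inner_rpow_smul_sub_ge {V : Type*} [NormedAddCommGroup V] [InnerProductSpace ℝ V]
    {p : ℝ} (hp : 2 ≤ p) (ξ η : V) :
    2 / p * (‖ξ‖ ^ (p / 2) - ‖η‖ ^ (p / 2)) ^ 2 ≤
      ‖ξ‖ ^ (p - 2) * inner ℝ ξ (ξ - η) - ‖η‖ ^ (p - 2) * inner ℝ η (ξ - η) := by
  have split : ∀ Z : ℝ, 0 ≤ Z → Z ^ (p - 1) = Z ^ (p - 2) * Z := fun Z hZ => by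
    conv_rhs => rw [← Real.rpow_one Z, ← Real.rpow_mul hZ, one_mul]
    rw [← Real.rpow_add_of_nonneg hZ (by linarith) (by linarith)]; ring_nf
  refine (sq_rpow_half_sub_le hp (norm_nonneg ξ) (norm_nonneg η)).trans ?_
  rw [split _ (norm_nonneg ξ), split _ (norm_nonneg η), inner_sub_right, inner_sub_right,
    real_inner_self_eq_norm_sq, real_inner_self_eq_norm_sq, real_inner_comm ξ η]
  have h1 := real_inner_le_norm ξ η
  have h2 : 0 ≤ ‖ξ‖ ^ (p - 2) := by positivity
  have h3 : 0 ≤ ‖η‖ ^ (p - 2) := by positivity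
  nlinarith [mul_le_mul_of_nonneg_left h1 h2, mul_le_mul_of_nonneg_left h1 h3]

/-! ### Truncated squares and their smooth approximations -/

/-- The truncated square: it is `s²` for `0 ≤ s ≤ K`, vanishes for `s ≤ 0` and is affine for
`s ≥ K`. -/
def truncSq (K s : ℝ) : ℝ := max s 0 ^ 2 - max (s - K) 0 ^ 2

/-- The derivative of `truncSq K`. -/
def truncSqDeriv (K s : ℝ) : ℝ := 2 * (max s 0 - max (s - K) 0)

/-- A smooth approximation of `s ↦ max s 0 ^ 2`, which vanishes for `s ≤ 0`. -/
noncomputable def smoothSq (ε s : ℝ) : ℝ := s ^ 2 * expNegInvGlue (s / ε)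

/-- The derivative of `smoothSq ε`. -/
noncomputable def smoothSqDeriv (ε s : ℝ) : ℝ := (2 * s + ε) * expNegInvGlue (s / ε)

/-- A smooth approximation of `truncSq K`, which vanishes for `s ≤ 0`. -/
noncomputable def smoothTruncSq (ε K s : ℝ) : ℝ := smoothSq ε s - smoothSq ε (s - K)

/-- The derivative of `smoothTruncSq ε K`. -/
noncomputable def smoothTruncSqDeriv (ε K s : ℝ) : ℝ := smoothSqDeriv ε s - smoothSqDeriv ε (s - K)

lemma truncSq_of_le {K s : ℝ} (h : s ≤ K) : truncSq K s = max s 0 ^ 2 := by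
  simp [truncSq, max_eq_right (sub_nonpos.2 h)]

lemma truncSq_nonneg {K : ℝ} (hK : 0 ≤ K) (s : ℝ) : 0 ≤ truncSq K s := by
  have h : max (s - K) 0 ≤ max s 0 := max_le_max (by linarith) le_rfl
  have h0 : 0 ≤ max (s - K) 0 := le_max_right _ _
  exact sub_nonneg.2 (pow_le_pow_left₀ h0 h 2)

lemma truncSqDeriv_of_le {K s : ℝ} (h : s ≤ K) : truncSqDeriv K s = 2 * max s 0 := by
  simp [truncSqDeriv, max_eq_right (sub_nonpos.2 h)]

lemma abs_max_zero_sub_le (a b : ℝ) : |max a 0 - max b 0| ≤ |a - b| :=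
  abs_max_sub_max_le_abs a b 0

lemma abs_truncSqDeriv_sub_le (K a b : ℝ) :
    |truncSqDeriv K a - truncSqDeriv K b| ≤ 4 * |a - b| := by
  have h1 := abs_max_zero_sub_le a b
  have h2 := abs_max_zero_sub_le (a - K) (b - K)
  rw [sub_sub_sub_cancel_right] at h2
  have : truncSqDeriv K a - truncSqDeriv K b
      = 2 * (max a 0 - max b 0) - 2 * (max (a - K) 0 - max (b - K) 0) := by
    simp only [truncSqDeriv]; ring
  rw [this]
  refine (abs_sub _ _).trans ?_
  rw [abs_mul, abs_mul, abs_two]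
  linarith

lemma expNegInvGlue_div_of_pos {ε s : ℝ} (hε : 0 < ε) (hs : 0 < s) :
    expNegInvGlue (s / ε) = Real.exp (-(ε / s)) := by
  have : ¬ s / ε ≤ 0 := not_le.2 (by positivity)
  simp [expNegInvGlue, this]

lemma expNegInvGlue_div_of_nonpos {ε s : ℝ} (hε : 0 < ε) (hs : s ≤ 0) :
    expNegInvGlue (s / ε) = 0 :=
  expNegInvGlue.zero_of_nonpos (div_nonpos_of_nonpos_of_nonneg hs hε.le)

lemma contDiff_smoothTruncSq (ε K : ℝ) : ContDiff ℝ ∞ (smoothTruncSq ε K) := by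
  have h : ContDiff ℝ ∞ (smoothSq ε) :=
    (contDiff_id.pow 2).mul (expNegInvGlue.contDiff.comp (contDiff_id.div_const ε))
  exact h.sub (h.comp (contDiff_id.sub contDiff_const))

lemma hasDerivAt_smoothSq {ε : ℝ} (hε : 0 < ε) (s : ℝ) :
    HasDerivAt (smoothSq ε) (smoothSqDeriv ε s) s := by
  have h1 : HasDerivAt expNegInvGlue ((s / ε)⁻¹ ^ 2 * expNegInvGlue (s / ε)) (s / ε) := by
    have := expNegInvGlue.hasDerivAt_polynomial_eval_inv_mul 1 (s / ε)
    simpa using this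
  have h2 : HasDerivAt (fun x : ℝ => x / ε) (1 / ε) s := (hasDerivAt_id s).div_const ε
  have h3 := ((hasDerivAt_id s).pow 2).mul (h1.comp s h2)
  refine h3.congr_deriv ?_
  rcases le_or_gt s 0 with hs | hs
  · simp [smoothSqDeriv, expNegInvGlue_div_of_nonpos hε hs]
  · simp only [smoothSqDeriv, Function.comp, id]
    simp only [Pi.pow_apply, id]
    field_simp
    ring

lemma hasDerivAt_smoothTruncSq {ε : ℝ} (hε : 0 < ε) (K s : ℝ) :
    HasDerivAt (smoothTruncSq ε K) (smoothTruncSqDeriv ε K s) s := by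
  have h := (hasDerivAt_smoothSq hε (s - K)).comp s ((hasDerivAt_id s).sub_const K)
  rw [mul_one] at h
  exact (hasDerivAt_smoothSq hε s).sub h

lemma smoothSq_of_nonpos {ε s : ℝ} (hε : 0 < ε) (hs : s ≤ 0) : smoothSq ε s = 0 := by
  simp [smoothSq, expNegInvGlue_div_of_nonpos hε hs]

lemma smoothTruncSq_of_nonpos {ε K s : ℝ} (hε : 0 < ε) (hK : 0 ≤ K) (hs : s ≤ 0) :
    smoothTruncSq ε K s = 0 := by
  rw [smoothTruncSq, smoothSq_of_nonpos hε hs, smoothSq_of_nonpos hε (by linarith), sub_zero]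

lemma abs_smoothSqDeriv_sub_le {ε : ℝ} (hε : 0 < ε) (s : ℝ) :
    |smoothSqDeriv ε s - 2 * max s 0| ≤ 2 * ε := by
  rcases le_or_gt s 0 with hs | hs
  · simp [smoothSqDeriv, expNegInvGlue_div_of_nonpos hε hs, max_eq_right hs, hε.le]
  · rw [smoothSqDeriv, expNegInvGlue_div_of_pos hε hs, max_eq_left hs.le]
    have h1 := Real.add_one_le_exp (-(ε / s))
    have h2 : Real.exp (-(ε / s)) ≤ 1 := Real.exp_le_one_iff.2 (by
      have : 0 < ε / s := by positivity
      linarith)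
    have h3 := Real.exp_pos (-(ε / s))
    have h4 : s * (ε / s) = ε := by field_simp
    rw [abs_le]
    constructor <;> nlinarith

lemma abs_smoothSq_sub_le {ε : ℝ} (hε : 0 < ε) (s : ℝ) :
    |smoothSq ε s - max s 0 ^ 2| ≤ ε * max s 0 := by
  rcases le_or_gt s 0 with hs | hs
  · simp [smoothSq, expNegInvGlue_div_of_nonpos hε hs, max_eq_right hs]
  · rw [smoothSq, expNegInvGlue_div_of_pos hε hs, max_eq_left hs.le]
    have h1 := Real.add_one_le_exp (-(ε / s))
    have h2 : Real.exp (-(ε / s)) ≤ 1 := Real.exp_le_one_iff.2 (by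
      have : 0 < ε / s := by positivity
      linarith)
    have h4 : s ^ 2 * (ε / s) = ε * s := by field_simp
    rw [abs_le]
    constructor <;> nlinarith [sq_nonneg s]

lemma abs_smoothTruncSqDeriv_sub_le {ε : ℝ} (hε : 0 < ε) (K s : ℝ) :
    |smoothTruncSqDeriv ε K s - truncSqDeriv K s| ≤ 4 * ε := by
  have h1 := abs_smoothSqDeriv_sub_le hε s
  have h2 := abs_smoothSqDeriv_sub_le hε (s - K)
  have : smoothTruncSqDeriv ε K s - truncSqDeriv K s = (smoothSqDeriv ε s - 2 * max s 0)
      - (smoothSqDeriv ε (s - K) - 2 * max (s - K) 0) := by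
    simp only [smoothTruncSqDeriv, truncSqDeriv]; ring
  rw [this]
  refine (abs_sub _ _).trans ?_
  linarith

lemma abs_truncSqDeriv_le {K : ℝ} (hK : 0 ≤ K) (s : ℝ) : |truncSqDeriv K s| ≤ 2 * K := by
  have h : |max s 0 - max (s - K) 0| ≤ |s - (s - K)| := abs_max_zero_sub_le _ _
  rw [sub_sub_cancel, abs_of_nonneg hK] at h
  rw [truncSqDeriv, abs_mul, abs_two]
  linarith

lemma abs_smoothTruncSqDeriv_le {ε K : ℝ} (hε : 0 < ε) (hK : 0 ≤ K) (s : ℝ) :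
    |smoothTruncSqDeriv ε K s| ≤ 2 * K + 4 * ε := by
  have h1 := abs_smoothTruncSqDeriv_sub_le hε K s
  have h2 := abs_truncSqDeriv_le hK s
  have := abs_add_le (smoothTruncSqDeriv ε K s - truncSqDeriv K s) (truncSqDeriv K s)
  rw [sub_add_cancel] at this
  linarith

lemma abs_smoothTruncSq_sub_le {ε K : ℝ} (hε : 0 < ε) (hK : 0 ≤ K) (a b : ℝ) :
    |smoothTruncSq ε K a - smoothTruncSq ε K b| ≤ (2 * K + 4 * ε) * |a - b| := by
  have := Convex.norm_image_sub_le_of_norm_hasDerivWithin_le (𝕜 := ℝ) (s := univ)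
    (f := smoothTruncSq ε K) (f' := smoothTruncSqDeriv ε K) (C := 2 * K + 4 * ε) (x := b) (y := a)
    (fun x _ => (hasDerivAt_smoothTruncSq hε K x).hasDerivWithinAt)
    (fun x _ => abs_smoothTruncSqDeriv_le hε hK x) convex_univ trivial trivial
  simpa [Real.norm_eq_abs] using this

lemma abs_smoothTruncSq_sub_truncSq_le {ε K s : ℝ} (hε : 0 < ε) (hK : 0 ≤ K) (hs : s ≤ K) :
    |smoothTruncSq ε K s - truncSq K s| ≤ ε * K := by
  rw [smoothTruncSq, smoothSq_of_nonpos hε (sub_nonpos.2 hs), sub_zero, truncSq_of_le hs]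
  refine (abs_smoothSq_sub_le hε s).trans ?_
  gcongr
  exact max_le hs hK

/-! ### Truncated squares of differences with a Sobolev function -/

lemma continuous_truncSq (K : ℝ) : Continuous (truncSq K) := by
  unfold truncSq; fun_prop

lemma continuous_truncSqDeriv (K : ℝ) : Continuous (truncSqDeriv K) := by
  unfold truncSqDeriv; fun_prop

lemma continuous_gradient {N : ℕ} {f : E N → ℝ} (hf : ContDiff ℝ ∞ f) :
    Continuous (gradient f) :=
  (InnerProductSpace.toDual ℝ (E N)).symm.continuous.comp (hf.continuous_fderiv (by simp))

lemma tendsto_eLpNorm_zero_of_bound {X F G : Type*} [MeasurableSpace X]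
    [NormedAddCommGroup F] [NormedAddCommGroup G] {μ : Measure X} [IsFiniteMeasure μ]
    {p : ℝ≥0∞} (hp : 1 ≤ p) {A : ℕ → X → F} {B : ℕ → X → ℝ} {D : ℕ → X → G} {c : ℕ → ℝ} {L : ℝ}
    (hB : ∀ n, AEStronglyMeasurable (B n) μ) (hD : ∀ n, AEStronglyMeasurable (D n) μ)
    (hA : ∀ n, ∀ᵐ x ∂μ, ‖A n x‖ ≤ c n + L * (‖B n x‖ + ‖D n x‖))
    (hc : Tendsto c atTop (𝓝 0))
    (hBt : Tendsto (fun n => eLpNorm (B n) p μ) atTop (𝓝 0))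
    (hDt : Tendsto (fun n => eLpNorm (D n) p μ) atTop (𝓝 0)) :
    Tendsto (fun n => eLpNorm (A n) p μ) atTop (𝓝 0) := by
  have key : ∀ n, eLpNorm (A n) p μ ≤ eLpNorm (fun _ : X => c n) p μ
      + ‖L‖ₑ * (eLpNorm (B n) p μ + eLpNorm (D n) p μ) := fun n => by
    refine (eLpNorm_mono_ae_real (hA n)).trans ?_
    refine (eLpNorm_add_le aestronglyMeasurable_const
      (((hB n).norm.add (hD n).norm).const_mul L) hp).trans ?_
    gcongr
    refine (eLpNorm_const_smul_le (c := L) (f := fun x => ‖B n x‖ + ‖D n x‖)).trans ?_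
    gcongr
    refine (eLpNorm_add_le (hB n).norm (hD n).norm hp).trans ?_
    rw [eLpNorm_norm, eLpNorm_norm]
  have hct : Tendsto (fun n => eLpNorm (fun _ : X => c n) p μ) atTop (𝓝 0) := by
    have hb : ∀ n, eLpNorm (fun _ : X => c n) p μ ≤ ‖c n‖ₑ * eLpNorm (fun _ : X => (1 : ℝ)) p μ :=
      fun n => by
        have := eLpNorm_const_smul_le (c := c n) (f := fun _ : X => (1 : ℝ)) (p := p) (μ := μ)
        have e : (c n • fun _ : X => (1 : ℝ)) = fun _ => c n := by ext; simp
        rwa [e] at this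
    have h1 : Tendsto (fun n => ‖c n‖ₑ * eLpNorm (fun _ : X => (1 : ℝ)) p μ) atTop (𝓝 0) := by
      have h2 : Tendsto (fun n => ‖c n‖ₑ) atTop (𝓝 0) := by
        have := (continuous_enorm.tendsto (0 : ℝ)).comp hc
        simpa [Function.comp_def] using this
      have := ENNReal.Tendsto.mul_const (b := eLpNorm (fun _ : X => (1 : ℝ)) p μ) h2
        (Or.inr (memLp_const (1 : ℝ)).2.ne)
      simpa using this
    exact tendsto_of_tendsto_of_tendsto_of_le_of_le tendsto_const_nhds h1 (fun _ => zero_le) hb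
  have hlim : Tendsto (fun n => eLpNorm (fun _ : X => c n) p μ
      + ‖L‖ₑ * (eLpNorm (B n) p μ + eLpNorm (D n) p μ)) atTop (𝓝 0) := by
    have := hct.add (ENNReal.Tendsto.const_mul (a := ‖L‖ₑ) (hBt.add hDt) (Or.inr enorm_ne_top))
    simpa using this
  exact tendsto_of_tendsto_of_tendsto_of_le_of_le tendsto_const_nhds hlim (fun _ => zero_le) key

lemma tendsto_eLpNorm_zero_of_exponent_le {X F : Type*} [MeasurableSpace X]
    [NormedAddCommGroup F] {μ : Measure X} [IsFiniteMeasure μ] {p a : ℝ≥0∞} (hpa : p ≤ a)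
    {A : ℕ → X → F} (hA : ∀ n, AEStronglyMeasurable (A n) μ)
    (h : Tendsto (fun n => eLpNorm (A n) a μ) atTop (𝓝 0)) :
    Tendsto (fun n => eLpNorm (A n) p μ) atTop (𝓝 0) := by
  rcases eq_or_ne p 0 with rfl | hp0
  · simp
  have hb := fun n => eLpNorm_le_eLpNorm_mul_rpow_measure_univ hpa (hA n)
  have hexp : 0 ≤ 1 / p.toReal - 1 / a.toReal := by
    rcases eq_or_ne a ⊤ with rfl | ha
    · simp
    · have hp : p ≠ ⊤ := (hpa.trans_lt ha.lt_top).ne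
      have := ENNReal.toReal_mono ha hpa
      have h0 := ENNReal.toReal_pos hp0 hp
      exact sub_nonneg.2 (one_div_le_one_div_of_le h0 this)
  have h1 := ENNReal.Tendsto.mul_const (b := μ univ ^ (1 / p.toReal - 1 / a.toReal)) h
    (Or.inr (ENNReal.rpow_ne_top_of_nonneg hexp (measure_ne_top μ univ)))
  rw [zero_mul] at h1
  exact tendsto_of_tendsto_of_tendsto_of_le_of_le tendsto_const_nhds h1 (fun _ => zero_le) hb

lemma gradient_smoothTruncSq_comp {N : ℕ} {ε K : ℝ} (hε : 0 < ε) {v : E N → ℝ} {x : E N}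
    (hv : DifferentiableAt ℝ v x) :
    gradient (fun y => smoothTruncSq ε K (v y)) x
      = smoothTruncSqDeriv ε K (v x) • gradient v x := by
  have h := (hasDerivAt_smoothTruncSq hε K (v x)).comp_hasFDerivAt x hv.hasFDerivAt
  have h' : fderiv ℝ (fun y => smoothTruncSq ε K (v y)) x
      = smoothTruncSqDeriv ε K (v x) • fderiv ℝ v x := h.fderiv
  simp [gradient, h']

lemma gradient_sub {N : ℕ} {v f : E N → ℝ} {x : E N} (hv : DifferentiableAt ℝ v x)
    (hf : DifferentiableAt ℝ f x) :
    gradient (fun y => v y - f y) x = gradient v x - gradient f x := by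
  have h' : fderiv ℝ (fun y => v y - f y) x = fderiv ℝ v x - fderiv ℝ f x :=
    fderiv_fun_sub hv hf
  simp [gradient, h']

/-- A truncated square of `W - f`, with `f` a Sobolev function with zero boundary values and `W`
smooth and nonpositive off a compact set, is again a Sobolev function with zero boundary values.
As the truncated square has a bounded Lipschitz derivative, the chain rule holds along the
approximating test functions, and no discussion of the set `{W = f}` is needed. -/
lemma MemW0.truncSq_sub {N : ℕ} {Ω : Set (E N)} (hΩ : volume Ω < ⊤)
    {a p : ℝ≥0∞} (hpa : p ≤ a) (hp : 1 ≤ p) {f : E N → ℝ} {g : E N → E N} (h : MemW0 Ω a f g)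
    {W : E N → ℝ} (hW : ContDiff ℝ ∞ W) {S : Set (E N)} (hS : IsCompact S) (hSΩ : S ⊆ Ω)
    (hneg : ∀ x ∉ S, W x ≤ 0) {K M : ℝ} (hK : 0 ≤ K)
    (hWK : ∀ᵐ x ∂(volume.restrict Ω), W x - f x ≤ K)
    (hM : ∀ᵐ x ∂(volume.restrict Ω), ‖gradient W x - g x‖ ≤ M) :
    MemW0 Ω p (fun x => truncSq K (W x - f x))
      (fun x => truncSqDeriv K (W x - f x) • (gradient W x - g x)) := by
  obtain ⟨hf, hg, ψ, hψ, hψf, hψg⟩ := h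
  have : IsFiniteMeasure (volume.restrict Ω) := ⟨by simpa using hΩ⟩
  have hM0 : 0 ≤ max M 0 := le_max_right _ _
  have hM' : ∀ᵐ x ∂(volume.restrict Ω), ‖gradient W x - g x‖ ≤ max M 0 := by
    filter_upwards [hM] with x hx using hx.trans (le_max_left _ _)
  have mWf : AEStronglyMeasurable (fun x => W x - f x) (volume.restrict Ω) :=
    hW.continuous.aestronglyMeasurable.sub hf.1
  have mWg : AEStronglyMeasurable (fun x => gradient W x - g x) (volume.restrict Ω) :=
    (continuous_gradient hW).aestronglyMeasurable.sub hg.1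
  have mB : ∀ n, AEStronglyMeasurable (fun x => f x - ψ n x) (volume.restrict Ω) := fun n =>
    hf.1.sub (hψ n).1.continuous.aestronglyMeasurable
  have mD : ∀ n, AEStronglyMeasurable (fun x => g x - gradient (ψ n) x) (volume.restrict Ω) :=
    fun n => hg.1.sub (continuous_gradient (hψ n).1).aestronglyMeasurable
  have hBt := tendsto_eLpNorm_zero_of_exponent_le hpa mB hψf
  have hDt := tendsto_eLpNorm_zero_of_exponent_le hpa mD hψg
  set ε : ℕ → ℝ := fun n => 1 / ((n : ℝ) + 1) with hεdef
  have hε : ∀ n, 0 < ε n := fun n => by positivity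
  have hε1 : ∀ n, ε n ≤ 1 := fun n => by
    rw [hεdef]; simp only; rw [div_le_one (by positivity)]
    have : (0 : ℝ) ≤ n := Nat.cast_nonneg n
    linarith
  have hεt : Tendsto ε atTop (𝓝 0) := tendsto_one_div_add_atTop_nhds_zero_nat
  refine ⟨?_, ?_, fun n x => smoothTruncSq (ε n) K (W x - ψ n x), ?_, ?_, ?_⟩
  · refine MemLp.of_bound ((continuous_truncSq K).comp_aestronglyMeasurable mWf) (K ^ 2) ?_
    filter_upwards [hWK] with x hx
    rw [truncSq_of_le hx, Real.norm_of_nonneg (by positivity)]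
    gcongr
    exact max_le hx hK
  · refine MemLp.of_bound (((continuous_truncSqDeriv K).comp_aestronglyMeasurable mWf).smul mWg)
      (2 * K * max M 0) ?_
    filter_upwards [hM'] with x hx
    change ‖truncSqDeriv K (W x - f x) • (gradient W x - g x)‖ ≤ _
    rw [norm_smul]
    have := abs_truncSqDeriv_le hK (W x - f x)
    rw [Real.norm_eq_abs]
    gcongr
  · intro n
    have hsub : tsupport (fun x => smoothTruncSq (ε n) K (W x - ψ n x)) ⊆ S ∪ tsupport (ψ n) := by
      refine closure_minimal (fun x hx => ?_) (hS.isClosed.union (isClosed_tsupport _))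
      by_contra hcon
      rw [mem_union, not_or] at hcon
      refine hx ?_
      have h0 : ψ n x = 0 := image_eq_zero_of_notMem_tsupport hcon.2
      exact smoothTruncSq_of_nonpos (hε n) hK (by rw [h0, sub_zero]; exact hneg x hcon.1)
    exact ⟨(contDiff_smoothTruncSq _ K).comp (hW.sub (hψ n).1),
      (hS.union (hψ n).2.1).of_isClosed_subset (isClosed_tsupport _) hsub,
      hsub.trans (union_subset hSΩ (hψ n).2.2)⟩
  · refine tendsto_eLpNorm_zero_of_bound hp (L := 2 * K + 4) (c := fun n => ε n * K)
      mB mD (fun n => ?_) (by simpa using hεt.mul_const K) hBt hDt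
    filter_upwards [hWK] with x hx
    have h1 := abs_smoothTruncSq_sub_truncSq_le (hε n) hK hx
    have h2 := abs_smoothTruncSq_sub_le (hε n) hK (W x - f x) (W x - ψ n x)
    rw [show W x - f x - (W x - ψ n x) = -(f x - ψ n x) by ring, abs_neg] at h2
    have h3 : (2 * K + 4 * ε n) * |f x - ψ n x| ≤ (2 * K + 4) * |f x - ψ n x| := by
      gcongr
      have := hε1 n
      linarith
    have h4 : 0 ≤ (2 * K + 4) * ‖g x - gradient (ψ n) x‖ := by positivity
    rw [abs_sub_comm] at h1
    have h5 := abs_add_le (truncSq K (W x - f x) - smoothTruncSq (ε n) K (W x - f x))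
      (smoothTruncSq (ε n) K (W x - f x) - smoothTruncSq (ε n) K (W x - ψ n x))
    rw [sub_add_sub_cancel] at h5
    rw [Real.norm_eq_abs, Real.norm_eq_abs]
    linarith
  · refine tendsto_eLpNorm_zero_of_bound hp (L := 4 * max M 0 + (2 * K + 4))
      (c := fun n => 4 * ε n * max M 0)
      mB mD (fun n => ?_) (by simpa using (hεt.const_mul 4).mul_const (max M 0)) hBt hDt
    filter_upwards [hM'] with x hx
    have hd1 : DifferentiableAt ℝ W x := hW.differentiable (by simp) x
    have hd2 : DifferentiableAt ℝ (ψ n) x := (hψ n).1.differentiable (by simp) x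
    rw [gradient_smoothTruncSq_comp (v := fun y => W y - ψ n y) (hε n) (hd1.sub hd2),
      gradient_sub hd1 hd2]
    have e : truncSqDeriv K (W x - f x) • (gradient W x - g x)
        - smoothTruncSqDeriv (ε n) K (W x - ψ n x) • (gradient W x - gradient (ψ n) x)
        = (truncSqDeriv K (W x - f x) - smoothTruncSqDeriv (ε n) K (W x - ψ n x))
            • (gradient W x - g x)
          - smoothTruncSqDeriv (ε n) K (W x - ψ n x) • (g x - gradient (ψ n) x) := by
      module
    rw [e]
    refine (norm_sub_le _ _).trans ?_
    rw [norm_smul, norm_smul, Real.norm_eq_abs, Real.norm_eq_abs, Real.norm_eq_abs]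
    have h1 := abs_smoothTruncSqDeriv_sub_le (hε n) K (W x - ψ n x)
    have h2 := abs_truncSqDeriv_sub_le K (W x - f x) (W x - ψ n x)
    rw [show W x - f x - (W x - ψ n x) = -(f x - ψ n x) by ring, abs_neg] at h2
    rw [abs_sub_comm] at h1
    have h3 := abs_add_le (truncSqDeriv K (W x - f x) - truncSqDeriv K (W x - ψ n x))
      (truncSqDeriv K (W x - ψ n x) - smoothTruncSqDeriv (ε n) K (W x - ψ n x))
    rw [sub_add_sub_cancel] at h3
    have h4 := abs_smoothTruncSqDeriv_le (hε n) hK (W x - ψ n x)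
    have h5 : |smoothTruncSqDeriv (ε n) K (W x - ψ n x)| ≤ 2 * K + 4 := by
      have := hε1 n
      linarith
    have h6 : |truncSqDeriv K (W x - f x) - smoothTruncSqDeriv (ε n) K (W x - ψ n x)|
        ≤ 4 * |f x - ψ n x| + 4 * ε n := by linarith
    have h7 : |truncSqDeriv K (W x - f x) - smoothTruncSqDeriv (ε n) K (W x - ψ n x)|
        * ‖gradient W x - g x‖ ≤ (4 * |f x - ψ n x| + 4 * ε n) * max M 0 := by gcongr
    have h8 : |smoothTruncSqDeriv (ε n) K (W x - ψ n x)| * ‖g x - gradient (ψ n) x‖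
        ≤ (2 * K + 4) * ‖g x - gradient (ψ n) x‖ := by gcongr
    have h9 : 0 ≤ (2 * K + 4) * |f x - ψ n x| := by positivity
    have h10 : 0 ≤ 4 * max M 0 * ‖g x - gradient (ψ n) x‖ := by positivity
    linarith

lemma gradient_const_mul {N : ℕ} (c : ℝ) {v : E N → ℝ} {x : E N} (hv : DifferentiableAt ℝ v x) :
    gradient (fun y => c * v y) x = c • gradient v x := by
  have h' : fderiv ℝ (fun y => c * v y) x = c • fderiv ℝ v x := fderiv_const_mul hv c
  simp [gradient, h']

lemma MemW0.const_mul {N : ℕ} {Ω : Set (E N)} {a : ℝ≥0∞} {f : E N → ℝ} {g : E N → E N}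
    (h : MemW0 Ω a f g) (c : ℝ) : MemW0 Ω a (fun x => c * f x) (fun x => c • g x) := by
  obtain ⟨hf, hg, ψ, hψ, hψf, hψg⟩ := h
  have scale : ∀ {F : Type} [NormedAddCommGroup F] [NormedSpace ℝ F] (A : ℕ → E N → F),
      Tendsto (fun n => eLpNorm (A n) a (volume.restrict Ω)) atTop (𝓝 0) →
      Tendsto (fun n => eLpNorm (c • A n) a (volume.restrict Ω)) atTop (𝓝 0) := by
    intro F _ _ A hA
    simp_rw [eLpNorm_const_smul]
    have := ENNReal.Tendsto.const_mul (a := ‖c‖ₑ) hA (Or.inr enorm_ne_top)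
    simpa using this
  refine ⟨hf.const_mul c, hg.const_smul c, fun n x => c * ψ n x, fun n => ?_, ?_, ?_⟩
  · have hsub : tsupport (fun x => c * ψ n x) ⊆ tsupport (ψ n) :=
      tsupport_mul_subset_right (f := fun _ => c)
    exact ⟨contDiff_const.mul (hψ n).1, (hψ n).2.1.of_isClosed_subset (isClosed_tsupport _) hsub,
      hsub.trans (hψ n).2.2⟩
  · refine (scale _ hψf).congr fun n => ?_
    congr 1
    ext x
    simp [mul_sub]
  · refine (scale _ hψg).congr fun n => ?_
    congr 1
    ext1 x
    rw [gradient_const_mul c ((hψ n).1.differentiable (by simp) x)]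
    simp [smul_sub]

/-! ### Integration by parts for a radial power field -/

lemma hasLineDerivAt_norm_rpow_mul {N : ℕ} {e : ℝ} (he : 0 ≤ e) (y : E N) (i : Fin N) :
    HasLineDerivAt ℝ (fun z : E N => ‖z‖ ^ e * z i) (‖y‖ ^ e + e * ‖y‖ ^ (e - 2) * y i ^ 2) y
      (EuclideanSpace.single i 1) := by
  have hi : ∀ s : ℝ, (y + s • (EuclideanSpace.single i (1 : ℝ) : E N)) i = y i + s := by
    intro s; simp
  unfold HasLineDerivAt
  simp only [hi]
  rcases eq_or_ne y 0 with rfl | hy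
  · simp only [PiLp.zero_apply, zero_add]
    rcases he.eq_or_lt with rfl | he
    · simpa using hasDerivAt_id' (0 : ℝ)
    · rw [hasDerivAt_iff_tendsto_slope]
      have h1 : Tendsto (fun s : ℝ => |s| ^ e) (𝓝[≠] 0) (𝓝 0) := by
        have : Continuous fun s : ℝ => |s| ^ e := continuous_abs.rpow_const fun _ => Or.inr he.le
        have h := this.tendsto 0
        rw [abs_zero, Real.zero_rpow he.ne'] at h
        exact h.mono_left nhdsWithin_le_nhds
      have h2 : ‖(0 : E N)‖ ^ e + e * ‖(0 : E N)‖ ^ (e - 2) * (0 : ℝ) ^ 2 = 0 := by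
        simp [Real.zero_rpow he.ne']
      rw [h2]
      refine h1.congr' ?_
      filter_upwards [self_mem_nhdsWithin] with s hs
      have hs' : s ≠ 0 := hs
      simp [slope_def_field, hs', norm_smul]
  · have hy0 : 0 < ‖y‖ := norm_pos_iff.2 hy
    have hsq : ∀ s : ℝ, ‖y + s • (EuclideanSpace.single i (1 : ℝ) : E N)‖ ^ 2
        = ‖y‖ ^ 2 + 2 * s * y i + s ^ 2 := by
      intro s
      rw [norm_add_sq_real, norm_smul, inner_smul_right, EuclideanSpace.inner_single_right]
      simp
      ring
    have hpow : ∀ s : ℝ, ‖y + s • (EuclideanSpace.single i (1 : ℝ) : E N)‖ ^ e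
        = (‖y‖ ^ 2 + 2 * s * y i + s ^ 2) ^ (e / 2) := by
      intro s
      rw [← hsq, ← Real.rpow_natCast, ← Real.rpow_mul (norm_nonneg _)]
      congr 1
      push_cast
      ring
    simp only [hpow]
    have d1 : HasDerivAt (fun s : ℝ => ‖y‖ ^ 2 + 2 * s * y i + s ^ 2) (2 * y i) 0 := by
      have h := (((hasDerivAt_id (0 : ℝ)).const_mul 2).mul_const (y i)).const_add (‖y‖ ^ 2)
      have h' := h.add ((hasDerivAt_id (0 : ℝ)).pow 2)
      refine h'.congr_deriv ?_
      simp
    have d2 := d1.rpow_const (p := e / 2) (Or.inl (by simp [hy]))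
    have d3 : HasDerivAt (fun s : ℝ => y i + s) 1 0 := (hasDerivAt_id (0 : ℝ)).const_add (y i)
    refine (d2.mul d3).congr_deriv ?_
    have e1 : (‖y‖ ^ 2 : ℝ) ^ (e / 2) = ‖y‖ ^ e := by
      rw [← Real.rpow_natCast, ← Real.rpow_mul hy0.le]; congr 1; push_cast; ring
    have e2 : (‖y‖ ^ 2 : ℝ) ^ (e / 2 - 1) = ‖y‖ ^ (e - 2) := by
      rw [← Real.rpow_natCast, ← Real.rpow_mul hy0.le]; congr 1; push_cast; ring
    simp only [mul_zero, zero_mul, add_zero, ne_eq, OfNat.ofNat_ne_zero, not_false_eq_true,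
      zero_pow, mul_one, e1, e2]
    ring

lemma norm_rpow_sub_two_mul_sq {N : ℕ} {e : ℝ} (y : E N) :
    e * ‖y‖ ^ (e - 2) * ‖y‖ ^ 2 = e * ‖y‖ ^ e := by
  rcases eq_or_ne y 0 with rfl | hy
  · rcases eq_or_ne e 0 with rfl | he
    · simp
    · simp [Real.zero_rpow he]
  · have hy0 : 0 < ‖y‖ := norm_pos_iff.2 hy
    rw [mul_assoc, ← Real.rpow_natCast, ← Real.rpow_add hy0]
    congr 2
    push_cast
    ring

lemma inner_gradient_eq_sum {N : ℕ} (ψ : E N → ℝ) (x y : E N) :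
    inner ℝ y (gradient ψ x) = ∑ i, y i * fderiv ℝ ψ x (EuclideanSpace.single i 1) := by
  rw [real_inner_comm, gradient, InnerProductSpace.toDual_symm_apply]
  conv_lhs => rw [← (EuclideanSpace.basisFun (Fin N) ℝ).sum_repr y]
  simp

/-- The field `y ↦ |y|^e y` has divergence `(N + e) |y|^e`. -/
lemma integral_norm_rpow_inner_gradient {N : ℕ} {e : ℝ} (he : 0 ≤ e) (x₀ : E N) {ψ : E N → ℝ}
    (hψ : ContDiff ℝ ∞ ψ) (hc : HasCompactSupport ψ) :
    ∫ x, ‖x - x₀‖ ^ e * inner ℝ (x - x₀) (gradient ψ x)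
      = -((N + e) * ∫ x, ‖x - x₀‖ ^ e * ψ x) := by
  have cr : Continuous fun x : E N => ‖x - x₀‖ ^ e :=
    (continuous_id.sub continuous_const).norm.rpow_const fun _ => Or.inr he
  have ci : ∀ i, Continuous fun x : E N => (x - x₀) i := fun i => by fun_prop
  have cψ := hψ.continuous
  have cdψ : ∀ v : E N, Continuous fun x => fderiv ℝ ψ x v := fun v =>
    (hψ.continuous_fderiv (by simp)).clm_apply continuous_const
  have I1 : ∀ i, Integrable fun x : E N => ‖x - x₀‖ ^ e * (x - x₀) i
      * fderiv ℝ ψ x (EuclideanSpace.single i 1) := fun i =>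
    ((cr.mul (ci i)).mul (cdψ _)).integrable_of_hasCompactSupport
      (HasCompactSupport.mul_left (hc.fderiv_apply (𝕜 := ℝ) _))
  have I0 : Integrable fun x : E N => ‖x - x₀‖ ^ e * ψ x :=
    (cr.mul cψ).integrable_of_hasCompactSupport hc.mul_left
  have I3 : ∀ i, Integrable fun x : E N => ‖x - x₀‖ ^ e * (x - x₀) i * ψ x := fun i =>
    ((cr.mul (ci i)).mul cψ).integrable_of_hasCompactSupport hc.mul_left
  have I2 : ∀ i, Integrable fun x : E N =>
      (‖x - x₀‖ ^ e + e * ‖x - x₀‖ ^ (e - 2) * (x - x₀) i ^ 2) * ψ x := fun i => by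
    refine Integrable.mono' (I0.norm.const_mul (1 + e)) ?_ (ae_of_all _ fun x => ?_)
    · have : Measurable fun x : E N =>
          (‖x - x₀‖ ^ e + e * ‖x - x₀‖ ^ (e - 2) * (x - x₀) i ^ 2) * ψ x := by
        have h1 : Measurable fun x : E N => ‖x - x₀‖ := by fun_prop
        exact ((h1.pow_const e).add (((h1.pow_const (e - 2)).const_mul e).mul
          ((ci i).measurable.pow_const 2))).mul cψ.measurable
      exact this.aestronglyMeasurable
    · rw [norm_mul, norm_mul, ← mul_assoc]
      gcongr
      rw [Real.norm_of_nonneg (by positivity), Real.norm_of_nonneg (by positivity)]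
      have h1 : (x - x₀) i ^ 2 ≤ ‖x - x₀‖ ^ 2 := by
        have := PiLp.norm_apply_le (x - x₀) i
        rw [← sq_abs]
        gcongr
        exact this
      have h2 : e * ‖x - x₀‖ ^ (e - 2) * (x - x₀) i ^ 2
          ≤ e * ‖x - x₀‖ ^ (e - 2) * ‖x - x₀‖ ^ 2 := by gcongr
      rw [norm_rpow_sub_two_mul_sq] at h2
      linarith
  have parts : ∀ i, ∫ x : E N, ‖x - x₀‖ ^ e * (x - x₀) i
        * fderiv ℝ ψ x (EuclideanSpace.single i 1)
      = -∫ x : E N, (‖x - x₀‖ ^ e + e * ‖x - x₀‖ ^ (e - 2) * (x - x₀) i ^ 2) * ψ x := fun i => by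
    refine integral_bilinear_hasLineDerivAt_right_eq_neg_left_of_integrable
      (B := ContinuousLinearMap.mul ℝ ℝ) (v := EuclideanSpace.single i 1) (I2 i) (I1 i) (I3 i)
      (fun x _ => ?_) (fun x _ => ?_)
    · have h := hasLineDerivAt_norm_rpow_mul he (x - x₀) i
      unfold HasLineDerivAt at h ⊢
      simpa only [add_sub_right_comm] using h
    · exact (hψ.differentiable (by simp) x).hasFDerivAt.hasLineDerivAt _
  have lhs : ∀ x : E N, ‖x - x₀‖ ^ e * inner ℝ (x - x₀) (gradient ψ x)
      = ∑ i, ‖x - x₀‖ ^ e * (x - x₀) i * fderiv ℝ ψ x (EuclideanSpace.single i 1) := fun x => by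
    rw [inner_gradient_eq_sum, Finset.mul_sum]
    simp only [mul_assoc]
  simp only [lhs]
  rw [integral_finsetSum _ fun i _ => I1 i]
  simp only [parts]
  rw [Finset.sum_neg_distrib, ← integral_finsetSum _ fun i _ => I2 i, ← integral_const_mul]
  congr 2
  ext x
  rw [← Finset.sum_mul, Finset.sum_add_distrib, ← Finset.mul_sum]
  have : ∑ i, (x - x₀) i ^ 2 = ‖x - x₀‖ ^ 2 := by
    rw [EuclideanSpace.norm_sq_eq]; simp
  rw [this, norm_rpow_sub_two_mul_sq]
  simp
  ring

lemma MemW0.integral_norm_rpow_inner {N : ℕ} {Ω : Set (E N)} (hΩ : Bornology.IsBounded Ω)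
    (hΩm : MeasurableSet Ω) {p : ℝ≥0∞} (hp : 1 ≤ p) {f : E N → ℝ} {h : E N → E N}
    (hf : MemW0 Ω p f h) {e : ℝ} (he : 0 ≤ e) (x₀ : E N) :
    ∫ x in Ω, ‖x - x₀‖ ^ e * inner ℝ (x - x₀) (h x)
      = -((N + e) * ∫ x in Ω, ‖x - x₀‖ ^ e * f x) := by
  obtain ⟨hfp, hhp, ψ, hψ, hψf, hψg⟩ := hf
  have : IsFiniteMeasure (volume.restrict Ω) := ⟨by simpa using hΩ.measure_lt_top⟩
  obtain ⟨R, hR⟩ := hΩ.subset_closedBall x₀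
  have hRn : ∀ x ∈ Ω, ‖x - x₀‖ ≤ max R 0 := fun x hx => by
    have := hR hx
    rw [Metric.mem_closedBall, dist_eq_norm] at this
    exact this.trans (le_max_left _ _)
  have cr : Continuous fun x : E N => ‖x - x₀‖ ^ e :=
    (continuous_id.sub continuous_const).norm.rpow_const fun _ => Or.inr he
  have cx : Continuous fun x : E N => x - x₀ := by fun_prop
  have mf : ∀ n, AEStronglyMeasurable (fun x => f x - ψ n x) (volume.restrict Ω) := fun n =>
    hfp.1.sub (hψ n).1.continuous.aestronglyMeasurable
  have mg : ∀ n, AEStronglyMeasurable (fun x => h x - gradient (ψ n) x) (volume.restrict Ω) :=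
    fun n => hhp.1.sub (continuous_gradient (hψ n).1).aestronglyMeasurable
  have tf := tendsto_eLpNorm_zero_of_exponent_le hp mf hψf
  have tg := tendsto_eLpNorm_zero_of_exponent_le hp mg hψg
  have fI : Integrable f (volume.restrict Ω) := hfp.integrable hp
  have hI : Integrable h (volume.restrict Ω) := hhp.integrable hp
  set R' := max R 0
  have hR' : 0 ≤ R' := le_max_right _ _
  -- the weights are bounded on `Ω`, so both sides pass to the limit in `L¹`
  have b0 : ∀ x ∈ Ω, ‖x - x₀‖ ^ e ≤ R' ^ e := fun x hx =>
    Real.rpow_le_rpow (norm_nonneg _) (hRn x hx) he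
  have bi : ∀ x ∈ Ω, ∀ v : E N, ‖‖x - x₀‖ ^ e * inner ℝ (x - x₀) v‖ ≤ R' ^ e * R' * ‖v‖ :=
    fun x hx v => by
      rw [norm_mul, Real.norm_of_nonneg (by positivity), mul_assoc]
      have h1 : ‖inner ℝ (x - x₀) v‖ ≤ R' * ‖v‖ := (norm_inner_le_norm _ _).trans (by
        gcongr; exact hRn x hx)
      have := b0 x hx
      gcongr
  have I1 : Integrable (fun x => ‖x - x₀‖ ^ e * inner ℝ (x - x₀) (h x)) (volume.restrict Ω) := by
    refine Integrable.mono' (hI.norm.const_mul (R' ^ e * R'))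
      (cr.aestronglyMeasurable.mul (cx.aestronglyMeasurable.inner hI.1)) ?_
    filter_upwards [ae_restrict_mem hΩm] with x hx using bi x hx _
  have I2 : Integrable (fun x => ‖x - x₀‖ ^ e * f x) (volume.restrict Ω) := by
    refine Integrable.mono' (fI.norm.const_mul (R' ^ e)) (cr.aestronglyMeasurable.mul fI.1) ?_
    filter_upwards [ae_restrict_mem hΩm] with x hx
    rw [norm_mul, Real.norm_of_nonneg (by positivity)]
    have := b0 x hx
    gcongr
  have cg : ∀ n, Continuous fun x : E N => ‖x - x₀‖ ^ e * inner ℝ (x - x₀) (gradient (ψ n) x) :=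
    fun n => cr.mul (cx.inner (continuous_gradient (hψ n).1))
  have sg : ∀ n x, x ∉ tsupport (ψ n) → gradient (ψ n) x = 0 := fun n x hx => by
    have : fderiv ℝ (ψ n) x = 0 :=
      image_eq_zero_of_notMem_tsupport fun h' => hx (tsupport_fderiv_subset ℝ h')
    simp [gradient, this]
  have J1 : ∀ n, Integrable (fun x : E N => ‖x - x₀‖ ^ e * inner ℝ (x - x₀) (gradient (ψ n) x)) :=
    fun n => (cg n).integrable_of_hasCompactSupport
      (HasCompactSupport.intro (hψ n).2.1 fun x hx => by simp [sg n x hx])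
  have J2 : ∀ n, Integrable (fun x : E N => ‖x - x₀‖ ^ e * ψ n x) :=
    fun n => (cr.mul (hψ n).1.continuous).integrable_of_hasCompactSupport (hψ n).2.1.mul_left
  have T1 : Tendsto (fun n => ∫ x in Ω, ‖x - x₀‖ ^ e * inner ℝ (x - x₀) (gradient (ψ n) x)) atTop
      (𝓝 (∫ x in Ω, ‖x - x₀‖ ^ e * inner ℝ (x - x₀) (h x))) := by
    refine tendsto_integral_of_L1' _ I1.1 (Eventually.of_forall fun n => (J1 n).integrableOn) ?_
    refine tendsto_eLpNorm_zero_of_bound le_rfl (L := R' ^ e * R') (c := fun _ => 0) mf mg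
      (fun n => ?_) tendsto_const_nhds tf tg
    filter_upwards [ae_restrict_mem hΩm] with x hx
    have h1 := bi x hx (gradient (ψ n) x - h x)
    rw [Pi.sub_apply, ← mul_sub, ← inner_sub_right, zero_add, norm_sub_rev (h x)]
    refine h1.trans ?_
    gcongr
    exact le_add_of_nonneg_left (norm_nonneg (f x - ψ n x))
  have T2 : Tendsto (fun n => ∫ x in Ω, ‖x - x₀‖ ^ e * ψ n x) atTop
      (𝓝 (∫ x in Ω, ‖x - x₀‖ ^ e * f x)) := by
    refine tendsto_integral_of_L1' _ I2.1 (Eventually.of_forall fun n => (J2 n).integrableOn) ?_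
    refine tendsto_eLpNorm_zero_of_bound le_rfl (L := R' ^ e) (c := fun _ => 0) mf mg
      (fun n => ?_) tendsto_const_nhds tf tg
    filter_upwards [ae_restrict_mem hΩm] with x hx
    rw [Pi.sub_apply, ← mul_sub, zero_add, norm_mul, Real.norm_of_nonneg (by positivity),
      norm_sub_rev (ψ n x)]
    have := b0 x hx
    gcongr
    exact le_add_of_nonneg_right (norm_nonneg (h x - gradient (ψ n) x))
  have key : ∀ n, ∫ x in Ω, ‖x - x₀‖ ^ e * inner ℝ (x - x₀) (gradient (ψ n) x)
      = -((N + e) * ∫ x in Ω, ‖x - x₀‖ ^ e * ψ n x) := fun n => by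
    have out : ∀ x, x ∉ Ω → x ∉ tsupport (ψ n) := fun x hx h' => hx ((hψ n).2.2 h')
    rw [setIntegral_eq_integral_of_forall_compl_eq_zero fun x hx => by simp [sg n x (out x hx)],
      setIntegral_eq_integral_of_forall_compl_eq_zero fun x hx => by
        simp [image_eq_zero_of_notMem_tsupport (out x hx)]]
    exact integral_norm_rpow_inner_gradient he x₀ (hψ n).1 (hψ n).2.1
  simp only [key] at T1
  exact tendsto_nhds_unique T1 ((T2.const_mul _).neg)

/-! ### Absolute continuity in time -/

lemma absolutelyContinuousOnInterval_comp {f G : ℝ → ℝ} {a b L : ℝ}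
    (hf : AbsolutelyContinuousOnInterval f a b)
    (hG : ∀ x ∈ uIcc a b, ∀ y ∈ uIcc a b, |G (f x) - G (f y)| ≤ L * |f x - f y|) :
    AbsolutelyContinuousOnInterval (fun t => G (f t)) a b := by
  rw [absolutelyContinuousOnInterval_iff] at hf ⊢
  intro ε hε
  obtain ⟨δ, hδ, h⟩ := hf (ε / (|L| + 1)) (by positivity)
  refine ⟨δ, hδ, fun E hE hs => ?_⟩
  have h1 := h E hE hs
  rw [lt_div_iff₀ (by positivity)] at h1
  refine lt_of_le_of_lt ?_ h1
  rw [Finset.sum_mul]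
  refine Finset.sum_le_sum fun i hi => ?_
  have := hE.1 i hi
  refine (hG _ this.1 _ this.2).trans ?_
  rw [Real.dist_eq, mul_comm]
  gcongr
  exact (le_abs_self L).trans (by linarith)

lemma hasDerivAt_max_zero_pow_three (s : ℝ) :
    HasDerivAt (fun s : ℝ => max s 0 ^ 3) (3 * max s 0 ^ 2) s := by
  rcases lt_trichotomy s 0 with h | rfl | h
  · have : (fun s : ℝ => max s 0 ^ 3) =ᶠ[𝓝 s] fun _ => 0 := by
      filter_upwards [gt_mem_nhds h] with t ht
      simp [max_eq_right ht.le]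
    rw [max_eq_right h.le]
    simpa using (hasDerivAt_const s (0 : ℝ)).congr_of_eventuallyEq this
  · rw [hasDerivAt_iff_isLittleO]
    simp only [max_self, ne_eq, OfNat.ofNat_ne_zero, not_false_eq_true, zero_pow, mul_zero,
      smul_zero, sub_zero]
    have h1 : (fun x : ℝ => max x 0 ^ 3) =O[𝓝 0] fun x : ℝ => x ^ 3 := by
      refine Asymptotics.isBigO_of_le _ fun x => ?_
      rw [norm_pow, norm_pow, Real.norm_eq_abs, Real.norm_eq_abs]
      refine pow_le_pow_left₀ (abs_nonneg _) ?_ 3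
      have := abs_max_zero_sub_le x 0
      rwa [max_self, sub_zero, sub_zero] at this
    refine h1.trans_isLittleO ?_
    simpa using Asymptotics.isLittleO_pow_pow (𝕜 := ℝ) (show 1 < 3 by norm_num)
  · have : (fun s : ℝ => max s 0 ^ 3) =ᶠ[𝓝 s] fun s => s ^ 3 := by
      filter_upwards [lt_mem_nhds h] with t ht
      simp [max_eq_left (le_of_lt ht)]
    rw [max_eq_left h.le]
    simpa using (hasDerivAt_pow 3 s).congr_of_eventuallyEq this

lemma abs_max_zero_pow_three_sub_le {R a b : ℝ} (ha : |a| ≤ R) (hb : |b| ≤ R) :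
    |max a 0 ^ 3 - max b 0 ^ 3| ≤ 3 * R ^ 2 * |a - b| := by
  have h := abs_max_zero_sub_le a b
  have hR : 0 ≤ R := (abs_nonneg a).trans ha
  have ha' : max a 0 ≤ R := max_le ((le_abs_self a).trans ha) hR
  have hb' : max b 0 ≤ R := max_le ((le_abs_self b).trans hb) hR
  have ha0 : 0 ≤ max a 0 := le_max_right _ _
  have hb0 : 0 ≤ max b 0 := le_max_right _ _
  have e : max a 0 ^ 3 - max b 0 ^ 3
      = (max a 0 ^ 2 + max a 0 * max b 0 + max b 0 ^ 2) * (max a 0 - max b 0) := by ring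
  rw [e, abs_mul, abs_of_nonneg (by positivity)]
  gcongr
  nlinarith [mul_nonneg ha0 hb0, mul_le_mul ha' hb' hb0 hR, mul_le_mul ha' ha' ha0 hR,
    mul_le_mul hb' hb' hb0 hR]

/-- The chain rule for `t ↦ exp (-λ t) (max (f t) 0)³` along a primitive `f`. -/
lemma integral_exp_mul_max_zero_pow_three {S c lam : ℝ} (hS : 0 ≤ S) {v : ℝ → ℝ}
    (hv : IntervalIntegrable v volume 0 S) {f : ℝ → ℝ}
    (hf : ∀ t ∈ Icc 0 S, f t = c + ∫ s in 0..t, v s) :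
    ∫ t in 0..S, Real.exp (-lam * t) * (3 * max (f t) 0 ^ 2 * v t - lam * max (f t) 0 ^ 3)
      = Real.exp (-lam * S) * max (f S) 0 ^ 3 - max (f 0) 0 ^ 3 := by
  set F : ℝ → ℝ := fun t => c + ∫ s in 0..t, v s with hF
  have hFac : AbsolutelyContinuousOnInterval F 0 S := by
    have h1 := hv.absolutelyContinuousOnInterval_intervalIntegral (c := 0) (by simp)
    have h2 : AbsolutelyContinuousOnInterval (fun _ : ℝ => c) 0 S :=
      contDiffOn_const.absolutelyContinuousOnInterval
    exact h2.add h1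
  obtain ⟨R, hR⟩ := hFac.exists_bound
  have hG : AbsolutelyContinuousOnInterval (fun t => max (F t) 0 ^ 3) 0 S :=
    absolutelyContinuousOnInterval_comp (G := fun s => max s 0 ^ 3) hFac fun x hx y hy =>
      abs_max_zero_pow_three_sub_le (hR x hx) (hR y hy)
  have hE : AbsolutelyContinuousOnInterval (fun t => Real.exp (-lam * t)) 0 S :=
    ContDiffOn.absolutelyContinuousOnInterval (by fun_prop)
  have hP : AbsolutelyContinuousOnInterval
      (fun t => Real.exp (-lam * t) * max (F t) 0 ^ 3) 0 S := hE.mul hG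
  have h0 : f 0 = F 0 := hf 0 ⟨le_rfl, hS⟩
  have h1 : f S = F S := hf S ⟨hS, le_rfl⟩
  have key := hP.integral_deriv_eq_sub
  simp only [mul_zero, Real.exp_zero, one_mul] at key
  rw [h0, h1, ← key]
  refine intervalIntegral.integral_congr_ae ?_
  filter_upwards [hv.ae_hasDerivAt_integral] with t ht hts
  have htI : t ∈ uIcc 0 S := uIoc_subset_uIcc hts
  have htI' : t ∈ Icc 0 S := by rwa [uIcc_of_le hS] at htI
  have dF : HasDerivAt F (v t) t := (ht htI 0 (by simp)).const_add c
  have dG : HasDerivAt (fun t => max (F t) 0 ^ 3) (3 * max (F t) 0 ^ 2 * v t) t :=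
    (hasDerivAt_max_zero_pow_three (F t)).comp t dF
  have dE : HasDerivAt (fun t => Real.exp (-lam * t)) (Real.exp (-lam * t) * (-lam)) t := by
    simpa using ((hasDerivAt_id t).const_mul (-lam)).exp
  have dP : HasDerivAt (fun t => Real.exp (-lam * t) * max (F t) 0 ^ 3) _ t := dE.mul dG
  rw [dP.deriv, hf t htI']
  ring

lemma deriv_smoothTransition_of_notMem {t : ℝ} (ht : t ∉ Icc (0 : ℝ) 1) :
    deriv Real.smoothTransition t = 0 := by
  rcases lt_or_ge t 0 with h | h
  · have : Real.smoothTransition =ᶠ[𝓝 t] fun _ => 0 := by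
      filter_upwards [gt_mem_nhds h] with s hs
      exact Real.smoothTransition.zero_of_nonpos (le_of_lt hs)
    rw [this.deriv_eq, deriv_const]
  · have h1 : 1 < t := by
      by_contra hc
      exact ht ⟨h, not_lt.1 hc⟩
    have : Real.smoothTransition =ᶠ[𝓝 t] fun _ => 1 := by
      filter_upwards [lt_mem_nhds h1] with s hs
      exact Real.smoothTransition.one_of_one_le (le_of_lt hs)
    rw [this.deriv_eq, deriv_const]

/-- The kernels `n H'(n (t - t₁))`, with `H` the smooth step, concentrate at `t₁`. -/
lemma tendsto_integral_smoothTransition_deriv {f : ℝ → ℝ} (hf : Continuous f) {R : ℝ}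
    (hR : ∀ t, |f t| ≤ R) (t₁ : ℝ) :
    Tendsto (fun n : ℕ => ∫ t, f t *
      (((n : ℝ) + 1) * deriv Real.smoothTransition (((n : ℝ) + 1) * (t - t₁)))) atTop
      (𝓝 (f t₁)) := by
  set H := Real.smoothTransition
  have hHs : ContDiff ℝ 1 H := Real.smoothTransition.contDiff (n := 1)
  have cH' : Continuous (deriv H) := hHs.continuous_deriv le_rfl
  have suppH : ∀ t, t ∉ Icc (0 : ℝ) 1 → deriv H t = 0 := fun t =>
    deriv_smoothTransition_of_notMem
  have hcs : HasCompactSupport (deriv H) := HasCompactSupport.intro isCompact_Icc suppH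
  have iH' : Integrable (deriv H) := cH'.integrable_of_hasCompactSupport hcs
  have mass : ∫ s, deriv H s = 1 := by
    have h1 : ∫ s, deriv H s = ∫ s in Icc 0 1, deriv H s :=
      (setIntegral_eq_integral_of_forall_compl_eq_zero suppH).symm
    rw [h1, integral_Icc_eq_integral_Ioc, ← intervalIntegral.integral_of_le zero_le_one,
      intervalIntegral.integral_deriv_eq_sub (fun x _ => hHs.differentiable (by simp) x)
        (cH'.intervalIntegrable _ _)]
    simp [H]
  have subst : ∀ n : ℕ, ∫ t, f t * (((n : ℝ) + 1) * deriv H (((n : ℝ) + 1) * (t - t₁)))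
      = ∫ s, f (t₁ + s / ((n : ℝ) + 1)) * deriv H s := fun n => by
    have hn : (0 : ℝ) < (n : ℝ) + 1 := by positivity
    have h1 := integral_sub_right_eq_self (μ := volume) (fun t => f (t₁ + t) *
      (((n : ℝ) + 1) * deriv H (((n : ℝ) + 1) * t))) t₁
    simp only [add_sub_cancel] at h1
    rw [h1]
    have h2 := Measure.integral_comp_mul_left
      (fun s => f (t₁ + s / ((n : ℝ) + 1)) * deriv H s) ((n : ℝ) + 1)
    rw [abs_of_pos (by positivity), smul_eq_mul, eq_inv_mul_iff_mul_eq₀ hn.ne',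
      ← integral_const_mul] at h2
    rw [← h2]
    congr 1
    ext s
    rw [mul_div_cancel_left₀ _ hn.ne']
    ring
  simp only [subst]
  have hlim : f t₁ = ∫ s, f t₁ * deriv H s := by rw [integral_const_mul, mass, mul_one]
  rw [hlim]
  refine tendsto_integral_of_dominated_convergence (fun s => R * |deriv H s|) (fun n => ?_)
    (iH'.abs.const_mul R) (fun n => ae_of_all _ fun s => ?_) (ae_of_all _ fun s => ?_)
  · exact ((hf.comp (by fun_prop)).mul cH').aestronglyMeasurable
  · rw [norm_mul, Real.norm_eq_abs, Real.norm_eq_abs]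
    gcongr
    exact hR _
  · refine Tendsto.mul_const _ ?_
    refine (hf.tendsto t₁).comp ?_
    have h1 : Tendsto (fun n : ℕ => s * (1 / ((n : ℝ) + 1))) atTop (𝓝 (s * 0)) :=
      tendsto_one_div_add_atTop_nhds_zero_nat.const_mul s
    have h2 := h1.const_add t₁
    rw [mul_zero, add_zero] at h2
    refine h2.congr fun n => ?_
    ring

lemma tendsto_smoothTransition_sub (t t₁ : ℝ) :
    Tendsto (fun n : ℕ => Real.smoothTransition (((n : ℝ) + 1) * (t - t₁))) atTop
      (𝓝 ((Ioi t₁).indicator 1 t)) := by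
  rcases le_or_gt t t₁ with h | h
  · have : ∀ n : ℕ, Real.smoothTransition (((n : ℝ) + 1) * (t - t₁)) = 0 := fun n =>
      Real.smoothTransition.zero_of_nonpos
        (mul_nonpos_of_nonneg_of_nonpos (by positivity) (by linarith))
    simp only [this]
    rw [indicator_of_notMem (by simpa using h)]
    exact tendsto_const_nhds
  · rw [indicator_of_mem (by simpa using h)]
    have h1 : Tendsto (fun n : ℕ => ((n : ℝ) + 1) * (t - t₁)) atTop atTop :=
      Tendsto.atTop_mul_const (sub_pos.2 h)
        (tendsto_atTop_add_const_right _ _ tendsto_natCast_atTop_atTop)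
    refine tendsto_const_nhds.congr' ?_
    filter_upwards [h1.eventually_ge_atTop 1] with n hn
    exact (Real.smoothTransition.one_of_one_le hn).symm

lemma restrict_cyl {N : ℕ} (Ω : Set (E N)) (S : ℝ) :
    (volume.restrict (cyl Ω S) : Measure (ℝ × E N))
      = (volume.restrict (Ioo 0 S)).prod (volume.restrict Ω) := by
  rw [cyl, Measure.prod_restrict]; rfl

lemma isFiniteMeasure_restrict_cyl {N : ℕ} {Ω : Set (E N)} (hΩ : Bornology.IsBounded Ω) (S : ℝ) :
    IsFiniteMeasure (volume.restrict (cyl Ω S) : Measure (ℝ × E N)) := by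
  have : IsFiniteMeasure (volume.restrict Ω) := ⟨by simpa using hΩ.measure_lt_top⟩
  rw [restrict_cyl]
  infer_instance

/-- Tested against `ζ`, the weak time derivative is a difference of time slices. -/
lemma IsWeakTimeDeriv.integral_mul_sub {N : ℕ} {Ω : Set (E N)} (hΩo : IsOpen Ω)
    (hΩ : Bornology.IsBounded Ω) {S : ℝ} {u w : ℝ × E N → ℝ} (hw : IsWeakTimeDeriv Ω S u w)
    (hu : ContinuousOn u (Icc 0 S ×ˢ closure Ω)) {t₁ t₂ : ℝ} (h1 : 0 < t₁) (h12 : t₁ < t₂)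
    (h2 : t₂ < S) {ζ : E N → ℝ} (hζ : IsTestFun Ω ζ) :
    ∫ x in Ω, ζ x * (u (t₂, x) - u (t₁, x)) = ∫ x in Ω, ζ x * ∫ t in t₁..t₂, w (t, x) := by
  have hS : 0 ≤ S := (h1.trans (h12.trans h2)).le
  have fin1 : IsFiniteMeasure (volume.restrict Ω) := ⟨by simpa using hΩ.measure_lt_top⟩
  have fin2 := isFiniteMeasure_restrict_cyl hΩ S
  have hcompact : IsCompact (Icc 0 S ×ˢ closure Ω) := isCompact_Icc.prod hΩ.isCompact_closure
  obtain ⟨R, hR⟩ := hcompact.exists_bound_of_continuousOn hu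
  obtain ⟨Z, hZ⟩ := hζ.2.1.exists_bound_of_continuous hζ.1.continuous
  have hR0 : ∀ t ∈ Icc 0 S, ∀ x ∈ Ω, ‖u (t, x)‖ ≤ R := fun t ht x hx =>
    hR (t, x) ⟨ht, subset_closure hx⟩
  have wI : Integrable w (volume.restrict (cyl Ω S)) := hw.1.integrable one_le_two
  set H := Real.smoothTransition with hH
  have hHs : ContDiff ℝ ∞ H := Real.smoothTransition.contDiff
  have hHs1 : ContDiff ℝ 1 H := Real.smoothTransition.contDiff (n := 1)
  have hHd : Differentiable ℝ H := hHs1.differentiable (by simp)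
  -- the smoothed indicator of `(t₁, t₂]`
  set η : ℕ → ℝ → ℝ := fun n t => H (((n : ℝ) + 1) * (t - t₁)) - H (((n : ℝ) + 1) * (t - t₂))
    with hη
  set η' : ℕ → ℝ → ℝ := fun n t => ((n : ℝ) + 1) * deriv H (((n : ℝ) + 1) * (t - t₁))
    - ((n : ℝ) + 1) * deriv H (((n : ℝ) + 1) * (t - t₂)) with hη'
  have dη : ∀ n t, HasDerivAt (η n) (η' n t) t := fun n t => by
    have d : ∀ c : ℝ, HasDerivAt (fun t => H (((n : ℝ) + 1) * (t - c)))
        (((n : ℝ) + 1) * deriv H (((n : ℝ) + 1) * (t - c))) t := fun c => by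
      have d1 : HasDerivAt (fun t : ℝ => ((n : ℝ) + 1) * (t - c)) ((n : ℝ) + 1) t := by
        simpa using ((hasDerivAt_id t).sub_const c).const_mul ((n : ℝ) + 1)
      have := (hHd (((n : ℝ) + 1) * (t - c))).hasDerivAt.comp t d1
      rwa [mul_comm] at this
    exact (d t₁).sub (d t₂)
  have sη : ∀ n, ContDiff ℝ ∞ (η n) := fun n =>
    (hHs.comp (by fun_prop)).sub (hHs.comp (by fun_prop))
  have bη : ∀ n t, |η n t| ≤ 1 := fun n t => by
    have a1 := Real.smoothTransition.nonneg (((n : ℝ) + 1) * (t - t₁))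
    have a2 := Real.smoothTransition.le_one (((n : ℝ) + 1) * (t - t₁))
    have a3 := Real.smoothTransition.nonneg (((n : ℝ) + 1) * (t - t₂))
    have a4 := Real.smoothTransition.le_one (((n : ℝ) + 1) * (t - t₂))
    rw [abs_le]
    constructor <;> simp only [hη, hH] <;> linarith
  have zη : ∀ (n : ℕ) t, t ∉ Icc t₁ (t₂ + 1 / ((n : ℝ) + 1)) → η n t = 0 := fun n t ht => by
    have hn : (0 : ℝ) < (n : ℝ) + 1 := by positivity
    rcases lt_or_ge t t₁ with h | h
    · simp only [hη, hH]
      rw [Real.smoothTransition.zero_of_nonpos, Real.smoothTransition.zero_of_nonpos, sub_zero]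
      · exact mul_nonpos_of_nonneg_of_nonpos hn.le (by linarith)
      · exact mul_nonpos_of_nonneg_of_nonpos hn.le (by linarith)
    · have h' : t₂ + 1 / ((n : ℝ) + 1) < t := by
        by_contra hc
        exact ht ⟨h, not_lt.1 hc⟩
      have h3 : 1 ≤ ((n : ℝ) + 1) * (t - t₂) := by
        have : 1 / ((n : ℝ) + 1) ≤ t - t₂ := by linarith
        rwa [div_le_iff₀' hn] at this
      simp only [hη, hH]
      rw [Real.smoothTransition.one_of_one_le, Real.smoothTransition.one_of_one_le h3, sub_self]
      refine h3.trans ?_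
      gcongr
  have evS : ∀ᶠ n : ℕ in atTop, t₂ + 1 / ((n : ℝ) + 1) < S := by
    have : Tendsto (fun n : ℕ => t₂ + 1 / ((n : ℝ) + 1)) atTop (𝓝 (t₂ + 0)) :=
      tendsto_one_div_add_atTop_nhds_zero_nat.const_add t₂
    rw [add_zero] at this
    exact this.eventually_lt_const h2
  -- the weak derivative identity for `η n t * ζ x`
  have weak : ∀ᶠ n in atTop, ∫ z in cyl Ω S, u z * (η' n z.1 * ζ z.2)
      = -∫ z in cyl Ω S, w z * (η n z.1 * ζ z.2) := by
    filter_upwards [evS] with n hn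
    have hsub : tsupport (fun z : ℝ × E N => η n z.1 * ζ z.2)
        ⊆ Icc t₁ (t₂ + 1 / ((n : ℝ) + 1)) ×ˢ tsupport ζ := by
      refine closure_minimal (fun z hz => ?_) (isClosed_Icc.prod (isClosed_tsupport _))
      refine ⟨?_, ?_⟩
      · by_contra hc
        exact hz (by simp [zη n _ hc])
      · by_contra hc
        exact hz (by simp [image_eq_zero_of_notMem_tsupport hc])
    have hsm : ContDiff ℝ ∞ (fun z : ℝ × E N => η n z.1 * ζ z.2) :=
      ((sη n).comp contDiff_fst).mul (hζ.1.comp contDiff_snd)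
    have h := hw.2 _ hsm
      ((isCompact_Icc.prod hζ.2.1).of_isClosed_subset (isClosed_tsupport _) hsub)
      (hsub.trans (prod_mono (fun t ht => ⟨h1.trans_le ht.1, ht.2.trans_lt hn⟩) hζ.2.2))
    rw [← h]
    congr 1
    ext z
    congr 1
    have e1 : HasFDerivAt (fun z : ℝ × E N => η n z.1) _ z :=
      (dη n z.1).comp_hasFDerivAt z (ContinuousLinearMap.fst ℝ ℝ (E N)).hasFDerivAt
    have e2 : HasFDerivAt (fun z : ℝ × E N => ζ z.2) _ z :=
      (hζ.1.differentiable (by simp) z.2).hasFDerivAt.comp z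
        (ContinuousLinearMap.snd ℝ ℝ (E N)).hasFDerivAt
    have e3 : HasFDerivAt (fun z : ℝ × E N => η n z.1 * ζ z.2) _ z := e1.mul e2
    rw [e3.fderiv]
    simp [mul_comm]
  -- the slices, tested against `ζ`
  set f : ℝ → ℝ := fun t => ∫ x in Ω, u (projIcc 0 S hS t, x) * ζ x with hf
  have fc : Continuous f := by
    refine continuous_of_dominated (bound := fun _ => R * Z) (fun t => ?_) (fun t => ?_)
      (integrable_const _) ?_
    · refine ContinuousOn.aestronglyMeasurable ?_ hΩo.measurableSet
      refine ContinuousOn.mul ?_ hζ.1.continuous.continuousOn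
      refine hu.comp (by fun_prop) fun x hx => ⟨(projIcc 0 S hS t).2, subset_closure hx⟩
    · filter_upwards [ae_restrict_mem hΩo.measurableSet] with x hx
      rw [norm_mul]
      have := hR0 _ (projIcc 0 S hS t).2 x hx
      have := hZ x
      gcongr
      exact (norm_nonneg _).trans (hR0 _ (projIcc 0 S hS t).2 x hx)
    · filter_upwards [ae_restrict_mem hΩo.measurableSet] with x hx
      refine Continuous.mul ?_ continuous_const
      have : Continuous fun t : ℝ => ((projIcc 0 S hS t : ℝ), x) :=
        (continuous_subtype_val.comp continuous_projIcc).prodMk continuous_const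
      exact hu.comp_continuous this fun t => ⟨(projIcc 0 S hS t).2, subset_closure hx⟩
  have fb : ∀ t, |f t| ≤ R * Z * (volume.restrict Ω).real univ := fun t => by
    rw [← Real.norm_eq_abs]
    refine norm_integral_le_of_norm_le_const ?_
    filter_upwards [ae_restrict_mem hΩo.measurableSet] with x hx
    rw [norm_mul]
    have := hR0 _ (projIcc 0 S hS t).2 x hx
    have := hZ x
    gcongr
    exact (norm_nonneg _).trans (hR0 _ (projIcc 0 S hS t).2 x hx)
  have feq : ∀ t ∈ Icc 0 S, f t = ∫ x in Ω, u (t, x) * ζ x := fun t ht => by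
    simp only [hf, projIcc_of_mem hS ht]
  have cη' : ∀ n, Continuous (η' n) := fun n => by
    have : Continuous (deriv H) := hHs1.continuous_deriv le_rfl
    simp only [hη']
    fun_prop
  have um : AEStronglyMeasurable u (volume.restrict (cyl Ω S)) :=
    (hu.mono (prod_mono Ioo_subset_Icc_self subset_closure)).aestronglyMeasurable
      (measurableSet_Ioo.prod hΩo.measurableSet)
  have lhs : ∀ᶠ n in atTop, ∫ z in cyl Ω S, u z * (η' n z.1 * ζ z.2) = ∫ t, f t * η' n t := by
    filter_upwards [evS] with n hn
    have hzero : ∀ t, t ∉ Ioo 0 S → f t * η' n t = 0 := fun t ht => by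
      have hopen : (Icc t₁ (t₂ + 1 / ((n : ℝ) + 1)))ᶜ ∈ 𝓝 t :=
        isClosed_Icc.isOpen_compl.mem_nhds fun hc =>
          ht ⟨h1.trans_le hc.1, hc.2.trans_lt hn⟩
      have : η n =ᶠ[𝓝 t] fun _ => 0 := by
        filter_upwards [hopen] with s hs using zη n s hs
      have h0 : η' n t = 0 := by
        rw [← (dη n t).deriv, this.deriv_eq, deriv_const]
      rw [h0, mul_zero]
    rw [← setIntegral_eq_integral_of_forall_compl_eq_zero hzero, restrict_cyl, integral_prod]
    · refine setIntegral_congr_fun measurableSet_Ioo fun t ht => ?_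
      simp only
      rw [feq t (Ioo_subset_Icc_self ht), ← integral_mul_const]
      congr 1
      ext x
      ring
    · rw [← restrict_cyl]
      obtain ⟨B, hB⟩ := isCompact_Icc.exists_bound_of_continuousOn (s := Icc 0 S)
        (cη' n).continuousOn
      refine Integrable.of_bound (C := R * (B * Z)) (um.mul ?_) ?_
      · exact ((cη' n).comp continuous_fst).mul (hζ.1.continuous.comp continuous_snd)
          |>.aestronglyMeasurable
      · filter_upwards [ae_restrict_mem (measurableSet_Ioo.prod hΩo.measurableSet)] with z hz
        have b1 := hR0 z.1 (Ioo_subset_Icc_self hz.1) z.2 hz.2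
        have b2 := hB z.1 (Ioo_subset_Icc_self hz.1)
        have b3 := hZ z.2
        rw [norm_mul, norm_mul]
        have := (norm_nonneg _).trans b1
        have := (norm_nonneg _).trans b2
        gcongr
  have lim1 : Tendsto (fun n => ∫ t, f t * η' n t) atTop (𝓝 (f t₁ - f t₂)) := by
    refine ((tendsto_integral_smoothTransition_deriv fc fb t₁).sub
      (tendsto_integral_smoothTransition_deriv fc fb t₂)).congr fun n => ?_
    have Ik : ∀ c, Integrable fun t => f t * (((n : ℝ) + 1) * deriv H (((n : ℝ) + 1) * (t - c))) :=
      fun c => by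
        have cH' : Continuous (deriv H) := hHs1.continuous_deriv le_rfl
        refine (fc.mul (by fun_prop)).integrable_of_hasCompactSupport ?_
        refine HasCompactSupport.intro (isCompact_Icc (a := c) (b := c + 1 / ((n : ℝ) + 1)))
          fun t ht => ?_
        have hn : (0 : ℝ) < (n : ℝ) + 1 := by positivity
        have : deriv H (((n : ℝ) + 1) * (t - c)) = 0 := by
          refine deriv_smoothTransition_of_notMem fun hc => ht ⟨?_, ?_⟩
          · linarith [nonneg_of_mul_nonneg_right hc.1 hn]
          · have h3 := hc.2
            rw [← le_div_iff₀' hn] at h3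
            linarith
        simp only [Pi.mul_apply, this, mul_zero]
    rw [← integral_sub (Ik t₁) (Ik t₂)]
    congr 1
    ext t
    simp only [hη']
    ring
  have lim2 : Tendsto (fun n => ∫ z in cyl Ω S, w z * (η n z.1 * ζ z.2)) atTop
      (𝓝 (∫ z in cyl Ω S, w z * ((Ioc t₁ t₂).indicator 1 z.1 * ζ z.2))) := by
    refine tendsto_integral_of_dominated_convergence (fun z => Z * |w z|) (fun n => ?_)
      (wI.abs.const_mul Z) (fun n => ae_of_all _ fun z => ?_) (ae_of_all _ fun z => ?_)
    · exact wI.1.mul (((sη n).continuous.comp continuous_fst).mul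
        (hζ.1.continuous.comp continuous_snd)).aestronglyMeasurable
    · rw [norm_mul, norm_mul, mul_comm, Real.norm_eq_abs (w z)]
      gcongr
      calc ‖η n z.1‖ * ‖ζ z.2‖ ≤ 1 * Z := by
            have := hZ z.2
            have := bη n z.1
            rw [Real.norm_eq_abs (η n z.1)]
            gcongr
        _ = Z := one_mul _
    · refine Tendsto.const_mul _ (Tendsto.mul_const _ ?_)
      have := (tendsto_smoothTransition_sub z.1 t₁).sub (tendsto_smoothTransition_sub z.1 t₂)
      have e : (Ioi t₁).indicator (1 : ℝ → ℝ) z.1 - (Ioi t₂).indicator 1 z.1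
          = (Ioc t₁ t₂).indicator 1 z.1 := by
        simp only [indicator, mem_Ioi, mem_Ioc, Pi.one_apply]
        split_ifs <;> grind
      rwa [e] at this
  have fub : ∫ z in cyl Ω S, w z * ((Ioc t₁ t₂).indicator 1 z.1 * ζ z.2)
      = ∫ x in Ω, ζ x * ∫ t in t₁..t₂, w (t, x) := by
    rw [restrict_cyl, integral_prod_symm]
    · congr 1
      ext x
      rw [intervalIntegral.integral_of_le h12.le, ← integral_const_mul]
      have hsub : Ioc t₁ t₂ ⊆ Ioo 0 S := fun t ht => ⟨h1.trans ht.1, ht.2.trans_lt h2⟩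
      have hind : ∫ t in Ioc t₁ t₂, ζ x * w (t, x)
          = ∫ t in Ioo 0 S, (Ioc t₁ t₂).indicator (fun t => ζ x * w (t, x)) t := by
        rw [setIntegral_indicator measurableSet_Ioc, inter_eq_right.2 hsub]
      rw [hind]
      congr 1
      ext t
      by_cases ht : t ∈ Ioc t₁ t₂
      · simp [ht, mul_comm]
      · simp [ht]
    · rw [← restrict_cyl]
      refine Integrable.mono' (wI.abs.const_mul Z) (wI.1.mul ?_) (ae_of_all _ fun z => ?_)
      · refine Measurable.aestronglyMeasurable ?_
        exact ((measurable_one.indicator measurableSet_Ioc).comp measurable_fst).mul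
          (hζ.1.continuous.measurable.comp measurable_snd)
      · rw [norm_mul, norm_mul, mul_comm, Real.norm_eq_abs (w z)]
        gcongr
        calc ‖(Ioc t₁ t₂).indicator (1 : ℝ → ℝ) z.1‖ * ‖ζ z.2‖ ≤ 1 * Z := by
              have := hZ z.2
              have : ‖(Ioc t₁ t₂).indicator (1 : ℝ → ℝ) z.1‖ ≤ 1 := by
                simp only [indicator, Pi.one_apply]
                split_ifs <;> simp
              gcongr
          _ = Z := one_mul _
  have final := tendsto_nhds_unique (lim1.congr' (lhs.mono fun n hn => hn.symm))
    (lim2.neg.congr' (weak.mono fun n hn => hn.symm))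
  rw [fub, feq t₁ ⟨h1.le, (h12.trans h2).le⟩, feq t₂ ⟨(h1.trans h12).le, h2.le⟩] at final
  have Is : ∀ t ∈ Icc 0 S, Integrable (fun x => u (t, x) * ζ x) (volume.restrict Ω) :=
    fun t ht => by
      refine Integrable.of_bound (C := R * Z) (ContinuousOn.aestronglyMeasurable ?_
        hΩo.measurableSet) ?_
      · refine ContinuousOn.mul ?_ hζ.1.continuous.continuousOn
        exact hu.comp (by fun_prop) fun x hx => ⟨ht, subset_closure hx⟩
      · filter_upwards [ae_restrict_mem hΩo.measurableSet] with x hx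
        rw [norm_mul]
        have b1 := hR0 t ht x hx
        have b2 := hZ x
        have := (norm_nonneg _).trans b1
        gcongr
  rw [← neg_eq_iff_eq_neg, neg_sub, ← integral_sub (Is t₂ ⟨(h1.trans h12).le, h2.le⟩)
    (Is t₁ ⟨h1.le, (h12.trans h2).le⟩)] at final
  rw [← final]
  congr 1
  ext x
  ring

/-- A continuous function with an `L²` weak time derivative is, for almost every `x`, a primitive
of that derivative on the whole time interval. -/
lemma IsWeakTimeDeriv.ae_eq_integral {N : ℕ} {Ω : Set (E N)} (hΩo : IsOpen Ω)
    (hΩ : Bornology.IsBounded Ω) {S : ℝ} (hS : 0 < S) {u w : ℝ × E N → ℝ}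
    (hw : IsWeakTimeDeriv Ω S u w) (hu : ContinuousOn u (Icc 0 S ×ˢ closure Ω)) :
    ∀ᵐ x ∂(volume.restrict Ω), IntervalIntegrable (fun t => w (t, x)) volume 0 S ∧
      ∀ t ∈ Icc 0 S, u (t, x) = u (0, x) + ∫ s in 0..t, w (s, x) := by
  have fin1 : IsFiniteMeasure (volume.restrict Ω) := ⟨by simpa using hΩ.measure_lt_top⟩
  have fin2 := isFiniteMeasure_restrict_cyl hΩ S
  have hcompact : IsCompact (Icc 0 S ×ˢ closure Ω) := isCompact_Icc.prod hΩ.isCompact_closure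
  obtain ⟨R, hR⟩ := hcompact.exists_bound_of_continuousOn hu
  have wI : Integrable w (volume.restrict (cyl Ω S)) := hw.1.integrable one_le_two
  have wI' := wI
  rw [restrict_cyl] at wI'
  have step : ∀ q₁ q₂ : ℚ, 0 < (q₁ : ℝ) → (q₁ : ℝ) < q₂ → (q₂ : ℝ) < S →
      ∀ᵐ x ∂(volume.restrict Ω), u (q₂, x) - u (q₁, x) - ∫ t in (q₁ : ℝ)..q₂, w (t, x) = 0 := by
    intro q₁ q₂ h1 h12 h2
    have Is : ∀ t ∈ Icc 0 S, IntegrableOn (fun x => u (t, x)) Ω := fun t ht => by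
      refine Integrable.of_bound (C := R) (ContinuousOn.aestronglyMeasurable ?_
        hΩo.measurableSet) ?_
      · exact hu.comp (by fun_prop) fun x hx => ⟨ht, subset_closure hx⟩
      · filter_upwards [ae_restrict_mem hΩo.measurableSet] with x hx
        exact hR (t, x) ⟨ht, subset_closure hx⟩
    have I1 := Is q₁ ⟨h1.le, (h12.trans h2).le⟩
    have I2 := Is q₂ ⟨(h1.trans h12).le, h2.le⟩
    have hsub : Ioc (q₁ : ℝ) q₂ ⊆ Ioo 0 S := fun t ht => ⟨h1.trans ht.1, ht.2.trans_lt h2⟩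
    have I3 : IntegrableOn (fun x => ∫ t in (q₁ : ℝ)..q₂, w (t, x)) Ω := by
      simp only [intervalIntegral.integral_of_le h12.le]
      have : Integrable w ((volume.restrict (Ioc (q₁ : ℝ) q₂)).prod (volume.restrict Ω)) := by
        refine wI'.mono_measure ?_
        exact Measure.prod_mono (Measure.restrict_mono hsub le_rfl) le_rfl
      exact this.integral_prod_right
    have I : IntegrableOn
        (fun x => u (q₂, x) - u (q₁, x) - ∫ t in (q₁ : ℝ)..q₂, w (t, x)) Ω := (I2.sub I1).sub I3
    rw [ae_restrict_iff' hΩo.measurableSet]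
    refine hΩo.ae_eq_zero_of_integral_contDiff_smul_eq_zero I.locallyIntegrableOn ?_
    intro ζ hζ hζc hζs
    obtain ⟨Z, hZ⟩ := hζc.exists_bound_of_continuous hζ.continuous
    rw [← setIntegral_eq_integral_of_forall_compl_eq_zero (s := Ω) fun x hx => by
      rw [image_eq_zero_of_notMem_tsupport fun h => hx (hζs h), zero_smul]]
    have J : ∀ {v : E N → ℝ}, IntegrableOn v Ω → IntegrableOn (fun x => ζ x * v x) Ω :=
      fun hv => hv.bdd_mul hζ.continuous.aestronglyMeasurable (ae_of_all _ hZ)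
    have := hw.integral_mul_sub hΩo hΩ hu h1 h12 h2 ⟨hζ, hζc, hζs⟩
    simp only [smul_eq_mul, mul_sub (ζ _) (_ - _)]
    have I21 : IntegrableOn (fun x => u (q₂, x) - u (q₁, x)) Ω := I2.sub I1
    rw [integral_sub (J I21) (J I3), this, sub_self]
  have all : ∀ᵐ x ∂(volume.restrict Ω), ∀ q₁ q₂ : ℚ, 0 < (q₁ : ℝ) → (q₁ : ℝ) < q₂ →
      (q₂ : ℝ) < S → u (q₂, x) - u (q₁, x) - ∫ t in (q₁ : ℝ)..q₂, w (t, x) = 0 := by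
    simp only [ae_all_iff]
    exact step
  filter_upwards [all, wI'.prod_left_ae, ae_restrict_mem hΩo.measurableSet] with x hx hxI hxΩ
  have wS : IntervalIntegrable (fun t => w (t, x)) volume 0 S := by
    rw [intervalIntegrable_iff_integrableOn_Ioo_of_le hS.le]
    exact hxI
  refine ⟨wS, ?_⟩
  have uc : ContinuousOn (fun t => u (t, x)) (Icc 0 S) :=
    hu.comp (by fun_prop) fun t ht => ⟨ht, subset_closure hxΩ⟩
  have pc : ContinuousOn (fun t => ∫ s in 0..t, w (s, x)) (Icc 0 S) := by
    have := intervalIntegral.continuousOn_primitive_interval' wS (a := 0) (by simp)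
    rwa [uIcc_of_le hS.le] at this
  have sub : ∀ t ∈ Icc 0 S, IntervalIntegrable (fun t => w (t, x)) volume 0 t := fun t ht =>
    wS.mono_set (by
      rw [uIcc_of_le ht.1, uIcc_of_le hS.le]
      exact Icc_subset_Icc_right ht.2)
  obtain ⟨q, hq0, hqS⟩ := exists_rat_btwn hS
  have dense : Icc 0 S ⊆ closure (Ioo 0 S ∩ range ((↑) : ℚ → ℝ)) := by
    rw [← closure_Ioo hS.ne]
    exact closure_minimal (Rat.isDenseEmbedding_coe_real.dense.open_subset_closure_inter isOpen_Ioo)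
      isClosed_closure
  have eqv : EqOn (fun t => u (t, x) - ∫ s in 0..t, w (s, x))
      (fun _ => u (q, x) - ∫ s in 0..(q : ℝ), w (s, x)) (Icc 0 S) := by
    refine EqOn.of_subset_closure (s := Ioo 0 S ∩ range ((↑) : ℚ → ℝ)) ?_ (uc.sub pc)
      continuousOn_const (inter_subset_left.trans Ioo_subset_Icc_self) dense
    rintro t ⟨ht, r, rfl⟩
    have split := intervalIntegral.integral_interval_sub_left (sub r (Ioo_subset_Icc_self ht))
      (sub q ⟨hq0.le, hqS.le⟩)
    have split' := intervalIntegral.integral_interval_sub_left (sub q ⟨hq0.le, hqS.le⟩)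
      (sub r (Ioo_subset_Icc_self ht))
    simp only
    rcases lt_trichotomy (r : ℝ) q with h | h | h
    · have := hx r q ht.1 h hqS
      linarith
    · rw [h]
    · have := hx q r hq0 h ht.2
      linarith
  intro t ht
  have e1 := eqv ht
  have e2 := eqv (x := 0) ⟨le_rfl, hS.le⟩
  simp only [intervalIntegral.integral_same, sub_zero] at e1 e2
  linarith

/-! ### The pointwise energy inequality -/

lemma abs_rpow_sub_one_mul {u a : ℝ} (hu : 0 ≤ u) (ha : 0 < a) : |u| ^ (a - 1) * u = u ^ a := by
  rcases hu.eq_or_lt with rfl | hu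
  · simp [Real.zero_rpow ha.ne']
  · rw [abs_of_pos hu, Real.rpow_sub_one hu.ne', div_mul_cancel₀ _ hu.ne']

/-- The reaction and gradient terms, as a function of the values `u` of the solution, `G` of the
norm of its gradient, and `J` of the nonlocal integral. -/
noncomputable def Params.source (P : Params) (u G J : ℝ) : ℝ :=
  P.α * u ^ P.k * J - P.β * u ^ P.l * G ^ P.q + P.γ * u ^ P.m + P.μ * G ^ P.r - P.ν * u ^ P.σ

/-- Where `u < W`, the difference of the sources, tested with the square of `W - u`, is controlled
by the monotonicity of the `p`-Laplacian up to terms of the order of the energy. This is where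
`q, r ≥ p / 2` is used: the gradient terms are then Lipschitz functions of `|∇u|^(p/2)`. -/
lemma Params.exists_source_diff_le (P : Params) (hα : 0 < P.α) (hβ : 0 ≤ P.β) (hγ : 0 < P.γ)
    (hν : 0 ≤ P.ν) (hl : 0 < P.l) (hσ : 0 < P.σ) (hk : 1 ≤ P.k) (hs : 1 ≤ P.s) (hm : 1 ≤ P.m)
    (hp : 2 ≤ P.p) (hq : P.p / 2 ≤ P.q) (hr : P.p / 2 ≤ P.r) {R J : ℝ} (hR : 0 ≤ R) (hJ : 0 ≤ J)
    (N : ℕ) :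
    ∃ C, 0 ≤ C ∧ ∀ (W u JW Ju I A : ℝ) (ξ η : E N), 0 ≤ u → u < W → W ≤ R → ‖ξ‖ ≤ R → ‖η‖ ≤ R →
      0 ≤ Ju → Ju ≤ J → 0 ≤ I → JW - Ju ≤ P.s * R ^ (P.s - 1) * I →
      A ≤ P.source W ‖ξ‖ JW →
      (A - P.source u ‖η‖ Ju) * (W - u) ^ 2
          - 2 * (W - u) * (‖ξ‖ ^ (P.p - 2) * inner ℝ ξ (ξ - η)
            - ‖η‖ ^ (P.p - 2) * inner ℝ η (ξ - η))
        ≤ C * ((W - u) ^ 3 + (W - u) ^ 2 * I) := by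
  have hb : 0 < P.p / 2 := by linarith
  have hp0 : 0 < P.p := by linarith
  have hq0 : 0 < P.q := by linarith
  have hr0 : 0 < P.r := by linarith
  have hk0 : 0 < P.k := by linarith
  have hs0 : 0 < P.s := by linarith
  have hm0 : 0 < P.m := by linarith
  have lip : ∀ e, P.p / 2 ≤ e → ∃ L, 0 ≤ L ∧ ∀ X Y : ℝ, 0 ≤ X → 0 ≤ Y → X ≤ R → Y ≤ R →
      |X ^ e - Y ^ e| ≤ L * |X ^ (P.p / 2) - Y ^ (P.p / 2)| := fun e he => by
    have he0 : 0 < e := by linarith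
    exact ⟨e / (P.p / 2) * (R ^ (P.p / 2)) ^ (e / (P.p / 2) - 1), by positivity,
      fun X Y hX hY hXR hYR => abs_rpow_sub_rpow_le hb he hX hY hXR hYR⟩
  obtain ⟨Lq, hLq, lipq⟩ := lip P.q hq
  obtain ⟨Lr, hLr, lipr⟩ := lip P.r hr
  set L := |P.μ| * Lr + P.β * R ^ P.l * Lq
  have hL : 0 ≤ L := by positivity
  set C1 := P.α * R ^ P.k * (P.s * R ^ (P.s - 1))
  set C2 := P.α * (P.k * R ^ (P.k - 1)) * J
  set C3 := P.γ * (P.m * R ^ (P.m - 1))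
  have hC1 : 0 ≤ C1 := by positivity
  have hC2 : 0 ≤ C2 := by positivity
  have hC3 : 0 ≤ C3 := by positivity
  refine ⟨C1 + C2 + C3 + P.p * L ^ 2 / 16, by positivity, ?_⟩
  intro W u JW Ju I A ξ η hu huW hWR hξ hη hJu hJuJ hI hJ' hA
  have hW : 0 ≤ W := hu.trans huW.le
  have hd : 0 < W - u := sub_pos.2 huW
  have mono := inner_rpow_smul_sub_ge hp ξ η
  have dq := lipq _ _ (norm_nonneg ξ) (norm_nonneg η) hξ hη
  have dr := lipr _ _ (norm_nonneg ξ) (norm_nonneg η) hξ hη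
  rw [← sq_abs] at mono
  have hd0 : 0 ≤ |‖ξ‖ ^ (P.p / 2) - ‖η‖ ^ (P.p / 2)| := abs_nonneg _
  generalize |‖ξ‖ ^ (P.p / 2) - ‖η‖ ^ (P.p / 2)| = d at mono dq dr hd0
  generalize ‖ξ‖ ^ (P.p - 2) * inner ℝ ξ (ξ - η) - ‖η‖ ^ (P.p - 2) * inner ℝ η (ξ - η) = Q
    at mono ⊢
  have t1 : P.α * W ^ P.k * JW - P.α * u ^ P.k * Ju ≤ C1 * I + C2 * (W - u) := by
    have a1 : W ^ P.k * (JW - Ju) ≤ R ^ P.k * (P.s * R ^ (P.s - 1) * I) := by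
      have : W ^ P.k * (JW - Ju) ≤ W ^ P.k * (P.s * R ^ (P.s - 1) * I) := by gcongr
      refine this.trans ?_
      gcongr
    have a2 : (W ^ P.k - u ^ P.k) * Ju ≤ P.k * R ^ (P.k - 1) * (W - u) * J := by
      have a3 := rpow_sub_rpow_le hk hu huW.le hWR
      have a4 : 0 ≤ W ^ P.k - u ^ P.k :=
        sub_nonneg.2 (Real.rpow_le_rpow hu huW.le (by linarith))
      gcongr
    have a5 : P.α * W ^ P.k * JW - P.α * u ^ P.k * Ju
        = P.α * (W ^ P.k * (JW - Ju)) + P.α * ((W ^ P.k - u ^ P.k) * Ju) := by ring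
    have a6 : C1 * I + C2 * (W - u) = P.α * (R ^ P.k * (P.s * R ^ (P.s - 1) * I))
        + P.α * (P.k * R ^ (P.k - 1) * (W - u) * J) := by
      simp only [C1, C2]; ring
    rw [a5, a6]
    gcongr
  have t2 : -(P.β * W ^ P.l * ‖ξ‖ ^ P.q) + P.β * u ^ P.l * ‖η‖ ^ P.q
      ≤ P.β * R ^ P.l * Lq * d := by
    have a1 : u ^ P.l ≤ W ^ P.l := Real.rpow_le_rpow hu huW.le hl.le
    have a2 : u ^ P.l ≤ R ^ P.l := Real.rpow_le_rpow hu (huW.le.trans hWR) hl.le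
    have a4 : ‖η‖ ^ P.q - ‖ξ‖ ^ P.q ≤ Lq * d := by
      have := neg_abs_le (‖ξ‖ ^ P.q - ‖η‖ ^ P.q)
      linarith
    have a5 : u ^ P.l * ‖ξ‖ ^ P.q ≤ W ^ P.l * ‖ξ‖ ^ P.q := by gcongr
    have a6 : u ^ P.l * (‖η‖ ^ P.q - ‖ξ‖ ^ P.q) ≤ R ^ P.l * (Lq * d) := by
      have : u ^ P.l * (‖η‖ ^ P.q - ‖ξ‖ ^ P.q) ≤ u ^ P.l * (Lq * d) := by gcongr
      refine this.trans ?_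
      gcongr
    have a7 : -(P.β * W ^ P.l * ‖ξ‖ ^ P.q) + P.β * u ^ P.l * ‖η‖ ^ P.q
        = P.β * (u ^ P.l * (‖η‖ ^ P.q - ‖ξ‖ ^ P.q)
          - (W ^ P.l * ‖ξ‖ ^ P.q - u ^ P.l * ‖ξ‖ ^ P.q)) := by ring
    rw [a7, show P.β * R ^ P.l * Lq * d = P.β * (R ^ P.l * (Lq * d)) by ring]
    gcongr
    linarith
  have t3 : P.γ * W ^ P.m - P.γ * u ^ P.m ≤ C3 * (W - u) := by
    have := mul_le_mul_of_nonneg_left (rpow_sub_rpow_le hm hu huW.le hWR) hγ.le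
    simp only [C3]
    linarith
  have t4 : P.μ * ‖ξ‖ ^ P.r - P.μ * ‖η‖ ^ P.r ≤ |P.μ| * Lr * d := by
    rw [← mul_sub, mul_assoc]
    refine (le_abs_self _).trans ?_
    rw [abs_mul]
    gcongr
  have t5 : -(P.ν * W ^ P.σ) + P.ν * u ^ P.σ ≤ 0 := by
    have := mul_le_mul_of_nonneg_left (Real.rpow_le_rpow hu huW.le hσ.le) hν
    linarith
  have hsrc : A - P.source u ‖η‖ Ju ≤ C1 * I + (C2 + C3) * (W - u) + L * d := by
    have : L * d = |P.μ| * Lr * d + P.β * R ^ P.l * Lq * d := by simp only [L]; ring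
    unfold Params.source at hA ⊢
    linarith
  have h1 : (A - P.source u ‖η‖ Ju) * (W - u) ^ 2
      ≤ (C1 * I + (C2 + C3) * (W - u) + L * d) * (W - u) ^ 2 := by gcongr
  have h2 := mul_le_mul_of_nonneg_left mono (show 0 ≤ 2 * (W - u) by positivity)
  -- Young's inequality absorbs the gradient terms into the monotone part
  have h3 : L * d * (W - u) ^ 2
      ≤ 2 * (W - u) * (2 / P.p * d ^ 2) + P.p * L ^ 2 / 16 * (W - u) ^ 3 := by
    have : 2 * (W - u) * (2 / P.p * d ^ 2) + P.p * L ^ 2 / 16 * (W - u) ^ 3 - L * d * (W - u) ^ 2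
        = (W - u) / P.p * (2 * d - P.p * L * (W - u) / 4) ^ 2 := by
      field_simp
      ring
    have h4 : 0 ≤ (W - u) / P.p * (2 * d - P.p * L * (W - u) / 4) ^ 2 := by positivity
    linarith
  have h5 : 0 ≤ (C2 + C3 + P.p * L ^ 2 / 16) * ((W - u) ^ 2 * I) := by positivity
  have h6 : 0 ≤ C1 * (W - u) ^ 3 := by positivity
  linarith

lemma exists_ae_norm_le_of_memLp_top {X F : Type*} [MeasurableSpace X] [NormedAddCommGroup F]
    {μ : Measure X} {f : X → F} (h : MemLp f ⊤ μ) : ∃ C, ∀ᵐ x ∂μ, ‖f x‖ ≤ C := by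
  have hfin : eLpNormEssSup f μ < ⊤ := by simpa using h.2
  refine ⟨(eLpNormEssSup f μ).toReal, ?_⟩
  filter_upwards [enorm_ae_le_eLpNormEssSup f μ] with x hx
  rw [← toReal_enorm]
  exact ENNReal.toReal_mono hfin.ne hx

/-- The double integral of `f x ^ 2 * f y ≤ f x ^ 3 + f y ^ 3`. -/
lemma integral_sq_mul_integral_le {X : Type*} [MeasurableSpace X] {μ : Measure X}
    [IsFiniteMeasure μ] {f : X → ℝ} (hf : ∀ᵐ x ∂μ, 0 ≤ f x) (h : MemLp f ⊤ μ) :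
    (∫ x, f x ^ 2 ∂μ) * ∫ x, f x ∂μ ≤ 2 * μ.real univ * ∫ x, f x ^ 3 ∂μ := by
  have m : ∀ n : ℕ, Integrable (fun x => f x ^ n) μ := fun n => by
    obtain ⟨C, hC⟩ := exists_ae_norm_le_of_memLp_top h
    refine Integrable.of_bound (C := C ^ n) (h.1.pow n) ?_
    filter_upwards [hC] with x hx
    rw [norm_pow]
    gcongr
  have m1 : Integrable f μ := by simpa using m 1
  have step : ∀ᵐ x ∂μ, f x ^ 2 * ∫ y, f y ∂μ ≤ f x ^ 3 * μ.real univ + ∫ y, f y ^ 3 ∂μ := by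
    filter_upwards [hf] with x hx
    have : f x ^ 3 * μ.real univ = ∫ _, f x ^ 3 ∂μ := by simp [mul_comm]
    rw [this, ← integral_add (integrable_const _) (m 3), ← integral_const_mul]
    refine integral_mono_ae (m1.const_mul _) ((integrable_const _).add (m 3)) ?_
    filter_upwards [hf] with y hy
    rcases le_total (f x) (f y) with hxy | hxy
    · have : f x ^ 2 * f y ≤ f y ^ 2 * f y := by gcongr
      nlinarith [pow_nonneg hx 3]
    · have : f x ^ 2 * f y ≤ f x ^ 2 * f x := by gcongr
      nlinarith [pow_nonneg hy 3]
  have := integral_mono_ae ((m 2).mul_const _) (((m 3).mul_const _).add (integrable_const _)) step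
  rw [integral_mul_const] at this
  refine this.trans_eq ?_
  rw [integral_add' ((m 3).mul_const _) (integrable_const _), integral_mul_const]
  simp
  ring

/-! ### Bounded functions on the cylinder -/

lemma memLp_top_mul {X : Type*} [MeasurableSpace X] {μ : Measure X} {f g : X → ℝ}
    (hf : MemLp f ⊤ μ) (hg : MemLp g ⊤ μ) : MemLp (fun x => f x * g x) ⊤ μ := by
  obtain ⟨C, hC⟩ := exists_ae_norm_le_of_memLp_top hf
  obtain ⟨D, hD⟩ := exists_ae_norm_le_of_memLp_top hg
  refine memLp_top_of_bound (hf.1.mul hg.1) (C * D) ?_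
  filter_upwards [hC, hD] with x h1 h2
  rw [norm_mul]
  have := (norm_nonneg _).trans h1
  gcongr

lemma memLp_top_norm_rpow {X F : Type*} [MeasurableSpace X] [NormedAddCommGroup F]
    {μ : Measure X} {f : X → F} (hf : MemLp f ⊤ μ) {a : ℝ} (ha : 0 ≤ a) :
    MemLp (fun x => ‖f x‖ ^ a) ⊤ μ := by
  obtain ⟨C, hC⟩ := exists_ae_norm_le_of_memLp_top hf
  refine memLp_top_of_bound (hf.1.norm.aemeasurable.pow_const a).aestronglyMeasurable (C ^ a) ?_
  filter_upwards [hC] with x h1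
  rw [Real.norm_of_nonneg (by positivity)]
  gcongr

lemma memLp_top_inner {X F : Type*} [MeasurableSpace X] [NormedAddCommGroup F]
    [InnerProductSpace ℝ F] {μ : Measure X} {f g : X → F}
    (hf : MemLp f ⊤ μ) (hg : MemLp g ⊤ μ) : MemLp (fun x => inner ℝ (f x) (g x)) ⊤ μ := by
  obtain ⟨C, hC⟩ := exists_ae_norm_le_of_memLp_top hf
  obtain ⟨D, hD⟩ := exists_ae_norm_le_of_memLp_top hg
  refine memLp_top_of_bound (hf.1.inner hg.1) (C * D) ?_
  filter_upwards [hC, hD] with x h1 h2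
  have := (norm_nonneg _).trans h1
  exact (norm_inner_le_norm _ _).trans (by gcongr)

lemma memLp_top_smul {X F : Type*} [MeasurableSpace X] [NormedAddCommGroup F]
    [NormedSpace ℝ F] {μ : Measure X} {f : X → ℝ} {g : X → F}
    (hf : MemLp f ⊤ μ) (hg : MemLp g ⊤ μ) : MemLp (fun x => f x • g x) ⊤ μ := by
  obtain ⟨C, hC⟩ := exists_ae_norm_le_of_memLp_top hf
  obtain ⟨D, hD⟩ := exists_ae_norm_le_of_memLp_top hg
  refine memLp_top_of_bound (hf.1.smul hg.1) (C * D) ?_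
  filter_upwards [hC, hD] with x h1 h2
  have := (norm_nonneg _).trans h1
  rw [norm_smul]
  gcongr

lemma measurableSet_cyl {N : ℕ} {Ω : Set (E N)} (hΩo : IsOpen Ω) (S : ℝ) :
    MeasurableSet (cyl Ω S) := measurableSet_Ioo.prod hΩo.measurableSet

lemma cyl_subset {N : ℕ} (Ω : Set (E N)) (S : ℝ) : cyl Ω S ⊆ Icc 0 S ×ˢ closure Ω :=
  prod_mono Ioo_subset_Icc_self subset_closure

lemma memLp_top_of_continuousOn {N : ℕ} {Ω : Set (E N)} (hΩo : IsOpen Ω)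
    (hΩ : Bornology.IsBounded Ω) {S : ℝ} {F : Type*} [NormedAddCommGroup F]
    {f : ℝ × E N → F} (hf : ContinuousOn f (Icc 0 S ×ˢ closure Ω)) :
    MemLp f ⊤ (volume.restrict (cyl Ω S)) := by
  obtain ⟨C, hC⟩ := (isCompact_Icc.prod hΩ.isCompact_closure).exists_bound_of_continuousOn hf
  refine memLp_top_of_bound ((hf.mono (cyl_subset Ω S)).aestronglyMeasurable
    (measurableSet_cyl hΩo S)) C ?_
  filter_upwards [ae_restrict_mem (measurableSet_cyl hΩo S)] with z hz
  exact hC z (cyl_subset Ω S hz)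

lemma memLp_top_slice_of_continuousOn {N : ℕ} {Ω : Set (E N)} (hΩo : IsOpen Ω)
    (hΩ : Bornology.IsBounded Ω) {S : ℝ}
    {f : ℝ × E N → ℝ} (hf : ContinuousOn f (Icc 0 S ×ˢ closure Ω)) {t : ℝ} (ht : t ∈ Icc 0 S) :
    MemLp (fun x => f (t, x)) ⊤ (volume.restrict Ω) := by
  obtain ⟨C, hC⟩ := (isCompact_Icc.prod hΩ.isCompact_closure).exists_bound_of_continuousOn hf
  refine memLp_top_of_bound (ContinuousOn.aestronglyMeasurable ?_ hΩo.measurableSet) C ?_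
  · exact hf.comp (by fun_prop) fun x hx => ⟨ht, subset_closure hx⟩
  · filter_upwards [ae_restrict_mem hΩo.measurableSet] with x hx
    exact hC (t, x) ⟨ht, subset_closure hx⟩

lemma memLp_top_integral_of_continuousOn {N : ℕ} {Ω : Set (E N)} (hΩo : IsOpen Ω)
    (hΩ : Bornology.IsBounded Ω) {S : ℝ}
    {f : ℝ × E N → ℝ} (hf : ContinuousOn f (Icc 0 S ×ˢ closure Ω)) :
    MemLp (fun z : ℝ × E N => ∫ y in Ω, f (z.1, y)) ⊤ (volume.restrict (cyl Ω S)) := by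
  have fin1 : IsFiniteMeasure (volume.restrict Ω) := ⟨by simpa using hΩ.measure_lt_top⟩
  obtain ⟨C, hC⟩ := (isCompact_Icc.prod hΩ.isCompact_closure).exists_bound_of_continuousOn hf
  have hm := (memLp_top_of_continuousOn hΩo hΩ hf).1
  rw [restrict_cyl] at hm
  have hm2 := hm.integral_prod_right'
  refine memLp_top_of_bound ?_ (C * (volume.restrict Ω).real univ) ?_
  · rw [restrict_cyl]
    exact hm2.comp_fst
  · filter_upwards [ae_restrict_mem (measurableSet_cyl hΩo S)] with z hz
    refine norm_integral_le_of_norm_le_const ?_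
    filter_upwards [ae_restrict_mem hΩo.measurableSet] with x hx
    exact hC (z.1, x) ⟨Ioo_subset_Icc_self hz.1, subset_closure hx⟩

/-! ### Comparison with a paraboloid -/

/-- The integrand is the time derivative of `exp (-λ t) (W - u)₊³`, a nonnegative function that
vanishes at time `0`. -/
lemma IsWeakTimeDeriv.integral_energy_nonneg {N : ℕ} {Ω : Set (E N)} (hΩo : IsOpen Ω)
    (hΩ : Bornology.IsBounded Ω) {S : ℝ} (hS : 0 < S) {u w : ℝ × E N → ℝ}
    (hw : IsWeakTimeDeriv Ω S u w) (hu : ContinuousOn u (Icc 0 S ×ˢ closure Ω))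
    {W Wt : ℝ × E N → ℝ}
    (hW : ∀ x ∈ Ω, ∀ t ∈ Icc 0 S, HasDerivAt (fun t => W (t, x)) (Wt (t, x)) t)
    (hWt : ContinuousOn Wt (Icc 0 S ×ˢ closure Ω))
    (h0 : ∀ x ∈ Ω, W (0, x) ≤ u (0, x)) {lam : ℝ}
    (hI : Integrable (fun z => Real.exp (-lam * z.1) *
      (3 * max (W z - u z) 0 ^ 2 * (Wt z - w z) - lam * max (W z - u z) 0 ^ 3))
      (volume.restrict (cyl Ω S))) :
    0 ≤ ∫ z in cyl Ω S, Real.exp (-lam * z.1) *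
      (3 * max (W z - u z) 0 ^ 2 * (Wt z - w z) - lam * max (W z - u z) 0 ^ 3) := by
  rw [restrict_cyl] at hI ⊢
  rw [integral_prod_symm _ hI]
  refine integral_nonneg_of_ae ?_
  filter_upwards [hw.ae_eq_integral hΩo hΩ hS hu, ae_restrict_mem hΩo.measurableSet]
    with x ⟨hwI, hux⟩ hx
  have cWt : ContinuousOn (fun t => Wt (t, x)) (Icc 0 S) :=
    hWt.comp (by fun_prop) fun t ht => ⟨ht, subset_closure hx⟩
  have iWt : ∀ t ∈ Icc 0 S, IntervalIntegrable (fun t => Wt (t, x)) volume 0 t := fun t ht =>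
    (cWt.mono (by rw [uIcc_of_le ht.1]; exact Icc_subset_Icc_right ht.2)).intervalIntegrable
  have ftc : ∀ t ∈ Icc 0 S, W (t, x) = W (0, x) + ∫ s in 0..t, Wt (s, x) := fun t ht => by
    rw [intervalIntegral.integral_eq_sub_of_hasDerivAt (fun s hs => hW x hx s ?_) (iWt t ht)]
    · ring
    · rw [uIcc_of_le ht.1] at hs
      exact ⟨hs.1, hs.2.trans ht.2⟩
  have hSS : S ∈ Icc 0 S := ⟨hS.le, le_rfl⟩
  have key := integral_exp_mul_max_zero_pow_three (lam := lam) (c := W (0, x) - u (0, x)) hS.le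
    ((iWt S hSS).sub hwI) (f := fun t => W (t, x) - u (t, x)) fun t ht => by
      have hwt : IntervalIntegrable (fun t => w (t, x)) volume 0 t := hwI.mono_set (by
        rw [uIcc_of_le ht.1, uIcc_of_le hS.le]
        exact Icc_subset_Icc_right ht.2)
      rw [intervalIntegral.integral_sub (iWt t ht) hwt, ftc t ht, hux t ht]
      ring
  rw [intervalIntegral.integral_of_le hS.le, integral_Ioc_eq_integral_Ioo] at key
  simp only [Pi.zero_apply]
  rw [key, max_eq_right (sub_nonpos.2 (h0 x hx))]
  have := le_max_right (W (S, x) - u (S, x)) 0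
  simp only [ne_eq, OfNat.ofNat_ne_zero, not_false_eq_true, zero_pow, sub_zero]
  positivity

/-- The paraboloid `a(t) - b(t) |x - x₀|²`. -/
noncomputable def barrier {N : ℕ} (a b : ℝ → ℝ) (x₀ : E N) (z : ℝ × E N) : ℝ :=
  a z.1 - b z.1 * ‖z.2 - x₀‖ ^ 2

lemma gradient_paraboloid {N : ℕ} (a b : ℝ) (x₀ x : E N) :
    gradient (fun x => a - b * ‖x - x₀‖ ^ 2) x = (-(2 * b)) • (x - x₀) := by
  have h1 : HasFDerivAt (fun x : E N => ‖x - x₀‖ ^ 2) (2 • (innerSL ℝ (x - x₀))) x := by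
    have := ((hasFDerivAt_id x).sub_const x₀).norm_sq
    simpa using this
  have h2 : HasFDerivAt (fun x : E N => a - b * ‖x - x₀‖ ^ 2)
      (-(b • (2 • (innerSL ℝ (x - x₀))))) x := (h1.const_mul b).const_sub a
  rw [gradient, h2.fderiv, LinearIsometryEquiv.symm_apply_eq]
  ext y
  simp [InnerProductSpace.toDual_apply_apply]
  ring

lemma contDiff_paraboloid {N : ℕ} (a b : ℝ) (x₀ : E N) :
    ContDiff ℝ ∞ (fun x : E N => a - b * ‖x - x₀‖ ^ 2) :=
  contDiff_const.sub (contDiff_const.mul ((contDiff_id.sub contDiff_const).norm_sq ℝ))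

lemma Params.le_top (P : Params) : P.p ≤ P.top := le_max_left _ _

/-- The negative `p`-Laplacian of the paraboloid `a - b |y|²`, at a point with `|y| = r`. -/
noncomputable def paraboloidPLaplace (N : ℕ) (p b r : ℝ) : ℝ :=
  (2 * b) ^ (p - 1) * ((N + (p - 2)) * r ^ (p - 2))

lemma integral_paraboloid_flux {N : ℕ} {Ω : Set (E N)} (hΩ : Bornology.IsBounded Ω)
    (hΩm : MeasurableSet Ω) {p : ℝ} (hp : 2 ≤ p) {a : ℝ≥0∞} (ha : 1 ≤ a) {f : E N → ℝ}
    {h : E N → E N} (hf : MemW0 Ω a f h) (x₀ : E N) {b : ℝ} (hb : 0 < b) :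
    ∫ x in Ω, ‖(-(2 * b)) • (x - x₀)‖ ^ (p - 2) * inner ℝ ((-(2 * b)) • (x - x₀)) (h x)
      = ∫ x in Ω, paraboloidPLaplace N p b ‖x - x₀‖ * f x := by
  have key := hf.integral_norm_rpow_inner hΩ hΩm ha (e := p - 2) (by linarith) x₀
  have e1 : ∀ x : E N, ‖(-(2 * b)) • (x - x₀)‖ ^ (p - 2) * inner ℝ ((-(2 * b)) • (x - x₀)) (h x)
      = (-(2 * b) ^ (p - 1)) * (‖x - x₀‖ ^ (p - 2) * inner ℝ (x - x₀) (h x)) := fun x => by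
    have h2b : 0 < 2 * b := by positivity
    rw [norm_smul, norm_neg, Real.norm_of_nonneg h2b.le,
      Real.mul_rpow h2b.le (norm_nonneg _), real_inner_smul_left,
      show p - 1 = (p - 2) + 1 by ring, Real.rpow_add_one h2b.ne']
    ring
  have e2 : ∀ x : E N, paraboloidPLaplace N p b ‖x - x₀‖ * f x
      = ((2 * b) ^ (p - 1) * (N + (p - 2))) * (‖x - x₀‖ ^ (p - 2) * f x) := fun x => by
    unfold paraboloidPLaplace
    ring
  simp only [e1, e2]
  rw [integral_const_mul, integral_const_mul, key]
  ring

/-- The comparison principle for a paraboloid that is a subsolution where it is positive. The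
weak formulation is tested with `exp (-λ t) (W - u)₊²`; for large `λ` the resulting energy
inequality forces `(W - u)₊` to vanish. -/
theorem barrier_le {N : ℕ} {Ω : Set (E N)} (hΩo : IsOpen Ω) (hΩ : Bornology.IsBounded Ω)
    {P : Params} (hα : 0 < P.α) (hβ : 0 ≤ P.β) (hγ : 0 < P.γ)
    (hν : 0 ≤ P.ν) (hl : 0 < P.l) (hσ : 0 < P.σ) (hk : 1 ≤ P.k) (hs : 1 ≤ P.s) (hm : 1 ≤ P.m)
    (hp : 2 ≤ P.p) (hq : P.p / 2 ≤ P.q) (hr : P.p / 2 ≤ P.r)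
    {S : ℝ} (hS : 0 < S) {u₀ : E N → ℝ} {u : ℝ × E N → ℝ} (hsol : IsWeakSolution P Ω u₀ S u)
    (hu : ContinuousOn u (Icc 0 S ×ˢ closure Ω))
    {a b a' b' : ℝ → ℝ} (ha : ∀ t ∈ Icc 0 S, HasDerivAt a (a' t) t)
    (hb : ∀ t ∈ Icc 0 S, HasDerivAt b (b' t) t) (ha' : ContinuousOn a' (Icc 0 S))
    (hb' : ContinuousOn b' (Icc 0 S)) (hbpos : ∀ t ∈ Icc 0 S, 0 < b t)
    {x₀ : E N} {R₀ : ℝ} (hR₀ : 0 ≤ R₀) (hball : Metric.closedBall x₀ R₀ ⊆ Ω)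
    (hab : ∀ t ∈ Icc 0 S, a t ≤ b t * R₀ ^ 2)
    (h0 : ∀ x ∈ Ω, barrier a b x₀ (0, x) ≤ u (0, x))
    (hsub : ∀ t ∈ Ioo 0 S, ∀ x ∈ Ω, 0 < barrier a b x₀ (t, x) →
      a' t - b' t * ‖x - x₀‖ ^ 2 + paraboloidPLaplace N P.p (b t) ‖x - x₀‖
        ≤ P.source (barrier a b x₀ (t, x)) (2 * b t * ‖x - x₀‖)
          (∫ y in Ω, max (barrier a b x₀ (t, y)) 0 ^ P.s)) :
    ∀ z ∈ cyl Ω S, barrier a b x₀ z ≤ u z := by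
  obtain ⟨hu0, -, -, -, g, w, ⟨-, -, hW0⟩, -, hg, hw, hweak⟩ := hsol
  have fin1 : IsFiniteMeasure (volume.restrict Ω) := ⟨by simpa using hΩ.measure_lt_top⟩
  have fin2 := isFiniteMeasure_restrict_cyl hΩ S
  have hQ := measurableSet_cyl hΩo S
  set μ := (volume.restrict (cyl Ω S) : Measure (ℝ × E N)) with hμ
  set W : ℝ × E N → ℝ := barrier a b x₀ with hWdef
  have ca : ContinuousOn (fun z : ℝ × E N => a z.1) (Icc 0 S ×ˢ closure Ω) :=
    ContinuousOn.comp (t := Icc 0 S) (fun t ht => (ha t ht).continuousAt.continuousWithinAt)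
      continuousOn_fst fun z hz => hz.1
  have cb : ContinuousOn (fun z : ℝ × E N => b z.1) (Icc 0 S ×ˢ closure Ω) :=
    ContinuousOn.comp (t := Icc 0 S) (fun t ht => (hb t ht).continuousAt.continuousWithinAt)
      continuousOn_fst fun z hz => hz.1
  have ca' : ContinuousOn (fun z : ℝ × E N => a' z.1) (Icc 0 S ×ˢ closure Ω) :=
    ha'.comp continuousOn_fst fun z hz => hz.1
  have cb' : ContinuousOn (fun z : ℝ × E N => b' z.1) (Icc 0 S ×ˢ closure Ω) :=
    hb'.comp continuousOn_fst fun z hz => hz.1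
  have cn : ContinuousOn (fun z : ℝ × E N => ‖z.2 - x₀‖) (Icc 0 S ×ˢ closure Ω) := by fun_prop
  have cW : ContinuousOn W (Icc 0 S ×ˢ closure Ω) := ca.sub (cb.mul (cn.pow 2))
  set Wt : ℝ × E N → ℝ := fun z => a' z.1 - b' z.1 * ‖z.2 - x₀‖ ^ 2 with hWtdef
  have cWt : ContinuousOn Wt (Icc 0 S ×ˢ closure Ω) := ca'.sub (cb'.mul (cn.pow 2))
  set ξ : ℝ × E N → E N := fun z => (-(2 * b z.1)) • (z.2 - x₀) with hξdef
  have cξ : ContinuousOn ξ (Icc 0 S ×ˢ closure Ω) :=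
    (continuousOn_const.mul cb).neg.smul (by fun_prop)
  set D : ℝ × E N → ℝ := fun z => paraboloidPLaplace N P.p (b z.1) ‖z.2 - x₀‖ with hDdef
  have cD : ContinuousOn D (Icc 0 S ×ˢ closure Ω) :=
    ((continuousOn_const.mul cb).rpow_const fun z _ => Or.inr (by linarith)).mul
      (continuousOn_const.mul (cn.rpow_const fun z _ => Or.inr (by linarith)))
  -- a common bound for all the quantities that enter the energy inequality
  obtain ⟨R, hR, bu, bW, bξ, bg⟩ : ∃ R, 0 ≤ R ∧ (∀ z ∈ Icc 0 S ×ˢ closure Ω, ‖u z‖ ≤ R) ∧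
      (∀ z ∈ Icc 0 S ×ˢ closure Ω, ‖W z‖ ≤ R) ∧ (∀ z ∈ Icc 0 S ×ˢ closure Ω, ‖ξ z‖ ≤ R) ∧
      ∀ᵐ z ∂μ, ‖g z‖ ≤ R := by
    have hc : IsCompact (Icc 0 S ×ˢ closure Ω) := isCompact_Icc.prod hΩ.isCompact_closure
    obtain ⟨R1, h1⟩ := hc.exists_bound_of_continuousOn hu
    obtain ⟨R2, h2⟩ := hc.exists_bound_of_continuousOn cW
    obtain ⟨R3, h3⟩ := hc.exists_bound_of_continuousOn cξ
    obtain ⟨R4, h4⟩ := exists_ae_norm_le_of_memLp_top hg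
    refine ⟨|R1| + |R2| + |R3| + |R4|, by positivity, fun z hz => (h1 z hz).trans ?_,
      fun z hz => (h2 z hz).trans ?_, fun z hz => (h3 z hz).trans ?_, h4.mono fun z hz =>
      hz.trans ?_⟩ <;>
    linarith [le_abs_self R1, le_abs_self R2, le_abs_self R3, le_abs_self R4, abs_nonneg R1,
      abs_nonneg R2, abs_nonneg R3, abs_nonneg R4]
  set v : ℝ × E N → ℝ := fun z => W z - u z with hv
  have cv : ContinuousOn v (Icc 0 S ×ˢ closure Ω) := cW.sub hu
  set V : ℝ × E N → ℝ := fun z => max (v z) 0 with hV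
  have cV : ContinuousOn V (Icc 0 S ×ˢ closure Ω) := cv.sup continuousOn_const
  have uQ : ∀ z ∈ cyl Ω S, 0 ≤ u z := fun z hz =>
    hu0 z ⟨⟨hz.1.1.le, hz.1.2⟩, subset_closure hz.2⟩
  have vR : ∀ z ∈ cyl Ω S, v z ≤ R := fun z hz => by
    have h1 := (le_abs_self _).trans (bW z (cyl_subset Ω S hz))
    have h2 := uQ z hz
    simp only [hv]
    linarith
  set us : ℝ × E N → ℝ := fun z => |u z| ^ P.s with hus
  have cus : ContinuousOn us (Icc 0 S ×ˢ closure Ω) :=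
    hu.abs.rpow_const fun z _ => Or.inr (by linarith)
  set Ws : ℝ × E N → ℝ := fun z => max (W z) 0 ^ P.s with hWs
  have cWs : ContinuousOn Ws (Icc 0 S ×ˢ closure Ω) :=
    (cW.sup continuousOn_const).rpow_const fun z _ => Or.inr (by linarith)
  set J : ℝ := R ^ P.s * (volume.restrict Ω).real univ with hJdef
  have hJ : 0 ≤ J := by positivity
  obtain ⟨C, hC, hsource⟩ := P.exists_source_diff_le hα hβ hγ hν hl hσ hk hs hm hp hq hr hR hJ N
  set I : ℝ → ℝ := fun t => ∫ y in Ω, V (t, y) with hI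
  set Ju : ℝ → ℝ := fun t => ∫ y in Ω, us (t, y) with hJu
  set B : ℝ := (volume.restrict Ω).real univ with hB
  have hB0 : 0 ≤ B := measureReal_nonneg
  set lam : ℝ := 3 * (C * (1 + 2 * B) + 1) with hlam
  set e : ℝ × E N → ℝ := fun z => Real.exp (-lam * z.1) with he
  have ce : ContinuousOn e (Icc 0 S ×ˢ closure Ω) := by fun_prop
  have e0 : ∀ z, 0 < e z := fun z => Real.exp_pos _
  set φ : ℝ × E N → ℝ := fun z => e z * truncSq R (v z) with hφ
  set h : ℝ × E N → E N := fun z => e z • (truncSqDeriv R (v z) • (ξ z - g z)) with hh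
  have cφ : ContinuousOn φ (Icc 0 S ×ˢ closure Ω) :=
    ce.mul ((continuous_truncSq R).comp_continuousOn cv)
  -- on the cylinder `v ≤ R`, so that the truncation is not active there
  have φQ : ∀ z ∈ cyl Ω S, φ z = e z * V z ^ 2 := fun z hz => by
    simp only [hφ, hV, truncSq_of_le (vR z hz)]
  have hQh : ∀ z ∈ cyl Ω S, h z = e z • ((2 * V z) • (ξ z - g z)) := fun z hz => by
    simp only [hh, hV, truncSqDeriv_of_le (vR z hz)]
  -- everything but the weak time derivative is bounded
  have bd : ∀ {F : Type} [NormedAddCommGroup F] {f : ℝ × E N → F},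
      ContinuousOn f (Icc 0 S ×ˢ closure Ω) → MemLp f ⊤ μ := fun hf =>
    memLp_top_of_continuousOn hΩo hΩ hf
  have mφ : MemLp φ ⊤ μ := bd cφ
  have mξg : MemLp (fun z => ξ z - g z) ⊤ μ := (bd cξ).sub hg
  have mh : MemLp h ⊤ μ :=
    memLp_top_smul (bd ce) (memLp_top_smul
      (bd ((continuous_truncSqDeriv R).comp_continuousOn cv)) mξg)
  have p1 : (1 : ℝ≥0∞) ≤ ENNReal.ofReal P.p := by
    rw [← ENNReal.ofReal_one]
    exact ENNReal.ofReal_le_ofReal (by linarith)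
  have slices : ∀ᵐ t ∂(volume.restrict (Ioo 0 S)),
      MemW0 Ω (ENNReal.ofReal P.p) (fun x => φ (t, x)) (fun x => h (t, x)) := by
    have bg' := bg
    rw [hμ, restrict_cyl] at bg'
    filter_upwards [hW0, Measure.ae_ae_of_ae_prod bg', ae_restrict_mem measurableSet_Ioo]
      with t htW htg ht
    have htI : t ∈ Icc 0 S := Ioo_subset_Icc_self ht
    have := MemW0.truncSq_sub (W := fun x => W (t, x)) (K := R) (M := 2 * R)
      (S := Metric.closedBall x₀ R₀) hΩ.measure_lt_top
      (ENNReal.ofReal_le_ofReal P.le_top) p1 htW (contDiff_paraboloid (a t) (b t) x₀)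
      (isCompact_closedBall _ _) hball (fun x hx => ?_) hR ?_ ?_
    · have := this.const_mul (Real.exp (-lam * t))
      simpa only [hφ, hh, he, hv, hξdef, hWdef, barrier, gradient_paraboloid] using this
    · rw [Metric.mem_closedBall, dist_eq_norm, not_le] at hx
      have h1 : R₀ ^ 2 ≤ ‖x - x₀‖ ^ 2 := pow_le_pow_left₀ hR₀ hx.le 2
      have h2 := mul_le_mul_of_nonneg_left h1 (hbpos t htI).le
      have h3 := hab t htI
      simp only [hWdef, barrier]
      linarith
    · filter_upwards [ae_restrict_mem hΩo.measurableSet] with x hx using vR (t, x) ⟨ht, hx⟩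
    · filter_upwards [ae_restrict_mem hΩo.measurableSet, htg] with x hx hgx
      simp only [hWdef, barrier, gradient_paraboloid]
      have := bξ (t, x) ⟨htI, subset_closure hx⟩
      refine (norm_sub_le _ _).trans ?_
      simp only [hξdef] at this
      linarith
  have topmono : ∀ {F : Type} [NormedAddCommGroup F] {f : ℝ × E N → F} {r : ℝ≥0∞},
      MemLp f ⊤ μ → MemLp f r μ := fun hf => hf.mono_exponent le_top
  have E1 := hweak φ h cφ (fun z _ => mul_nonneg (e0 z).le (truncSq_nonneg hR _))
    ⟨topmono mφ, topmono mh, slices⟩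
  -- the weak formulation of the equation for the barrier
  have mA4 : MemLp (fun z => ‖ξ z‖ ^ (P.p - 2) * inner ℝ (ξ z) (h z)) ⊤ μ :=
    memLp_top_mul (memLp_top_norm_rpow (bd cξ) (by linarith)) (memLp_top_inner (bd cξ) mh)
  have mA5 : MemLp (fun z => D z * φ z) ⊤ μ := memLp_top_mul (bd cD) mφ
  have E2 : ∫ z, ‖ξ z‖ ^ (P.p - 2) * inner ℝ (ξ z) (h z) ∂μ = ∫ z, D z * φ z ∂μ := by
    have i4 := mA4.integrable le_top
    have i5 := mA5.integrable le_top
    rw [hμ, restrict_cyl] at i4 i5 ⊢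
    rw [integral_prod _ i4, integral_prod _ i5]
    refine integral_congr_ae ?_
    filter_upwards [slices, ae_restrict_mem measurableSet_Ioo] with t htW ht
    have flux := integral_paraboloid_flux hΩ hΩo.measurableSet hp p1 htW x₀
      (hbpos t (Ioo_subset_Icc_self ht))
    simp only [hξdef, hDdef]
    exact flux
  have mV2 : MemLp (fun z => V z ^ 2) ⊤ μ := bd (cV.pow 2)
  have mV3 : MemLp (fun z => V z ^ 3) ⊤ μ := bd (cV.pow 3)
  have wI : Integrable w μ := hw.1.integrable one_le_two
  have mul_w : ∀ {f : ℝ × E N → ℝ}, MemLp f ⊤ μ → Integrable (fun z => w z * f z) μ :=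
    fun {f} hf => by
      obtain ⟨c, hc⟩ := exists_ae_norm_le_of_memLp_top hf
      have := wI.bdd_mul hf.1 hc
      simpa only [mul_comm] using this
  have iA1 : Integrable (fun z => w z * φ z) μ := mul_w mφ
  have mA2 : MemLp (fun z => ‖g z‖ ^ (P.p - 2) * inner ℝ (g z) (h z)) ⊤ μ :=
    memLp_top_mul (memLp_top_norm_rpow hg (by linarith)) (memLp_top_inner hg mh)
  have mA6 : MemLp (fun z => Wt z * φ z) ⊤ μ := memLp_top_mul (bd cWt) mφ
  have mY : MemLp (fun z => e z * V z ^ 3) ⊤ μ := memLp_top_mul (bd ce) mV3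
  have mI : MemLp (fun z : ℝ × E N => I z.1) ⊤ μ := memLp_top_integral_of_continuousOn hΩo hΩ cV
  have mJu : MemLp (fun z : ℝ × E N => Ju z.1) ⊤ μ :=
    memLp_top_integral_of_continuousOn hΩo hΩ cus
  have mZ : MemLp (fun z => e z * (V z ^ 2 * I z.1)) ⊤ μ :=
    memLp_top_mul (bd ce) (memLp_top_mul mV2 mI)
  -- the source evaluated at the solution
  set f : ℝ × E N → ℝ := fun z => P.source (u z) ‖g z‖ (Ju z.1) with hf
  have rhs_eq : ∀ z ∈ cyl Ω S, rhs P Ω u g z = f z := fun z hz => by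
    have h1 := uQ z hz
    simp only [hf, rhs, Params.source, hJu, hus]
    rw [abs_rpow_sub_one_mul h1 (by linarith), abs_rpow_sub_one_mul h1 hl,
      abs_rpow_sub_one_mul h1 hσ]
  have mf : MemLp f ⊤ μ := by
    have hpow : ∀ {c : ℝ}, 0 ≤ c → MemLp (fun z => u z ^ c) ⊤ μ := fun {c} hc =>
      bd (hu.rpow_const fun z _ => Or.inr hc)
    have hgp : ∀ {c : ℝ}, 0 ≤ c → MemLp (fun z => ‖g z‖ ^ c) ⊤ μ := fun {c} hc =>
      memLp_top_norm_rpow hg hc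
    exact ((((memLp_top_mul ((hpow (by linarith)).const_mul _) mJu).sub
      (memLp_top_mul ((hpow hl.le).const_mul _) (hgp (by linarith)))).add
      ((hpow (by linarith)).const_mul _)).add ((hgp (by linarith)).const_mul _)).sub
      ((hpow hσ.le).const_mul _)
  have mA3 : MemLp (fun z => f z * φ z) ⊤ μ := memLp_top_mul mf mφ
  have i2 := mA2.integrable le_top
  have i3 := mA3.integrable le_top
  have i4 := mA4.integrable le_top
  have i5 := mA5.integrable le_top
  have i6 := mA6.integrable le_top
  have iY := mY.integrable le_top
  have iZ := mZ.integrable le_top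
  have E1' : ∫ z, w z * φ z ∂μ + ∫ z, ‖g z‖ ^ (P.p - 2) * inner ℝ (g z) (h z) ∂μ
      = ∫ z, f z * φ z ∂μ := by
    rw [← integral_add iA1 i2, E1]
    refine setIntegral_congr_fun hQ fun z hz => ?_
    simp only [rhs_eq z hz]
  -- the time derivative
  have E3 : 0 ≤ 3 * (∫ z, Wt z * φ z ∂μ - ∫ z, w z * φ z ∂μ) - lam * ∫ z, e z * V z ^ 3 ∂μ := by
    have eq : ∀ z ∈ cyl Ω S, Real.exp (-lam * z.1) *
        (3 * max (W z - u z) 0 ^ 2 * (Wt z - w z) - lam * max (W z - u z) 0 ^ 3)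
        = 3 * (Wt z * φ z - w z * φ z) - lam * (e z * V z ^ 3) := fun z hz => by
      rw [φQ z hz]
      simp only [he, hV, hv]
      ring
    have k1 : Integrable (fun z => Wt z * φ z - w z * φ z) μ := i6.sub iA1
    have iall : Integrable (fun z => 3 * (Wt z * φ z - w z * φ z) - lam * (e z * V z ^ 3)) μ :=
      (k1.const_mul 3).sub (iY.const_mul lam)
    have := hw.integral_energy_nonneg hΩo hΩ hS hu (W := W) (Wt := Wt) (lam := lam)
      (fun x _ t ht => (ha t ht).sub ((hb t ht).mul_const (‖x - x₀‖ ^ 2))) cWt h0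
      (iall.congr (by
        filter_upwards [ae_restrict_mem hQ] with z hz using (eq z hz).symm))
    rw [setIntegral_congr_fun hQ eq, integral_sub (k1.const_mul 3) (iY.const_mul lam),
      integral_const_mul, integral_const_mul, integral_sub i6 iA1] at this
    exact this
  -- the pointwise energy inequality
  have E4 : ∫ z, Wt z * φ z ∂μ + ∫ z, D z * φ z ∂μ - ∫ z, f z * φ z ∂μ
      - ∫ z, ‖ξ z‖ ^ (P.p - 2) * inner ℝ (ξ z) (h z) ∂μ
      + ∫ z, ‖g z‖ ^ (P.p - 2) * inner ℝ (g z) (h z) ∂μ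
      ≤ C * (∫ z, e z * V z ^ 3 ∂μ + ∫ z, e z * (V z ^ 2 * I z.1) ∂μ) := by
    have k1 : Integrable (fun z => Wt z * φ z + D z * φ z) μ := i6.add i5
    have k2 : Integrable (fun z => Wt z * φ z + D z * φ z - f z * φ z) μ := k1.sub i3
    have k3 : Integrable (fun z => Wt z * φ z + D z * φ z - f z * φ z
      - ‖ξ z‖ ^ (P.p - 2) * inner ℝ (ξ z) (h z)) μ := k2.sub i4
    rw [← integral_add i6 i5, ← integral_sub k1 i3, ← integral_sub k2 i4,
      ← integral_add k3 i2, ← integral_add iY iZ, ← integral_const_mul]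
    refine integral_mono_ae (k3.add i2) ((iY.add iZ).const_mul C) ?_
    filter_upwards [ae_restrict_mem hQ, bg] with z hz hgz
    rw [φQ z hz, hQh z hz]
    have hzc := cyl_subset Ω S hz
    have hIz : 0 ≤ I z.1 := integral_nonneg fun y => le_max_right _ _
    rcases le_or_gt (v z) 0 with hvz | hvz
    · have hV0 : V z = 0 := max_eq_right hvz
      simp [hV0]
    · have hVz : V z = W z - u z := max_eq_left hvz.le
      have huW : u z < W z := sub_pos.1 hvz
      have hzI : z.1 ∈ Icc 0 S := Ioo_subset_Icc_self hz.1
      have hnξ : ‖ξ z‖ = 2 * b z.1 * ‖z.2 - x₀‖ := by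
        have := hbpos z.1 hzI
        simp only [hξdef, norm_smul, norm_neg]
        rw [Real.norm_of_nonneg (by positivity)]
      have hJu0 : 0 ≤ Ju z.1 := integral_nonneg fun y => by positivity
      have hJuJ : Ju z.1 ≤ J := by
        have := norm_integral_le_of_norm_le_const (μ := volume.restrict Ω) (C := R ^ P.s)
          (f := fun y => us (z.1, y)) (by
            filter_upwards [ae_restrict_mem hΩo.measurableSet] with y hy
            rw [Real.norm_of_nonneg (by positivity)]
            exact Real.rpow_le_rpow (abs_nonneg _) (bu (z.1, y) ⟨hzI, subset_closure hy⟩)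
              (by linarith))
        exact (le_abs_self _).trans this
      have hJd : (∫ y in Ω, Ws (z.1, y)) - Ju z.1 ≤ P.s * R ^ (P.s - 1) * I z.1 := by
        have j1 := (memLp_top_slice_of_continuousOn hΩo hΩ cWs hzI).integrable le_top
        have j2 := (memLp_top_slice_of_continuousOn hΩo hΩ cus hzI).integrable le_top
        have j3 := (memLp_top_slice_of_continuousOn hΩo hΩ cV hzI).integrable le_top
        simp only [hJu, hI]
        rw [← integral_sub j1 j2, ← integral_const_mul]
        refine integral_mono_ae (j1.sub j2) (j3.const_mul _) ?_
        filter_upwards [ae_restrict_mem hΩo.measurableSet] with y hy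
        have hy0 := uQ (z.1, y) ⟨hz.1, hy⟩
        have hyR := (le_abs_self _).trans (bW (z.1, y) ⟨hzI, subset_closure hy⟩)
        simp only [hWs, hus, abs_of_nonneg hy0]
        have hc : 0 ≤ P.s * R ^ (P.s - 1) := by positivity
        have hVy : 0 ≤ V (z.1, y) := le_max_right _ _
        rcases le_total (max (W (z.1, y)) 0) (u (z.1, y)) with hc' | hc'
        · have := Real.rpow_le_rpow (le_max_right _ _) hc' (by linarith : 0 ≤ P.s)
          have := mul_nonneg hc hVy
          linarith
        · have h1 := rpow_sub_rpow_le hs hy0 hc' (max_le hyR hR)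
          refine h1.trans ?_
          gcongr
          simp only [hV, hv]
          rcases le_total (W (z.1, y)) 0 with hW' | hW'
          · rw [max_eq_right hW'] at hc' ⊢
            exact (by linarith : 0 - u (z.1, y) ≤ 0).trans (le_max_right _ _)
          · rw [max_eq_left hW']
            exact le_max_left _ _
      have main := hsource (W z) (u z) (∫ y in Ω, Ws (z.1, y)) (Ju z.1) (I z.1) (Wt z + D z)
        (ξ z) (g z) (uQ z hz) huW ((le_abs_self _).trans (bW z hzc)) (bξ z hzc) hgz hJu0 hJuJ hIz
        hJd (by
          rw [hnξ]
          exact hsub z.1 hz.1 z.2 hz.2 ((uQ z hz).trans_lt huW))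
      have main' := mul_le_mul_of_nonneg_left main (e0 z).le
      rw [hVz]
      simp only [inner_smul_right]
      simp only [hf] at main' ⊢
      refine le_trans (le_of_eq ?_) (main'.trans (le_of_eq ?_)) <;> ring
  have E5 : ∫ z, e z * (V z ^ 2 * I z.1) ∂μ ≤ 2 * B * ∫ z, e z * V z ^ 3 ∂μ := by
    have iZ' := iZ
    have iY' := iY
    rw [hμ, restrict_cyl] at iZ' iY' ⊢
    rw [integral_prod _ iZ', integral_prod _ iY', ← integral_const_mul]
    refine integral_mono_ae iZ'.integral_prod_left (iY'.integral_prod_left.const_mul _) ?_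
    filter_upwards [ae_restrict_mem measurableSet_Ioo] with t ht
    have hsl := memLp_top_slice_of_continuousOn hΩo hΩ cV (Ioo_subset_Icc_self ht)
    have := integral_sq_mul_integral_le (ae_of_all _ fun x => le_max_right _ _) hsl
    simp only [he]
    rw [integral_const_mul, integral_const_mul, integral_mul_const]
    have h2 := mul_le_mul_of_nonneg_left this (Real.exp_pos (-lam * t)).le
    refine h2.trans (le_of_eq ?_)
    ring
  -- for the chosen `λ` the energy vanishes
  have hY0 : 0 ≤ ∫ z, e z * V z ^ 3 ∂μ :=
    integral_nonneg fun z => mul_nonneg (e0 z).le (pow_nonneg (le_max_right _ _) 3)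
  have hY : ∫ z, e z * V z ^ 3 ∂μ ≤ 0 := by
    have h1 := mul_le_mul_of_nonneg_left E5 hC
    have h2 : lam * ∫ z, e z * V z ^ 3 ∂μ
        = 3 * (C * (1 + 2 * B) * ∫ z, e z * V z ^ 3 ∂μ) + 3 * ∫ z, e z * V z ^ 3 ∂μ := by
      rw [hlam]; ring
    nlinarith
  have hzero := (integral_eq_zero_iff_of_nonneg
    (fun z => mul_nonneg (e0 z).le (pow_nonneg (le_max_right _ _) 3)) iY).1 (le_antisymm hY hY0)
  have hV0 : V =ᵐ[μ] fun _ => 0 := by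
    filter_upwards [hzero] with z hz
    have h1 : e z * V z ^ 3 = 0 := hz
    rcases mul_eq_zero.1 h1 with h2 | h2
    · exact absurd h2 (e0 z).ne'
    · exact pow_eq_zero_iff (by norm_num) |>.1 h2
  have hVeq := Measure.eqOn_open_of_ae_eq hV0 (isOpen_Ioo.prod hΩo)
    (cV.mono (cyl_subset Ω S)) continuousOn_const
  intro z hz
  have h1 : max (v z) 0 = 0 := hVeq hz
  have h2 : v z ≤ 0 := h1 ▸ le_max_left (v z) 0
  exact sub_nonpos.1 h2

/-! ### The self-similar barrier -/

lemma eventually_const_mul_rpow_le (A : ℝ) {B c d : ℝ} (hB : 0 < B) (hcd : d < c) :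
    ∀ᶠ τ in 𝓝[>] (0 : ℝ), A * τ ^ c ≤ B * τ ^ d := by
  have h1 : Tendsto (fun τ : ℝ => A * τ ^ (c - d)) (𝓝[>] 0) (𝓝 0) := by
    have h2 : Tendsto (fun τ : ℝ => τ ^ (c - d)) (𝓝 0) (𝓝 0) := by
      have := (Real.continuousAt_rpow_const 0 (c - d) (Or.inr (by linarith))).tendsto
      rwa [Real.zero_rpow (by linarith)] at this
    simpa using (h2.mono_left nhdsWithin_le_nhds).const_mul A
  filter_upwards [h1.eventually_lt_const hB, self_mem_nhdsWithin] with τ hτ hpos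
  have hpos' : (0 : ℝ) < τ := hpos
  rw [show c = (c - d) + d by ring, Real.rpow_add hpos', ← mul_assoc]
  gcongr

/-- The exponents of the barrier `τ^(-κ) (1 - |x - x₀|² τ^(-2θ))`, with `τ` the time left before
blow-up: each unfavourable term is of lower order than `τ^(-κ-1)`, and one of the two reaction
terms is of higher order. -/
lemma Params.exists_similarity_exponents (P : Params) (N : ℕ) (hk : 1 ≤ P.k) (hs : 1 ≤ P.s)
    (hm : max (P.p - 1) (max P.r P.σ) < P.m)
    (hks : max (P.p - 1) (max (P.q + P.l) P.r) < P.k + P.s) :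
    ∃ κ θ : ℝ, 0 < κ ∧ 0 < θ ∧ κ * (P.p - 1) + θ * P.p < κ + 1 ∧
      κ * P.l + (κ + θ) * P.q < κ + 1 ∧ (κ + θ) * P.r < κ + 1 ∧ κ * P.σ < κ + 1 ∧
      (κ + 1 < κ * P.m ∨ κ + 1 < κ * (P.k + P.s) - θ * N) := by
  set M := max P.m (P.k + P.s) with hM
  obtain ⟨D, hD1, hDp, hDr, hDσ, hDq, hDM⟩ : ∃ D, 1 ≤ D ∧ P.p - 1 ≤ D ∧ P.r ≤ D ∧ P.σ ≤ D ∧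
      P.q + P.l ≤ D ∧ D < M := by
    simp only [max_lt_iff] at hm hks
    have h1 := le_max_left P.m (P.k + P.s)
    have h2 := le_max_right P.m (P.k + P.s)
    refine ⟨max 1 (max (P.p - 1) (max P.r (max P.σ (P.q + P.l)))), by simp, by simp, by simp,
      by simp, by simp, ?_⟩
    simp only [max_lt_iff]
    refine ⟨?_, ?_, ?_, ?_, ?_⟩ <;> linarith [hm.1, hm.2.1, hm.2.2, hks.2.1]
  -- `κ` is such that `1 + 1 / κ` lies strictly between the unfavourable and the favourable powers
  set e := (D + M) / 2 with he
  have heD : D < e := by rw [he]; linarith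
  have heM : e < M := by rw [he]; linarith
  set κ := 1 / (e - 1) with hκ
  have hκ0 : 0 < κ := by
    have : 0 < e - 1 := by linarith
    positivity
  have hκe : κ + 1 = κ * e := by
    have : e - 1 ≠ 0 := by linarith
    rw [hκ]
    field_simp
    ring
  have lt_of : ∀ c, c ≤ D → κ * c < κ + 1 := fun c hc => by
    rw [hκe]
    exact mul_lt_mul_of_pos_left (hc.trans_lt heD) hκ0
  have hlim : ∀ c d : ℝ, c < κ + 1 → ∀ᶠ θ in 𝓝[>] (0 : ℝ), c + θ * d < κ + 1 := fun c d hc => by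
    have : Tendsto (fun θ : ℝ => c + θ * d) (𝓝 0) (𝓝 (c + 0 * d)) :=
      (continuous_const.add (continuous_id.mul continuous_const)).tendsto 0
    rw [zero_mul, add_zero] at this
    exact (this.mono_left nhdsWithin_le_nhds).eventually_lt_const hc
  have fav : ∀ᶠ θ in 𝓝[>] (0 : ℝ), κ + 1 < κ * P.m ∨ κ + 1 < κ * (P.k + P.s) - θ * N := by
    rcases max_choice P.m (P.k + P.s) with h | h
    · refine Eventually.of_forall fun θ => Or.inl ?_
      rw [hκe, ← h]
      exact mul_lt_mul_of_pos_left heM hκ0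
    · have h1 : κ + 1 < κ * (P.k + P.s) := by
        rw [hκe, ← h]
        exact mul_lt_mul_of_pos_left heM hκ0
      have h2 : Tendsto (fun θ : ℝ => κ * (P.k + P.s) - θ * N) (𝓝 0)
          (𝓝 (κ * (P.k + P.s) - 0 * N)) :=
        (continuous_const.sub (continuous_id.mul continuous_const)).tendsto 0
      rw [zero_mul, sub_zero] at h2
      filter_upwards [(h2.mono_left nhdsWithin_le_nhds).eventually_const_lt h1] with θ hθ
      exact Or.inr hθ
  obtain ⟨θ, h1, h2, h3, h4, hθ⟩ := ((hlim _ P.p (lt_of _ hDp)).and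
    ((hlim _ P.q (lt_of _ hDq)).and ((hlim _ P.r (lt_of _ hDr)).and
      (fav.and self_mem_nhdsWithin)))).exists
  exact ⟨κ, θ, hκ0, hθ, h1, by linarith, by linarith, lt_of _ hDσ, h4⟩

/-- The nonlocal integral of the barrier is at least that over the ball of half its radius. -/
lemma le_integral_paraboloid {N : ℕ} {Ω : Set (E N)} (hΩo : IsOpen Ω)
    (hΩ : Bornology.IsBounded Ω) {x₀ : E N} {s κ θ τ : ℝ} (hs : 1 ≤ s) (hτ : 0 < τ)
    (hball : Metric.ball x₀ (τ ^ θ / 2) ⊆ Ω) :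
    (3 / 4) ^ s * ((1 / 2) ^ N * (volume (Metric.ball (0 : E N) 1)).toReal)
        * τ ^ (-(κ * s) + θ * N)
      ≤ ∫ y in Ω, max (τ ^ (-κ) - τ ^ (-(κ + 2 * θ)) * ‖y - x₀‖ ^ 2) 0 ^ s := by
  have fin1 : IsFiniteMeasure (volume.restrict Ω) := ⟨by simpa using hΩ.measure_lt_top⟩
  have hs0 : 0 ≤ s := by linarith
  have hc : Continuous fun y : E N =>
      max (τ ^ (-κ) - τ ^ (-(κ + 2 * θ)) * ‖y - x₀‖ ^ 2) 0 ^ s := by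
    refine Continuous.rpow_const (by fun_prop) fun _ => Or.inr hs0
  obtain ⟨C, hC⟩ := hΩ.isCompact_closure.exists_bound_of_continuousOn hc.continuousOn
  have hI : IntegrableOn (fun y : E N =>
      max (τ ^ (-κ) - τ ^ (-(κ + 2 * θ)) * ‖y - x₀‖ ^ 2) 0 ^ s) Ω := by
    refine Integrable.of_bound (C := C) hc.aestronglyMeasurable ?_
    filter_upwards [ae_restrict_mem hΩo.measurableSet] with y hy using hC y (subset_closure hy)
  have hr : 0 < τ ^ θ / 2 := by positivity
  have hvol : (volume.real (Metric.ball x₀ (τ ^ θ / 2)))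
      = (τ ^ θ / 2) ^ N * (volume (Metric.ball (0 : E N) 1)).toReal := by
    rw [Measure.real, Measure.addHaar_ball_of_pos volume x₀ hr, ENNReal.toReal_mul,
      ENNReal.toReal_ofReal (by positivity)]
    simp
  have h1 : (3 / 4 * τ ^ (-κ)) ^ s * volume.real (Metric.ball x₀ (τ ^ θ / 2))
      ≤ ∫ y in Metric.ball x₀ (τ ^ θ / 2),
        max (τ ^ (-κ) - τ ^ (-(κ + 2 * θ)) * ‖y - x₀‖ ^ 2) 0 ^ s := by
    refine setIntegral_ge_of_const_le_real measurableSet_ball measure_ball_lt_top.ne (fun y hy => ?_)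
      (hI.mono_set hball)
    refine Real.rpow_le_rpow (by positivity) ?_ hs0
    refine le_trans ?_ (le_max_left _ _)
    rw [Metric.mem_ball, dist_eq_norm] at hy
    have h2 : ‖y - x₀‖ ^ 2 ≤ (τ ^ θ / 2) ^ 2 := pow_le_pow_left₀ (norm_nonneg _) hy.le 2
    have h3 : τ ^ (-(κ + 2 * θ)) * (τ ^ θ / 2) ^ 2 = τ ^ (-κ) / 4 := by
      have : τ ^ (-κ) = τ ^ (-(κ + 2 * θ)) * (τ ^ θ * τ ^ θ) := by
        rw [← Real.rpow_add hτ, ← Real.rpow_add hτ]; congr 1; ring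
      rw [this]; ring
    have h4 : 0 ≤ τ ^ (-(κ + 2 * θ)) := by positivity
    nlinarith [mul_le_mul_of_nonneg_left h2 h4]
  have h5 : (3 / 4) ^ s * ((1 / 2) ^ N * (volume (Metric.ball (0 : E N) 1)).toReal)
        * τ ^ (-(κ * s) + θ * N)
      = (3 / 4 * τ ^ (-κ)) ^ s * volume.real (Metric.ball x₀ (τ ^ θ / 2)) := by
    rw [hvol, Real.mul_rpow (by norm_num) (by positivity), ← Real.rpow_mul hτ.le, div_pow (τ ^ θ),
      ← Real.rpow_natCast (τ ^ θ) N, ← Real.rpow_mul hτ.le, Real.rpow_add hτ]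
    rw [show -κ * s = -(κ * s) by ring, one_div, inv_pow]
    ring
  rw [h5]
  refine h1.trans (setIntegral_mono_set hI (ae_of_all _ fun y => by positivity) ?_)
  exact hball.eventuallyLE

/-- The self-similar paraboloid is a subsolution where it is positive, for all small times `τ` left
before blow-up. Near the edge of its positivity set it decreases in time, because the set shrinks,
and this outweighs diffusion, damping and the gradient terms; away from the edge the dominant
reaction term does. -/
lemma exists_self_similar_subsolution {N : ℕ} {Ω : Set (E N)} (hΩo : IsOpen Ω)
    (hΩ : Bornology.IsBounded Ω) {P : Params} (hα : 0 < P.α) (hβ : 0 ≤ P.β) (hγ : 0 < P.γ)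
    (hν : 0 ≤ P.ν) (hl : 0 < P.l) (hσ : 0 < P.σ) (hk : 1 ≤ P.k) (hs : 1 ≤ P.s) (hm1 : 1 ≤ P.m)
    (hp : 2 ≤ P.p) (hq : 0 ≤ P.q) (hr : 0 ≤ P.r)
    (hm : max (P.p - 1) (max P.r P.σ) < P.m)
    (hks : max (P.p - 1) (max (P.q + P.l) P.r) < P.k + P.s)
    {x₀ : E N} {ρ : ℝ} (hρ : 0 < ρ) (hball : Metric.ball x₀ ρ ⊆ Ω) :
    ∃ κ θ τ₀ : ℝ, 0 < κ ∧ 0 < θ ∧ 0 < τ₀ ∧ τ₀ ≤ 1 ∧ τ₀ ^ θ < ρ ∧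
      ∀ τ ∈ Ioc 0 τ₀, ∀ x : E N, 0 < τ ^ (-κ) - τ ^ (-(κ + 2 * θ)) * ‖x - x₀‖ ^ 2 →
        κ * τ ^ (-κ - 1) - (κ + 2 * θ) * τ ^ (-(κ + 2 * θ) - 1) * ‖x - x₀‖ ^ 2
            + paraboloidPLaplace N P.p (τ ^ (-(κ + 2 * θ))) ‖x - x₀‖
          ≤ P.source (τ ^ (-κ) - τ ^ (-(κ + 2 * θ)) * ‖x - x₀‖ ^ 2)
              (2 * τ ^ (-(κ + 2 * θ)) * ‖x - x₀‖)
              (∫ y in Ω, max (τ ^ (-κ) - τ ^ (-(κ + 2 * θ)) * ‖y - x₀‖ ^ 2) 0 ^ P.s) := by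
  obtain ⟨κ, θ, hκ, hθ, c1, c2, c3, c4, c5⟩ := P.exists_similarity_exponents N hk hs hm hks
  set Λ := (3 / 4 : ℝ) ^ P.s * ((1 / 2) ^ N * (volume (Metric.ball (0 : E N) 1)).toReal) with hΛ
  have hΛ0 : 0 < Λ := by
    have : 0 < (volume (Metric.ball (0 : E N) 1)).toReal :=
      ENNReal.toReal_pos (Metric.measure_ball_pos volume _ one_pos).ne' measure_ball_lt_top.ne
    positivity
  -- below this height of the profile, `∂ₜ` of the barrier is at most `-θ τ^(-κ-1)`
  set V₀ := θ / (κ + 2 * θ) with hV₀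
  have hV₀0 : 0 < V₀ := by positivity
  have hθ4 : 0 < θ / 4 := by positivity
  have ev1 := eventually_const_mul_rpow_le (2 ^ (P.p - 1) * (N + (P.p - 2))) hθ4
    (c := -(κ * (P.p - 1) + θ * P.p)) (d := -κ - 1) (by linarith)
  have ev2 := eventually_const_mul_rpow_le (P.β * 2 ^ P.q) hθ4
    (c := -(κ * P.l + (κ + θ) * P.q)) (d := -κ - 1) (by linarith)
  have ev3 := eventually_const_mul_rpow_le (|P.μ| * 2 ^ P.r) hθ4
    (c := -((κ + θ) * P.r)) (d := -κ - 1) (by linarith)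
  have ev4 := eventually_const_mul_rpow_le P.ν hθ4
    (c := -(κ * P.σ)) (d := -κ - 1) (by linarith)
  have ev5 : ∀ᶠ τ in 𝓝[>] (0 : ℝ), (κ + θ) * τ ^ (-κ - 1) ≤ P.γ * V₀ ^ P.m * τ ^ (-(κ * P.m)) ∨
      (κ + θ) * τ ^ (-κ - 1) ≤ P.α * V₀ ^ P.k * Λ * τ ^ (-(κ * (P.k + P.s) - θ * N)) := by
    rcases c5 with c5 | c5
    · exact (eventually_const_mul_rpow_le (κ + θ) (by positivity) (by linarith)).mono
        fun _ => Or.inl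
    · exact (eventually_const_mul_rpow_le (κ + θ) (by positivity) (by linarith)).mono
        fun _ => Or.inr
  have ev6 : ∀ᶠ τ in 𝓝[>] (0 : ℝ), τ ^ θ < ρ := by
    have h2 : Tendsto (fun τ : ℝ => τ ^ θ) (𝓝 0) (𝓝 0) := by
      have := (Real.continuousAt_rpow_const 0 θ (Or.inr hθ.le)).tendsto
      rwa [Real.zero_rpow hθ.ne'] at this
    exact (h2.mono_left nhdsWithin_le_nhds).eventually_lt_const hρ
  have ev7 : ∀ᶠ τ in 𝓝[>] (0 : ℝ), τ ≤ 1 := by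
    filter_upwards [Ioc_mem_nhdsGT (zero_lt_one' ℝ)] with τ hτ using hτ.2
  obtain ⟨τ₀, hτ₀, hall⟩ := mem_nhdsGT_iff_exists_Ioc_subset.1
    (ev1.and (ev2.and (ev3.and (ev4.and (ev5.and (ev6.and ev7))))))
  have hτ₀' : (0 : ℝ) < τ₀ := hτ₀
  obtain ⟨-, -, -, -, -, h6, h7⟩ := hall ⟨hτ₀', le_rfl⟩
  refine ⟨κ, θ, τ₀, hκ, hθ, hτ₀', h7, h6, fun τ hτ x hx => ?_⟩
  obtain ⟨e1, e2, e3, e4, e5, e6, -⟩ := hall hτ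
  have hτ0 : 0 < τ := hτ.1
  -- `y` is the self-similar distance to the centre, `V` the height of the profile
  set y := ‖x - x₀‖ * τ ^ (-θ) with hy
  have hy0 : 0 ≤ y := by positivity
  have hxy : ‖x - x₀‖ = y * τ ^ θ := by
    rw [hy, mul_assoc, ← Real.rpow_add hτ0, neg_add_cancel, Real.rpow_zero, mul_one]
  set V := 1 - y ^ 2 with hV
  have sq1 : ∀ c : ℝ, τ ^ (-(κ + 2 * θ) + c) * ‖x - x₀‖ ^ 2 = τ ^ (-κ + c) * y ^ 2 := fun c => by
    have : τ ^ (-κ + c) = τ ^ (-(κ + 2 * θ) + c) * (τ ^ θ * τ ^ θ) := by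
      rw [← Real.rpow_add hτ0, ← Real.rpow_add hτ0]; congr 1; ring
    rw [this, hxy]; ring
  have hWV : τ ^ (-κ) - τ ^ (-(κ + 2 * θ)) * ‖x - x₀‖ ^ 2 = τ ^ (-κ) * V := by
    have := sq1 0
    rw [add_zero, add_zero] at this
    rw [this, hV]; ring
  have hτκ : 0 < τ ^ (-κ) := by positivity
  have hV0 : 0 < V := by
    rw [hWV] at hx
    exact pos_of_mul_pos_right hx hτκ.le
  have hy1 : y ≤ 1 := by
    have : y ^ 2 ≤ 1 := by linarith
    exact (sq_le_one_iff₀ hy0).1 this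
  have hV1 : V ≤ 1 := by
    have := sq_nonneg y
    linarith
  have hG : 2 * τ ^ (-(κ + 2 * θ)) * ‖x - x₀‖ ≤ 2 * τ ^ (-(κ + θ)) := by
    have : τ ^ (-(κ + 2 * θ)) * ‖x - x₀‖ = τ ^ (-(κ + θ)) * y := by
      rw [hxy, show -(κ + θ) = -(κ + 2 * θ) + θ by ring, Real.rpow_add hτ0]; ring
    rw [mul_assoc, this]
    have : τ ^ (-(κ + θ)) * y ≤ τ ^ (-(κ + θ)) * 1 := by gcongr
    linarith
  have hG0 : 0 ≤ 2 * τ ^ (-(κ + 2 * θ)) * ‖x - x₀‖ := by positivity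
  have hlap : paraboloidPLaplace N P.p (τ ^ (-(κ + 2 * θ))) ‖x - x₀‖ ≤ θ / 4 * τ ^ (-κ - 1) := by
    refine le_trans ?_ e1
    have hxθ : ‖x - x₀‖ ≤ τ ^ θ := by
      rw [hxy]
      exact mul_le_of_le_one_left (by positivity) hy1
    have hNp : (0 : ℝ) ≤ N + (P.p - 2) := by
      have : (0 : ℝ) ≤ N := Nat.cast_nonneg N
      linarith
    have h1 : paraboloidPLaplace N P.p (τ ^ (-(κ + 2 * θ))) ‖x - x₀‖
        ≤ paraboloidPLaplace N P.p (τ ^ (-(κ + 2 * θ))) (τ ^ θ) := by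
      unfold paraboloidPLaplace
      have : ‖x - x₀‖ ^ (P.p - 2) ≤ (τ ^ θ) ^ (P.p - 2) :=
        Real.rpow_le_rpow (norm_nonneg _) hxθ (by linarith)
      gcongr
    refine h1.trans (le_of_eq ?_)
    unfold paraboloidPLaplace
    rw [Real.mul_rpow zero_le_two (by positivity), ← Real.rpow_mul hτ0.le, ← Real.rpow_mul hτ0.le,
      show -(κ * (P.p - 1) + θ * P.p) = -(κ + 2 * θ) * (P.p - 1) + θ * (P.p - 2) by ring,
      Real.rpow_add hτ0]
    ring
  set W := τ ^ (-κ) - τ ^ (-(κ + 2 * θ)) * ‖x - x₀‖ ^ 2 with hW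
  set G := 2 * τ ^ (-(κ + 2 * θ)) * ‖x - x₀‖ with hGdef
  have hWle : W ≤ τ ^ (-κ) := by
    rw [hWV]
    exact mul_le_of_le_one_right hτκ.le hV1
  have hdamp : P.β * W ^ P.l * G ^ P.q ≤ θ / 4 * τ ^ (-κ - 1) := by
    refine le_trans ?_ e2
    have h1 : W ^ P.l ≤ (τ ^ (-κ)) ^ P.l := Real.rpow_le_rpow hx.le hWle hl.le
    have h2 : G ^ P.q ≤ (2 * τ ^ (-(κ + θ))) ^ P.q := Real.rpow_le_rpow hG0 hG hq
    have h3 : P.β * W ^ P.l * G ^ P.q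
        ≤ P.β * (τ ^ (-κ)) ^ P.l * (2 * τ ^ (-(κ + θ))) ^ P.q := by gcongr
    refine h3.trans (le_of_eq ?_)
    rw [Real.mul_rpow zero_le_two (by positivity), ← Real.rpow_mul hτ0.le, ← Real.rpow_mul hτ0.le,
      show -(κ * P.l + (κ + θ) * P.q) = -κ * P.l + -(κ + θ) * P.q by ring, Real.rpow_add hτ0]
    ring
  have hgrad : -(θ / 4 * τ ^ (-κ - 1)) ≤ P.μ * G ^ P.r := by
    have h2 : G ^ P.r ≤ (2 * τ ^ (-(κ + θ))) ^ P.r := Real.rpow_le_rpow hG0 hG hr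
    have h3 : |P.μ| * G ^ P.r ≤ |P.μ| * 2 ^ P.r * τ ^ (-((κ + θ) * P.r)) := by
      have : |P.μ| * G ^ P.r ≤ |P.μ| * (2 * τ ^ (-(κ + θ))) ^ P.r := by gcongr
      refine this.trans (le_of_eq ?_)
      rw [Real.mul_rpow zero_le_two (by positivity), ← Real.rpow_mul hτ0.le,
        show -((κ + θ) * P.r) = -(κ + θ) * P.r by ring]
      ring
    have h4 : -|P.μ| * G ^ P.r ≤ P.μ * G ^ P.r := by
      gcongr
      exact neg_abs_le _
    linarith
  have habs : P.ν * W ^ P.σ ≤ θ / 4 * τ ^ (-κ - 1) := by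
    refine le_trans ?_ e4
    have h1 : W ^ P.σ ≤ (τ ^ (-κ)) ^ P.σ := Real.rpow_le_rpow hx.le hWle hσ.le
    rw [← Real.rpow_mul hτ0.le, show -κ * P.σ = -(κ * P.σ) by ring] at h1
    gcongr
  have hball' : Metric.ball x₀ (τ ^ θ / 2) ⊆ Ω := by
    refine (Metric.ball_subset_ball ?_).trans hball
    have : 0 < τ ^ θ := by positivity
    linarith
  have hJ := le_integral_paraboloid (κ := κ) hΩo hΩ hs hτ0 hball'
  generalize ∫ y in Ω, max (τ ^ (-κ) - τ ^ (-(κ + 2 * θ)) * ‖y - x₀‖ ^ 2) 0 ^ P.s = J at hJ ⊢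
  have hJ0 : 0 ≤ J := le_trans (by positivity) hJ
  have hr1 : 0 ≤ P.α * W ^ P.k * J :=
    mul_nonneg (mul_nonneg hα.le (Real.rpow_nonneg hx.le _)) hJ0
  have hr2 : 0 ≤ P.γ * W ^ P.m := mul_nonneg hγ.le (Real.rpow_nonneg hx.le _)
  have hτ1 : 0 < τ ^ (-κ - 1) := by positivity
  have htime : κ * τ ^ (-κ - 1) - (κ + 2 * θ) * τ ^ (-(κ + 2 * θ) - 1) * ‖x - x₀‖ ^ 2
      = τ ^ (-κ - 1) * ((κ + 2 * θ) * V - 2 * θ) := by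
    have := sq1 (-1)
    rw [← sub_eq_add_neg, ← sub_eq_add_neg] at this
    rw [mul_assoc, this, hV]; ring
  rw [htime]
  unfold Params.source
  rcases le_or_gt V V₀ with hVV | hVV
  · have h1 : (κ + 2 * θ) * V - 2 * θ ≤ -θ := by
      have : (κ + 2 * θ) * V ≤ (κ + 2 * θ) * V₀ := by gcongr
      have h2 : (κ + 2 * θ) * V₀ = θ := by rw [hV₀]; field_simp
      linarith
    have h2 : τ ^ (-κ - 1) * ((κ + 2 * θ) * V - 2 * θ) ≤ τ ^ (-κ - 1) * -θ := by gcongr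
    linarith
  · have h1 : (κ + 2 * θ) * V - 2 * θ ≤ κ := by
      have : (κ + 2 * θ) * V ≤ (κ + 2 * θ) * 1 := by gcongr
      linarith
    have h2 : τ ^ (-κ - 1) * ((κ + 2 * θ) * V - 2 * θ) ≤ τ ^ (-κ - 1) * κ := by gcongr
    have hpow : ∀ c : ℝ, 0 ≤ c → V₀ ^ c * τ ^ (-(κ * c)) ≤ W ^ c := fun c hc => by
      rw [hWV, Real.mul_rpow hτκ.le hV0.le, ← Real.rpow_mul hτ0.le,
        show -κ * c = -(κ * c) by ring, mul_comm]
      have := Real.rpow_le_rpow hV₀0.le hVV.le hc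
      gcongr
    have h3 : (κ + θ) * τ ^ (-κ - 1) ≤ P.α * W ^ P.k * J + P.γ * W ^ P.m := by
      rcases e5 with e5 | e5
      · have := mul_le_mul_of_nonneg_left (hpow P.m (by linarith)) hγ.le
        linarith
      · have h4 : P.α * V₀ ^ P.k * Λ * τ ^ (-(κ * (P.k + P.s) - θ * N))
            = P.α * (V₀ ^ P.k * τ ^ (-(κ * P.k))) * (Λ * τ ^ (-(κ * P.s) + θ * N)) := by
          rw [show -(κ * (P.k + P.s) - θ * N) = -(κ * P.k) + (-(κ * P.s) + θ * N) by ring,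
            Real.rpow_add hτ0]
          ring
        have h5 : P.α * (V₀ ^ P.k * τ ^ (-(κ * P.k))) * (Λ * τ ^ (-(κ * P.s) + θ * N))
            ≤ P.α * W ^ P.k * J := by
          have := hpow P.k (by linarith)
          gcongr
        linarith
    linarith

/-! ### Blow-up -/

lemma ofReal_le_supNorm {N : ℕ} {Ω : Set (E N)} (hΩo : IsOpen Ω) {u : ℝ × E N → ℝ} {t : ℝ}
    (hu : ContinuousOn (fun x => u (t, x)) Ω) {x : E N} (hx : x ∈ Ω) {c : ℝ} (hc : c ≤ u (t, x)) :
    ENNReal.ofReal c ≤ supNorm Ω u t := by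
  refine (ENNReal.ofReal_le_ofReal hc).trans ((Real.ofReal_le_enorm _).trans ?_)
  have hae : ∀ᵐ y ∂(volume.restrict Ω), ‖u (t, y)‖ₑ ≤ supNorm Ω u t := by
    rw [supNorm, eLpNorm_exponent_top]
    exact enorm_ae_le_eLpNormEssSup _ _
  have hopen : IsOpen (Ω ∩ (fun y => ‖u (t, y)‖ₑ) ⁻¹' Ioi (supNorm Ω u t)) :=
    (continuous_enorm.comp_continuousOn hu).isOpen_inter_preimage hΩo isOpen_Ioi
  have hnull : volume (Ω ∩ (fun y => ‖u (t, y)‖ₑ) ⁻¹' Ioi (supNorm Ω u t)) = 0 := by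
    rw [ae_restrict_iff' hΩo.measurableSet, ae_iff] at hae
    refine measure_mono_null (fun y hy => ?_) hae
    simp only [mem_ofPred_eq, Classical.not_imp, not_le]
    exact hy
  by_contra hlt
  have : x ∈ (∅ : Set (E N)) := by
    rw [← (hopen.measure_eq_zero_iff volume).1 hnull]
    exact ⟨hx, not_le.1 hlt⟩
  exact this

end PLaplace

theorem theorem3p1 {N : ℕ} (hN : 1 ≤ N) (Ω : Set (PLaplace.E N))
    (hΩ_open : IsOpen Ω) (hΩ_conn : IsConnected Ω) (hΩ_bdd : Bornology.IsBounded Ω)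
    (hΩ_smooth : PLaplace.HasSmoothBoundary Ω)
    (P : PLaplace.Params)
    (hα : 0 < P.α) (hβ : 0 ≤ P.β) (hγ : 0 < P.γ) (hν : 0 ≤ P.ν)
    (hl : 0 < P.l) (hσ : 0 < P.σ) (hk : 1 ≤ P.k) (hs : 1 ≤ P.s) (hm1 : 1 ≤ P.m)
    (hr : P.p - 1 ≤ P.r) (hp : P.p / 2 ≤ P.p - 1)
    (hm : max (P.p - 1) (max P.r P.σ) < P.m)
    (hq : P.p / 2 ≤ P.q) (hql : 1 < P.q + P.l)
    (hks : max (P.p - 1) (max (P.q + P.l) P.r) < P.k + P.s)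
    (x₀ : PLaplace.E N) (ρ : ℝ) (hρ : 0 < ρ) (hball : Metric.ball x₀ ρ ⊆ Ω) :
    ∃ C δ t₀ c κ : ℝ, 0 < C ∧ 0 < δ ∧ 0 ≤ t₀ ∧ t₀ < 1 / δ ∧ 0 < c ∧ 0 < κ ∧
      ∀ u₀ : PLaplace.E N → ℝ, PLaplace.IsInitialDatum Ω u₀ →
        (∀ x ∈ Metric.ball x₀ ρ, C ≤ u₀ x) →
        -- no solution lives longer than `1/δ - t₀`, and its sup norm is bounded below by a
        -- function of time that tends to infinity at `1/δ - t₀`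
        (∀ (T : ENNReal) (u : ℝ × PLaplace.E N → ℝ), PLaplace.IsSolutionUpTo P Ω u₀ T u →
          T ≤ ENNReal.ofReal (1 / δ - t₀) ∧
          ∀ t : ℝ, 0 ≤ t → ENNReal.ofReal t < T →
            ENNReal.ofReal (c * (1 / δ - t₀ - t) ^ (-κ)) ≤ PLaplace.supNorm Ω u t) ∧
        -- a maximal solution blows up in `L^∞` at a finite time
        (∀ (T : ENNReal) (u : ℝ × PLaplace.E N → ℝ), PLaplace.IsMaximalUpTo P Ω u₀ T u →
          T ≤ ENNReal.ofReal (1 / δ - t₀) ∧ PLaplace.BlowsUpAt Ω u T) := by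
  have hp2 : 2 ≤ P.p := by linarith
  obtain ⟨κ, θ, τ₀, hκ, hθ, hτ₀, hτ1, hτρ, hsub⟩ :=
    PLaplace.exists_self_similar_subsolution hΩ_open hΩ_bdd hα hβ hγ hν hl hσ hk hs hm1 hp2
      (by linarith) (by linarith) hm hks hρ hball
  have hτρ0 : 0 < τ₀ ^ θ := by positivity
  have hx₀ : x₀ ∈ Ω := hball (Metric.mem_ball_self hρ)
  -- `1 / δ - t₀` is the lifetime `τ₀` of the barrier, and `τ₀ ^ (-κ)` is its largest initial value
  refine ⟨τ₀ ^ (-κ), 1, 1 - τ₀, 1, κ, by positivity, one_pos, by linarith, by linarith, one_pos,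
    hκ, fun u₀ _ hC => ?_⟩
  simp only [div_one, sub_sub_cancel, one_mul]
  -- the solution stays above the centre of the barrier as long as both exist
  have lower : ∀ (T : ENNReal) (u : ℝ × PLaplace.E N → ℝ), PLaplace.IsSolutionUpTo P Ω u₀ T u →
      ∀ t : ℝ, 0 ≤ t → ENNReal.ofReal t < T → t < τ₀ → (τ₀ - t) ^ (-κ) ≤ u (t, x₀) := by
    intro T u hu t ht htT htτ
    obtain ⟨S₁, -, htS₁, hS₁T⟩ := ENNReal.lt_iff_exists_real_btwn.1 htT
    have hS₁0 : 0 < S₁ := by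
      by_contra hcon
      rw [ENNReal.ofReal_of_nonpos (not_lt.1 hcon)] at htS₁
      exact not_lt_zero htS₁
    have htS : t < S₁ := (ENNReal.ofReal_lt_ofReal_iff hS₁0).1 htS₁
    obtain ⟨-, hcont, hinit, -, -⟩ := hu.2 S₁ hS₁0 hS₁T
    rcases ht.eq_or_lt with rfl | ht0
    · rw [sub_zero, hinit x₀ hx₀]
      exact hC x₀ (Metric.mem_ball_self hρ)
    obtain ⟨S, htS', hSmin⟩ := exists_between (lt_min htS htτ)
    have hS0 : 0 < S := ht0.trans htS'
    have hSS₁ : S < S₁ := hSmin.trans_le (min_le_left _ _)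
    have hSτ : S < τ₀ := hSmin.trans_le (min_le_right _ _)
    have hsol := hu.2 S hS0 ((ENNReal.ofReal_le_ofReal hSS₁.le).trans_lt hS₁T)
    have hτpos : ∀ t ∈ Icc 0 S, 0 < τ₀ - t := fun t ht => by linarith [ht.2]
    have deriv_pow : ∀ c : ℝ, ∀ t ∈ Icc 0 S,
        HasDerivAt (fun t => (τ₀ - t) ^ (-c)) (c * (τ₀ - t) ^ (-c - 1)) t := fun c t ht => by
      have h1 : HasDerivAt (fun t : ℝ => τ₀ - t) (-1) t := (hasDerivAt_id t).const_sub τ₀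
      refine (h1.rpow_const (p := -c) (Or.inl (hτpos t ht).ne')).congr_deriv ?_
      ring
    have cont_pow : ∀ c : ℝ, ContinuousOn (fun t => c * (τ₀ - t) ^ (-c - 1)) (Icc 0 S) := fun c =>
      continuousOn_const.mul ((continuousOn_const.sub continuousOn_id).rpow_const
        fun t ht => Or.inl (hτpos t ht).ne')
    have comp := PLaplace.barrier_le hΩ_open hΩ_bdd hα hβ hγ hν hl hσ hk hs hm1 hp2 hq
      (by linarith) hS0 hsol
      (hcont.mono (prod_mono (fun t ht => ⟨ht.1, ht.2.trans_lt hSS₁⟩) le_rfl))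
      (a := fun t => (τ₀ - t) ^ (-κ)) (b := fun t => (τ₀ - t) ^ (-(κ + 2 * θ)))
      (deriv_pow κ) (deriv_pow (κ + 2 * θ)) (cont_pow κ) (cont_pow (κ + 2 * θ))
      (fun t ht => Real.rpow_pos_of_pos (hτpos t ht) _) (x₀ := x₀) (R₀ := τ₀ ^ θ) hτρ0.le
      ((Metric.closedBall_subset_ball hτρ).trans hball) ?_ ?_ ?_
    · have := comp (t, x₀) ⟨⟨ht0, htS'⟩, hx₀⟩
      simpa [PLaplace.barrier] using this
    · intro t ht
      have hpos := hτpos t ht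
      have h1 : (τ₀ - t) ^ (-κ) = (τ₀ - t) ^ (-(κ + 2 * θ)) * ((τ₀ - t) ^ θ) ^ 2 := by
        rw [← Real.rpow_natCast, ← Real.rpow_mul hpos.le, ← Real.rpow_add hpos]
        congr 1
        push_cast
        ring
      have h2 : (τ₀ - t) ^ θ ≤ τ₀ ^ θ := Real.rpow_le_rpow hpos.le (by linarith [ht.1]) hθ.le
      rw [h1]
      gcongr
    · intro x hx
      simp only [PLaplace.barrier, sub_zero]
      have hb0 : 0 < τ₀ ^ (-(κ + 2 * θ)) := by positivity
      by_cases hxb : x ∈ Metric.ball x₀ ρ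
      · rw [hinit x hx]
        have := hC x hxb
        have h3 : 0 ≤ τ₀ ^ (-(κ + 2 * θ)) * ‖x - x₀‖ ^ 2 := by positivity
        linarith
      · rw [Metric.mem_ball, dist_eq_norm, not_lt] at hxb
        have hu0 := hsol.1 (0, x) ⟨⟨le_rfl, hS0⟩, subset_closure hx⟩
        have h1 : τ₀ ^ (-κ) = τ₀ ^ (-(κ + 2 * θ)) * (τ₀ ^ θ) ^ 2 := by
          rw [← Real.rpow_natCast, ← Real.rpow_mul hτ₀.le, ← Real.rpow_add hτ₀]
          congr 1
          push_cast
          ring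
        have h2 : (τ₀ ^ θ) ^ 2 ≤ ‖x - x₀‖ ^ 2 :=
          pow_le_pow_left₀ hτρ0.le (hτρ.le.trans hxb) 2
        have h3 := mul_le_mul_of_nonneg_left h2 hb0.le
        linarith
    · intro t ht x _ hpos
      exact hsub (τ₀ - t) ⟨hτpos t (Ioo_subset_Icc_self ht), by linarith [ht.1]⟩ x hpos
  have bound : ∀ (T : ENNReal) (u : ℝ × PLaplace.E N → ℝ), PLaplace.IsSolutionUpTo P Ω u₀ T u →
      T ≤ ENNReal.ofReal τ₀ := by
    intro T u hu
    by_contra hcon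
    obtain ⟨S₁, -, hτS₁, hS₁T⟩ := ENNReal.lt_iff_exists_real_btwn.1 (not_le.1 hcon)
    have hS₁0 : 0 < S₁ := by
      by_contra hcon'
      rw [ENNReal.ofReal_of_nonpos (not_lt.1 hcon')] at hτS₁
      exact not_lt_zero hτS₁
    have hτS : τ₀ < S₁ := (ENNReal.ofReal_lt_ofReal_iff hS₁0).1 hτS₁
    obtain ⟨-, hcont, -⟩ := hu.2 S₁ hS₁0 hS₁T
    have hc : ContinuousOn (fun t => u (t, x₀)) (Icc 0 τ₀) :=
      hcont.comp (by fun_prop) fun t ht => ⟨⟨ht.1, ht.2.trans_lt hτS⟩, subset_closure hx₀⟩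
    obtain ⟨B, hB⟩ := isCompact_Icc.exists_bound_of_continuousOn hc
    -- a time at which the barrier exceeds the bound of `u` on `[0, τ₀]`
    set ε := min τ₀ ((|B| + 1) ^ (-(1 / κ))) with hε
    have hB1 : 0 < |B| + 1 := by positivity
    have hε0 : 0 < ε := lt_min hτ₀ (by positivity)
    have h1 : |B| + 1 ≤ ε ^ (-κ) := by
      have h2 : ((|B| + 1) ^ (-(1 / κ))) ^ (-κ) = |B| + 1 := by
        rw [← Real.rpow_mul hB1.le, show -(1 / κ) * -κ = 1 by field_simp, Real.rpow_one]
      rw [← h2]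
      exact Real.rpow_le_rpow_of_nonpos hε0 (min_le_right _ _) (by linarith)
    have hετ : ε ≤ τ₀ := min_le_left _ _
    have h3 := lower T u hu (τ₀ - ε) (by linarith)
      (lt_of_le_of_lt (ENNReal.ofReal_le_ofReal (by linarith)) (not_le.1 hcon)) (by linarith)
    rw [sub_sub_cancel] at h3
    have h4 := (le_abs_self _).trans (hB (τ₀ - ε) ⟨by linarith, by linarith⟩)
    linarith [le_abs_self B]
  refine ⟨fun T u hu => ⟨bound T u hu, fun t ht htT => ?_⟩, fun T u hu => ?_⟩
  · have htτ : t < τ₀ := (ENNReal.ofReal_lt_ofReal_iff hτ₀).1 (htT.trans_le (bound T u hu))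
    obtain ⟨S₁, -, htS₁, hS₁T⟩ := ENNReal.lt_iff_exists_real_btwn.1 htT
    have hS₁0 : 0 < S₁ := by
      by_contra hcon
      rw [ENNReal.ofReal_of_nonpos (not_lt.1 hcon)] at htS₁
      exact not_lt_zero htS₁
    have htS : t < S₁ := (ENNReal.ofReal_lt_ofReal_iff hS₁0).1 htS₁
    obtain ⟨-, hcont, -⟩ := hu.2 S₁ hS₁0 hS₁T
    exact PLaplace.ofReal_le_supNorm hΩ_open
      (hcont.comp (by fun_prop) fun x hx => ⟨⟨ht, htS⟩, subset_closure hx⟩) hx₀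
      (lower T u hu t ht htT htτ)
  · have hT := bound T u hu.1
    exact ⟨hT, hu.2.resolve_left (ne_top_of_le_ne_top ENNReal.ofReal_ne_top hT)⟩
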